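/- Let $(M,\omega)$ be a symplectic manifold (smooth, finite-dimensional, Hausdorff, second countable, without boundary; not necessarily compact or connected), with Poisson bracket $\{\cdot,\cdot\}$. Sets $X_1,\dots,X_N\subseteq M$ are said to *intersect cyclically* if $X_i\cap X_j=\emptyset$ whenever $i\notin\{j-1,j,j+1\}$, with $j\pm1$ taken modulo $N$. A *marked domain* $\underline\Delta=(\Delta,p_1,\dots,p_N)$ consists of a compact convex set $\Delta\subset\mathbb R^2$ of area $1$ whose boundary is either smooth or polygonal, and of $N$ distinct points $p_1,\dots,p_N\in\partial\Delta$ in counterclockwise cyclic order. Let $\gamma_i\subset\partial\Delta$ be the closed arc running counterclockwise from $p_i$ to $p_{i+1}$ (indices modulo $N$). For compact $X_1,\dots,X_N\subseteq M$ let $\mathcal F'_{\underline\Delta}(X_1,\dots,X_N)$ be the set of all smooth maps $\Phi=(\Phi_1,\Phi_2)\colon M\to\Delta\subset\mathbb R^2$ such that 1. there is a point $(a_1,a_2)\in\Delta$ for which $\Phi_1-a_1$ and $\Phi_2-a_2$ are compactly supported, and 2. for every $i$ there is an open set $U_i\supseteq X_i$ with $\Phi(U_i)\subseteq\gamma_i$.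 Put $$\mathrm{Pb}_N^{\underline\Delta}(X_1,\dots,X_N)=\inf_{\Phi\in\mathcal F'_{\underline\Delta}(X_1,\dots,X_N)}\ \sup_{x\in M}\bigl|\{\Phi_1,\Phi_2\}(x)\bigr|\in[0,\infty].$$ **Theorem.** Let $N\ge4$ and let $X_1,\dots,X_N\subseteq M$ be compact sets that intersect cyclically. Then $$\mathrm{Pb}_N(X_1,\dots,X_N)=\mathrm{Pb}_{N-1}(X_1,\dots,X_{N-2},X_{N-1}\cup X_N),$$ where the two sides may be computed with any marked domains: for every marked domain $\underline\Delta$ with $N$ marked points and every marked domain $\underline\Delta'$ with $N-1$ marked points, $\mathrm{Pb}_N^{\underline\Delta}(X_1,\dots,X_N)=\mathrm{Pb}_{N-1}^{\underline\Delta'}(X_1,\dots,X_{N-2},X_{N-1}\cup X_N)$. -/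

import Mathlib

open Set MeasureTheory Bundle
open scoped Manifold ContDiff ENNReal Topology

noncomputable section

/-! ### Symplectic manifolds and the Poisson bracket -/

/-- A symplectic form on the smooth manifold `M` modelled on `E`: a smooth, fibrewise alternating
and nondegenerate, closed 2-form. -/
structure SymplecticForm (E : Type*) [NormedAddCommGroup E] [NormedSpace ℝ E]
    (M : Type*) [TopologicalSpace M] [ChartedSpace E M] [IsManifold 𝓘(ℝ, E) ∞ M] where
  /-- The bilinear form on each tangent space. -/
  form (x : M) : TangentSpace 𝓘(ℝ, E) x →L[ℝ] TangentSpace 𝓘(ℝ, E) x →L[ℝ] ℝ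
  alternating (x : M) (v : TangentSpace 𝓘(ℝ, E) x) : form x v v = 0
  nondegenerate (x : M) (v : TangentSpace 𝓘(ℝ, E) x) (hv : ∀ w, form x v w = 0) : v = 0
  smooth : ContMDiff 𝓘(ℝ, E) (𝓘(ℝ, E).prod 𝓘(ℝ, E →L[ℝ] E →L[ℝ] ℝ)) ∞
    (fun x : M ↦ TotalSpace.mk' (E →L[ℝ] E →L[ℝ] ℝ) x (form x))
  /-- `dω = 0`, written in every chart: for constant vector fields `u, v, w` on the model space,
  `dω(u, v, w) = ∂_u ω(v, w) + ∂_v ω(w, u) + ∂_w ω(u, v)`. Here `coord a b y` is the value on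
  `(a, b)` of the pullback of the form by the inverse chart. -/
  closed (x₀ : M) (y : E) (hy : y ∈ (chartAt E x₀).target) (u v w : E) :
    let coord : E → E → E → ℝ := fun a b z ↦
      form ((chartAt E x₀).symm z)
        (mfderiv 𝓘(ℝ, E) 𝓘(ℝ, E) (chartAt E x₀).symm z a)
        (mfderiv 𝓘(ℝ, E) 𝓘(ℝ, E) (chartAt E x₀).symm z b)
    fderiv ℝ (coord v w) y u + fderiv ℝ (coord w u) y v + fderiv ℝ (coord u v) y w = 0

namespace SymplecticForm

variable {E : Type*} [NormedAddCommGroup E] [NormedSpace ℝ E] [FiniteDimensional ℝ E]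
  {M : Type*} [TopologicalSpace M] [ChartedSpace E M] [IsManifold 𝓘(ℝ, E) ∞ M]

/-- Every covector is `ω(v, ·)` for a vector `v`. -/
theorem exists_dual (σ : SymplecticForm E M) (x : M) (α : TangentSpace 𝓘(ℝ, E) x →L[ℝ] ℝ) :
    ∃ v : TangentSpace 𝓘(ℝ, E) x, σ.form x v = α := by
  have hfin : FiniteDimensional ℝ (TangentSpace 𝓘(ℝ, E) x) := inferInstanceAs
    (FiniteDimensional ℝ E)
  let L : TangentSpace 𝓘(ℝ, E) x →ₗ[ℝ] Module.Dual ℝ (TangentSpace 𝓘(ℝ, E) x) :=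
    { toFun := fun v ↦ (σ.form x v : TangentSpace 𝓘(ℝ, E) x →ₗ[ℝ] ℝ)
      map_add' := fun a b ↦ by ext w; simp
      map_smul' := fun c a ↦ by ext w; simp }
  have hinj : Function.Injective L := by
    rw [injective_iff_map_eq_zero]
    intro v hv
    exact σ.nondegenerate x v fun w ↦ LinearMap.congr_fun hv w
  have hsurj : Function.Surjective L :=
    (LinearMap.injective_iff_surjective_of_finrank_eq_finrank
      Subspace.dual_finrank_eq.symm).1 hinj
  obtain ⟨v, hv⟩ := hsurj (α : TangentSpace 𝓘(ℝ, E) x →ₗ[ℝ] ℝ)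
  exact ⟨v, ContinuousLinearMap.ext fun w ↦ LinearMap.congr_fun hv w⟩

/-- The Hamiltonian vector field `X_F` of `F`, determined by `ω(X_F, ·) = dF`. -/
def hamiltonianVector (σ : SymplecticForm E M) (F : M → ℝ) (x : M) : TangentSpace 𝓘(ℝ, E) x :=
  Classical.choose (σ.exists_dual x (mvfderiv 𝓘(ℝ, E) F x))

theorem form_hamiltonianVector (σ : SymplecticForm E M) (F : M → ℝ) (x : M) :
    σ.form x (σ.hamiltonianVector F x) = mvfderiv 𝓘(ℝ, E) F x :=
  Classical.choose_spec (σ.exists_dual x (mvfderiv 𝓘(ℝ, E) F x))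

/-- The Poisson bracket `{F, G} = dG(X_F) = -ω(X_F, X_G)`. -/
def poissonBracket (σ : SymplecticForm E M) (F G : M → ℝ) (x : M) : ℝ :=
  mvfderiv 𝓘(ℝ, E) G x (σ.hamiltonianVector F x)

end SymplecticForm

/-! ### Planar domains with marked boundary points -/

/-- The boundary of `Δ` is a smooth curve: near each of its points it is the zero set of a smooth
function whose differential does not vanish at the point. -/
def HasSmoothBoundary (Δ : Set (ℝ × ℝ)) : Prop :=
  ∀ x ∈ frontier Δ, ∃ f : ℝ × ℝ → ℝ, ContDiff ℝ ∞ f ∧ fderiv ℝ f x ≠ 0 ∧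
    ∀ᶠ y in 𝓝 x, (y ∈ frontier Δ ↔ f y = 0)

/-- A convex polygon (possibly degenerate): the convex hull of finitely many points. -/
def IsConvexPolygon (Δ : Set (ℝ × ℝ)) : Prop :=
  ∃ s : Finset (ℝ × ℝ), Δ = convexHull ℝ (s : Set (ℝ × ℝ))

/-- The open ray from `o` in the direction of angle `t`. -/
def planeRay (o : ℝ × ℝ) (t : ℝ) : Set (ℝ × ℝ) :=
  {x | ∃ r : ℝ, 0 < r ∧ x = o + r • (Real.cos t, Real.sin t)}

/-- A compact convex planar domain of area one with smooth or polygonal boundary, together with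
`N` distinct boundary points in counterclockwise cyclic order. The order is recorded by the angles
under which the points are seen from an interior point `center` (any interior point serves): they
increase, and by less than a full turn. -/
structure MarkedDomain (N : ℕ) where
  carrier : Set (ℝ × ℝ)
  isCompact : IsCompact carrier
  convex : Convex ℝ carrier
  area : volume carrier = 1
  boundary : HasSmoothBoundary carrier ∨ IsConvexPolygon carrier
  /-- The marked points. -/
  pt : Fin N → ℝ × ℝ
  pt_mem (i : Fin N) : pt i ∈ frontier carrier
  center : ℝ × ℝ
  center_mem : center ∈ interior carrier
  angle : Fin N → ℝ
  pt_mem_ray (i : Fin N) : pt i ∈ planeRay center (angle i)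
  angle_strictMono : StrictMono angle
  angle_lt (i j : Fin N) : angle j < angle i + 2 * Real.pi

namespace MarkedDomain

/-- The angle of the marked point that follows the `i`-th one counterclockwise; a full turn is
added when the first point is reached again. -/
def nextAngle {N : ℕ} (D : MarkedDomain N) (i : Fin N) : ℝ :=
  if h : (i : ℕ) + 1 < N then D.angle ⟨i + 1, h⟩
  else D.angle ⟨0, i.pos⟩ + 2 * Real.pi

/-- The closed boundary arc running counterclockwise from the `i`-th marked point to the
next one. -/
def arc {N : ℕ} (D : MarkedDomain N) (i : Fin N) : Set (ℝ × ℝ) :=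
  {x ∈ frontier D.carrier | ∃ t ∈ Icc (D.angle i) (D.nextAngle i), x ∈ planeRay D.center t}

end MarkedDomain

/-! ### The invariant -/

/-- `X i` and `X j` are disjoint unless `i` and `j` are equal or cyclically adjacent. The
arithmetic in `Fin N` is modulo `N`. -/
def IntersectCyclically {N : ℕ} [NeZero N] {M : Type*} (X : Fin N → Set M) : Prop :=
  ∀ i j : Fin N, i ≠ j - 1 → i ≠ j → i ≠ j + 1 → X i ∩ X j = ∅

/-- The tuple `(X_1, …, X_{n-1}, X_n ∪ X_{n+1})` obtained from `(X_1, …, X_{n+1})`. -/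
def mergeLastTwo {n : ℕ} {M : Type*} (X : Fin (n + 1) → Set M) : Fin n → Set M := fun i ↦
  if (i : ℕ) + 1 = n then X i.castSucc ∪ X (Fin.last n) else X i.castSucc

/-- The class of smooth maps `Φ : M → Δ`, constant outside a compact set, that map a neighbourhood
of each `X i` into the `i`-th boundary arc. -/
structure IsAdmissible (E : Type*) [NormedAddCommGroup E] [NormedSpace ℝ E]
    {M : Type*} [TopologicalSpace M] [ChartedSpace E M]
    {N : ℕ} (D : MarkedDomain N) (X : Fin N → Set M) (Φ : M → ℝ × ℝ) : Prop where
  smooth : ContMDiff 𝓘(ℝ, E) 𝓘(ℝ, ℝ × ℝ) ∞ Φ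
  mem (x : M) : Φ x ∈ D.carrier
  compactSupport : ∃ p ∈ D.carrier,
    HasCompactSupport (fun x ↦ (Φ x).1 - p.1) ∧ HasCompactSupport (fun x ↦ (Φ x).2 - p.2)
  maps_arc (i : Fin N) : ∃ U : Set M, IsOpen U ∧ X i ⊆ U ∧ Φ '' U ⊆ D.arc i

/-- `Pb_N(X_1, …, X_N)` computed with the domain `D`: the infimum over all admissible `Φ` of the
supremum norm of `{Φ₁, Φ₂}`. -/
def Pb {E : Type*} [NormedAddCommGroup E] [NormedSpace ℝ E] [FiniteDimensional ℝ E]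
    {M : Type*} [TopologicalSpace M] [ChartedSpace E M] [IsManifold 𝓘(ℝ, E) ∞ M]
    (σ : SymplecticForm E M) {N : ℕ} (D : MarkedDomain N) (X : Fin N → Set M) : ℝ≥0∞ :=
  ⨅ (Φ : M → ℝ × ℝ) (_ : IsAdmissible E D X Φ),
    ⨆ x : M, ‖σ.poissonBracket (fun y ↦ (Φ y).1) (fun y ↦ (Φ y).2) x‖ₑ

end

/-! Up to a factor arbitrarily close to 1, every marked domain can be replaced by the round disc,
and on the disc the marked points can be moved, merged or split at no cost to the bracket.

Composing `Φ` with a planar map `T` multiplies the bracket by the Jacobian of `T`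
(`poissonBracket_comp`). So it suffices to have smooth maps from a domain to the disc and back, not
necessarily injective, whose Jacobians are at most `(1 + ε) ^ 5 * π` and `(1 + ε) / π` and which are
monotone on the boundary (`exists_map_body_to_disc`, `exists_map_disc_to_body`). Both are written in
polar coordinates: the angle is reparametrised so that sectors correspond according to area, and a
radial cutoff collapses the centre and the rim. Corners of a polygon are absorbed by a circle map
close to the identity that is flat over the corner directions, after which the radial function is
smooth (`IsPiecewiseSmooth.exists_reparametrization`).

On the disc, the map `Ψ` takes values in the circle near every `X i`, and a map into a curve has
zero bracket (`poissonBracket_eq_zero_of_circle`). Rotating `Ψ` by an angle function supported there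
therefore never increases the bracket (`exists_rotated_map`). At each point the requirement that the
sets land in prescribed new arcs confines the rotation angle to an intersection of intervals, which
is convex, so local choices are glued by a partition of unity. For `N ≥ 4` at most two consecutive
sets meet at a point, and an endpoint of the first target arc then satisfies both requirements.

The tuple of `N` sets is kept throughout. What varies is the assignment of sets to arcs, an
`IsStepMap`: the identity, or `mergeIndex`, which gives the last two sets the same arc. The two
inequalities are `Pb_le_Pb` with these assignments as source and target, in either order. -/

/-! ### Polar coordinates in the plane -/

/-- The point of the unit circle at angle `t`. -/
noncomputable def circ (t : ℝ) : ℝ × ℝ := (Real.cos t, Real.sin t)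

/-- The planar cross product, i.e. the determinant of two vectors. -/
def cross (u v : ℝ × ℝ) : ℝ := u.1 * v.2 - u.2 * v.1

/-- The Jacobian determinant of a map of the plane. -/
noncomputable def jac (T : ℝ × ℝ → ℝ × ℝ) (x : ℝ × ℝ) : ℝ :=
  cross (fderiv ℝ T x (1, 0)) (fderiv ℝ T x (0, 1))

/-- The Euclidean norm on the plane. -/
noncomputable def rad (x : ℝ × ℝ) : ℝ := ‖(⟨x.1, x.2⟩ : ℂ)‖

/-- The angle of `x`, normalised to lie in `(m - π, m + π]`. -/
noncomputable def angleFrom (m : ℝ) (x : ℝ × ℝ) : ℝ :=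
  m + Complex.arg ((⟨x.1, x.2⟩ : ℂ) * Complex.exp (-m * Complex.I))

theorem circ_add_two_pi (t : ℝ) : circ (t + 2 * Real.pi) = circ t := by
  simp [circ]

theorem circ_eq_circ {s t : ℝ} (h : circ s = circ t) : ∃ k : ℤ, s = t + k * (2 * Real.pi) := by
  have h1 := congrArg Prod.fst h
  have h2 := congrArg Prod.snd h
  simp only [circ] at h1 h2
  have : Complex.exp (s * Complex.I) = Complex.exp (t * Complex.I) := by
    rw [Complex.exp_mul_I, Complex.exp_mul_I]
    rw [← Complex.ofReal_cos, ← Complex.ofReal_cos, ← Complex.ofReal_sin, ← Complex.ofReal_sin,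
      h1, h2]
  obtain ⟨k, hk⟩ := Complex.exp_eq_exp_iff_exists_int.1 this
  refine ⟨k, ?_⟩
  have := congrArg Complex.im hk
  simpa using this

theorem contDiff_circ : ContDiff ℝ ∞ circ :=
  Real.contDiff_cos.prodMk Real.contDiff_sin

theorem toComplex_smul_circ (r t : ℝ) :
    (⟨(r • circ t).1, (r • circ t).2⟩ : ℂ) = r * Complex.exp (t * Complex.I) := by
  apply Complex.ext <;> simp [circ, Complex.exp_re, Complex.exp_im]

theorem rad_nonneg (x : ℝ × ℝ) : 0 ≤ rad x := norm_nonneg _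

theorem rad_smul_circ {r : ℝ} (hr : 0 ≤ r) (t : ℝ) : rad (r • circ t) = r := by
  rw [rad, toComplex_smul_circ]
  simp [Complex.norm_exp, abs_of_nonneg hr]

theorem rad_sq (x : ℝ × ℝ) : rad x ^ 2 = x.1 ^ 2 + x.2 ^ 2 := by
  rw [rad, Complex.sq_norm, Complex.normSq_apply]; ring

theorem rad_smul_circ_angleFrom (m : ℝ) (x : ℝ × ℝ) : rad x • circ (angleFrom m x) = x := by
  have key : (⟨(rad x • circ (angleFrom m x)).1, (rad x • circ (angleFrom m x)).2⟩ : ℂ)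
      = ⟨x.1, x.2⟩ := by
    rw [toComplex_smul_circ, angleFrom]
    set z : ℂ := ⟨x.1, x.2⟩ with hz
    have hr : (rad x : ℂ) = ‖z * Complex.exp (-m * Complex.I)‖ := by
      rw [rad, norm_mul, Complex.norm_exp]; simp [hz]
    rw [hr, Complex.ofReal_add, add_mul, Complex.exp_add, mul_left_comm,
      Complex.norm_mul_exp_arg_mul_I, mul_left_comm, ← Complex.exp_add]
    simp
  exact Prod.ext (congrArg Complex.re key) (congrArg Complex.im key)

theorem angleFrom_smul_circ {m r t : ℝ} (hr : 0 < r) (h1 : m - Real.pi < t)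
    (h2 : t ≤ m + Real.pi) : angleFrom m (r • circ t) = t := by
  rw [angleFrom, toComplex_smul_circ, mul_assoc, ← Complex.exp_add,
    Complex.arg_real_mul _ hr, show (t * Complex.I + -m * Complex.I : ℂ)
      = ((t - m : ℝ) : ℂ) * Complex.I by push_cast; ring, Complex.arg_exp_mul_I,
    (toIocMod_eq_self _).2]
  · ring
  · constructor <;> linarith

theorem mul_exp_mem_slitPlane {m r t : ℝ} (hr : 0 < r) (h1 : m - Real.pi < t)
    (h2 : t < m + Real.pi) :
    (⟨(r • circ t).1, (r • circ t).2⟩ : ℂ) * Complex.exp (-m * Complex.I) ∈ Complex.slitPlane := by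
  rw [Complex.mem_slitPlane_iff_arg]
  have := angleFrom_smul_circ hr h1 h2.le
  rw [angleFrom] at this
  refine ⟨?_, ?_⟩
  · intro h; rw [h] at this; linarith
  · rw [toComplex_smul_circ]
    simp [hr.ne']

theorem contDiffAt_angleFrom {m r t : ℝ} (hr : 0 < r) (h1 : m - Real.pi < t)
    (h2 : t < m + Real.pi) : ContDiffAt ℝ ∞ (angleFrom m) (r • circ t) := by
  have hz := mul_exp_mem_slitPlane hr h1 h2
  have h3 : ContDiffAt ℝ ∞ (fun x : ℝ × ℝ ↦
      (⟨x.1, x.2⟩ : ℂ) * Complex.exp (-m * Complex.I)) (r • circ t) := by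
    have : (fun x : ℝ × ℝ ↦ (⟨x.1, x.2⟩ : ℂ) * Complex.exp (-m * Complex.I)) =
        fun x : ℝ × ℝ ↦ Complex.equivRealProdCLM.symm x * Complex.exp (-m * Complex.I) := by
      ext x; rfl
    rw [this]
    exact (Complex.equivRealProdCLM.symm.contDiff.mul contDiff_const).contDiffAt
  have h4 : ContDiffAt ℝ ∞ Complex.log
      ((⟨(r • circ t).1, (r • circ t).2⟩ : ℂ) * Complex.exp (-m * Complex.I)) :=
    (Complex.contDiffAt_log hz).restrict_scalars ℝ
  have h5 := Complex.imCLM.contDiff.contDiffAt.comp (r • circ t)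
    (ContDiffAt.comp (r • circ t) h4 h3)
  refine contDiffAt_const.add (h5.congr_of_eventuallyEq (Filter.Eventually.of_forall fun x ↦ ?_))
  simp [Complex.log_im]

theorem contDiffAt_rad {x : ℝ × ℝ} (hx : rad x ≠ 0) : ContDiffAt ℝ ∞ rad x := by
  have h : rad = fun x : ℝ × ℝ ↦ √(x.1 ^ 2 + x.2 ^ 2) := by
    ext x; rw [← rad_sq, Real.sqrt_sq (rad_nonneg x)]
  have h0 : x.1 ^ 2 + x.2 ^ 2 ≠ 0 := by rw [← rad_sq]; positivity
  rw [h]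
  exact ContDiffAt.sqrt (by fun_prop) h0

theorem continuous_rad : Continuous rad := by
  have h : rad = fun x : ℝ × ℝ ↦ √(x.1 ^ 2 + x.2 ^ 2) := by
    ext x; rw [← rad_sq, Real.sqrt_sq (rad_nonneg x)]
  rw [h]; fun_prop

theorem cross_map (A : ℝ × ℝ →L[ℝ] ℝ × ℝ) (u v : ℝ × ℝ) :
    cross (A u) (A v) = cross (A (1, 0)) (A (0, 1)) * cross u v := by
  have h : ∀ u : ℝ × ℝ, A u = u.1 • A (1, 0) + u.2 • A (0, 1) := fun u ↦ by
    rw [← map_smul, ← map_smul, ← map_add]; congr 1; ext <;> simp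
  rw [h u, h v]
  simp [cross]; ring

theorem exists_periodic_shift {F : Type*} {P : ℝ → F} (hP : ∀ t, P (t + 2 * Real.pi) = P t)
    (t : ℝ) (k : ℤ) : P (t + k * (2 * Real.pi)) = P t :=
  (show Function.Periodic P (2 * Real.pi) from hP).int_mul k t

theorem hasFDerivAt_smul_circ (p : ℝ × ℝ) :
    HasFDerivAt (fun p : ℝ × ℝ ↦ p.1 • circ p.2) (fderiv ℝ (fun p : ℝ × ℝ ↦ p.1 • circ p.2) p) p ∧
    fderiv ℝ (fun p : ℝ × ℝ ↦ p.1 • circ p.2) p (1, 0) = circ p.2 ∧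
    fderiv ℝ (fun p : ℝ × ℝ ↦ p.1 • circ p.2) p (0, 1) =
      p.1 • (-Real.sin p.2, Real.cos p.2) := by
  have hc : HasFDerivAt (fun p : ℝ × ℝ ↦ circ p.2)
      ((ContinuousLinearMap.toSpanSingleton ℝ (-Real.sin p.2, Real.cos p.2)).comp
        (ContinuousLinearMap.snd ℝ ℝ ℝ)) p := by
    have h1 : HasDerivAt circ (-Real.sin p.2, Real.cos p.2) p.2 :=
      (Real.hasDerivAt_cos _).prodMk (Real.hasDerivAt_sin _)
    exact h1.hasFDerivAt.comp p hasFDerivAt_snd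
  have h : HasFDerivAt (fun p : ℝ × ℝ ↦ p.1 • circ p.2) _ p :=
    (hasFDerivAt_fst (𝕜 := ℝ) (p := p)).smul hc
  refine ⟨h.differentiableAt.hasFDerivAt, ?_, ?_⟩
  · rw [h.fderiv]; simp
  · rw [h.fderiv]; simp

/-- A smooth function of polar coordinates that is constant near the origin is a smooth function
on the plane; its Jacobian is computed in polar coordinates. -/
theorem exists_map_of_polar {P : ℝ × ℝ → ℝ × ℝ} (hP : ContDiff ℝ ∞ P)
    (hper : ∀ r t, P (r, t + 2 * Real.pi) = P (r, t)) {δ : ℝ} (hδ : 0 < δ) {c : ℝ × ℝ}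
    (hc : ∀ r t, r ≤ δ → P (r, t) = c) {K : ℝ}
    (hK : ∀ r t, 0 < r →
      |cross (fderiv ℝ P (r, t) (1, 0)) (fderiv ℝ P (r, t) (0, 1))| ≤ K * r) :
    ∃ T : ℝ × ℝ → ℝ × ℝ, ContDiff ℝ ∞ T ∧ (∀ r t, 0 ≤ r → T (r • circ t) = P (r, t)) ∧
      ∀ x, |jac T x| ≤ K := by
  set T : ℝ × ℝ → ℝ × ℝ := fun x ↦ P (rad x, angleFrom 0 x) with hT
  -- Two branches of the angle differ by a multiple of `2π`, and at the origin `P` does not depend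
  -- on the angle. Near a given point the branch centred at its own angle can thus be used, which
  -- keeps the cut of `arg` away.
  have hTm : ∀ m x, T x = P (rad x, angleFrom m x) := by
    intro m x
    by_cases h0 : rad x = 0
    · simp only [hT, h0]; rw [hc _ _ hδ.le, hc _ _ hδ.le]
    · have : circ (angleFrom 0 x) = circ (angleFrom m x) := by
        have := (rad_smul_circ_angleFrom 0 x).trans (rad_smul_circ_angleFrom m x).symm
        exact smul_right_injective _ h0 this
      obtain ⟨k, hk⟩ := circ_eq_circ this
      simp only [hT, hk]
      exact exists_periodic_shift (P := fun t ↦ P (rad x, t)) (hper _) _ k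
  have hTp : ∀ r t, 0 ≤ r → T (r • circ t) = P (r, t) := by
    intro r t hr
    rcases hr.eq_or_lt with rfl | hr
    · simp only [hT]; rw [hc _ _ hδ.le, hc _ _ (by rw [rad_smul_circ le_rfl]; exact hδ.le)]
    · rw [hTm t, rad_smul_circ hr.le, angleFrom_smul_circ hr] <;> linarith [Real.pi_pos]
  have hnear : ∀ x, rad x < δ → T =ᶠ[𝓝 x] fun _ ↦ c := by
    intro x hx
    filter_upwards [(isOpen_lt continuous_rad continuous_const).mem_nhds hx] with y hy
    exact hc _ _ (le_of_lt hy)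
  have hTs : ContDiff ℝ ∞ T := by
    rw [contDiff_iff_contDiffAt]
    intro x
    by_cases h0 : rad x = 0
    · exact contDiffAt_const.congr_of_eventuallyEq (hnear x (h0 ▸ hδ))
    · have hpos : 0 < rad x := lt_of_le_of_ne (rad_nonneg x) (Ne.symm h0)
      set t := angleFrom 0 x
      have hx : rad x • circ t = x := rad_smul_circ_angleFrom 0 x
      have h1 : ContDiffAt ℝ ∞ (angleFrom t) x := by
        have := contDiffAt_angleFrom (m := t) (t := t) hpos (by linarith [Real.pi_pos])
          (by linarith [Real.pi_pos])
        rwa [hx] at this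
      have h2 : T = fun x ↦ P (rad x, angleFrom t x) := funext (hTm t)
      rw [h2]
      exact ContDiffAt.comp (g := P) x hP.contDiffAt ((contDiffAt_rad h0).prodMk h1)
  refine ⟨T, hTs, hTp, fun x ↦ ?_⟩
  have hK0 : 0 ≤ K := by
    have := (abs_nonneg _).trans (hK 1 0 one_pos); linarith
  by_cases h0 : rad x = 0
  · rw [jac, (hnear x (h0 ▸ hδ)).fderiv_eq]
    simpa [cross] using hK0
  · have hpos : 0 < rad x := lt_of_le_of_ne (rad_nonneg x) (Ne.symm h0)
    set t := angleFrom 0 x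
    have hx : rad x • circ t = x := rad_smul_circ_angleFrom 0 x
    obtain ⟨h1, h2, h3⟩ := hasFDerivAt_smul_circ (rad x, t)
    have h4 : P =ᶠ[𝓝 (rad x, t)] T ∘ fun p : ℝ × ℝ ↦ p.1 • circ p.2 := by
      filter_upwards [(isOpen_lt continuous_const continuous_fst).mem_nhds
        (show (0 : ℝ) < (rad x, t).1 from hpos)] with p hp
      exact (hTp p.1 p.2 (le_of_lt hp)).symm
    have h5 : HasFDerivAt T (fderiv ℝ T x) ((fun p : ℝ × ℝ ↦ p.1 • circ p.2) (rad x, t)) := by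
      simp only [hx]
      exact (hTs.differentiable (by simp) x).hasFDerivAt
    have h6 := hK (rad x) t hpos
    rw [h4.fderiv_eq, (HasFDerivAt.comp (rad x, t) h5 h1).fderiv, ContinuousLinearMap.comp_apply,
      ContinuousLinearMap.comp_apply, cross_map, h2, h3] at h6
    have h7 : cross (circ t) (rad x • (-Real.sin t, Real.cos t)) = rad x := by
      simp only [cross, circ, Prod.smul_mk, smul_eq_mul]
      linear_combination rad x * Real.cos_sq_add_sin_sq t
    rw [h7, abs_mul, abs_of_pos hpos] at h6
    exact le_of_mul_le_mul_right h6 hpos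

/-! ### Cutoffs and the parametrisation by area -/

theorem hasDerivAt_mul_intervalIntegral {f : ℝ → ℝ} (hf : Continuous f) (c x : ℝ) :
    HasDerivAt (fun u ↦ c * ∫ v in (0 : ℝ)..u, f v) (c * f x) x :=
  (intervalIntegral.integral_hasDerivAt_right (hf.intervalIntegrable _ _)
    hf.stronglyMeasurable.stronglyMeasurableAtFilter hf.continuousAt).const_mul c

theorem contDiff_mul_intervalIntegral {f : ℝ → ℝ} (hf : ContDiff ℝ ∞ f) (c : ℝ) :
    ContDiff ℝ ∞ (fun u ↦ c * ∫ v in (0 : ℝ)..u, f v) := by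
  rw [contDiff_infty_iff_deriv]
  refine ⟨fun x ↦ (hasDerivAt_mul_intervalIntegral hf.continuous c x).differentiableAt, ?_⟩
  have : deriv (fun u ↦ c * ∫ v in (0 : ℝ)..u, f v) = fun x ↦ c * f x :=
    funext fun x ↦ (hasDerivAt_mul_intervalIntegral hf.continuous c x).deriv
  rw [this]
  exact contDiff_const.mul hf

/-- A smooth function that collapses neighbourhoods of `0` and of `1` and increases the area form
`u du` by a factor of at most `1 + ε`. -/
theorem exists_radial_cutoff {ε : ℝ} (hε : 0 < ε) :
    ∃ (κ : ℝ → ℝ) (δ : ℝ), 0 < δ ∧ δ < 1 / 4 ∧ ContDiff ℝ ∞ κ ∧ (∀ u, 0 ≤ κ u ∧ κ u ≤ 1) ∧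
      (∀ u ≤ δ, κ u = 0) ∧ (∀ u, 1 - δ ≤ u → κ u = 1) ∧
      ∀ u, 0 < u → |κ u * deriv κ u| ≤ (1 + ε) * u := by
  -- Chosen so that `(1 - 4δ)² (1 + ε) ≥ 1`; the integral `I` below is at least `1 - 4δ`.
  set δ : ℝ := ε / (16 * (1 + ε)) with hδdef
  have hδ : 0 < δ := by positivity
  have hδ' : δ * (16 * (1 + ε)) = ε := by rw [hδdef]; field_simp
  have hδ1 : δ < 1 / 16 := by rw [hδdef, div_lt_div_iff₀ (by positivity) (by norm_num)]; linarith
  let f : ContDiffBump (1 / 2 : ℝ) := ⟨1 / 2 - 2 * δ, 1 / 2 - δ, by linarith, by linarith⟩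
  have hfs : ContDiff ℝ ∞ f := f.contDiff
  have hfi : ∀ a b, IntervalIntegrable f volume a b := fun a b ↦
    hfs.continuous.intervalIntegrable a b
  have hf0 : ∀ u, 1 / 2 - δ ≤ |u - 1 / 2| → f u = 0 := fun u hu ↦
    f.zero_of_le_dist (by rw [Real.dist_eq]; exact hu)
  set I := ∫ v in (0 : ℝ)..1, f v with hI
  have hI1 : 1 - 4 * δ ≤ I := by
    have h1 : ∫ v in (2 * δ)..(1 - 2 * δ), (1 : ℝ) ≤ ∫ v in (2 * δ)..(1 - 2 * δ), f v := by
      apply intervalIntegral.integral_mono_on (by linarith) (by simp) (hfi _ _)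
      intro x hx
      rw [f.one_of_mem_closedBall]
      rw [Metric.mem_closedBall, Real.dist_eq, abs_le]
      constructor <;> simp only [f] <;> linarith [hx.1, hx.2]
    have h2 : ∫ v in (2 * δ)..(1 - 2 * δ), f v ≤ I := by
      apply intervalIntegral.integral_mono_interval (by linarith) (by linarith) (by linarith)
        (Filter.Eventually.of_forall fun x ↦ f.nonneg) (hfi _ _)
    have h3 : ∫ v in (2 * δ)..(1 - 2 * δ), (1 : ℝ) = 1 - 4 * δ := by simp; ring
    linarith
  have hI0 : 0 < I := by linarith
  set κ : ℝ → ℝ := fun u ↦ I⁻¹ * ∫ v in (0 : ℝ)..u, f v with hκ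
  have hd : ∀ u, HasDerivAt κ (I⁻¹ * f u) u := hasDerivAt_mul_intervalIntegral hfs.continuous _
  have hmono : Monotone κ := monotone_of_deriv_nonneg (fun u ↦ (hd u).differentiableAt)
    fun u ↦ by rw [(hd u).deriv]; exact mul_nonneg (by positivity) f.nonneg
  have h0 : ∀ u ≤ δ, κ u = 0 := by
    intro u hu
    have : ∫ v in (0 : ℝ)..u, f v = ∫ v in (0 : ℝ)..u, (0 : ℝ) := by
      apply intervalIntegral.integral_congr
      intro v hv
      apply hf0
      have : v ≤ δ := (hv.2).trans (max_le hδ.le hu)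
      rw [abs_of_neg] <;> linarith
    simp [hκ, this]
  have h1 : ∀ u, 1 - δ ≤ u → κ u = 1 := by
    intro u hu
    have : ∫ v in (1 : ℝ)..u, f v = ∫ v in (1 : ℝ)..u, (0 : ℝ) := by
      apply intervalIntegral.integral_congr
      intro v hv
      apply hf0
      have : 1 - δ ≤ v := (le_min (by linarith) hu).trans hv.1
      rw [abs_of_pos] <;> linarith
    have h2 : ∫ v in (0 : ℝ)..u, f v = I := by
      rw [← intervalIntegral.integral_add_adjacent_intervals (hfi 0 1) (hfi 1 u), this]
      simp [hI]
    simp only [hκ, h2]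
    exact inv_mul_cancel₀ hI0.ne'
  refine ⟨κ, δ, hδ, by linarith, contDiff_mul_intervalIntegral hfs _, fun u ↦ ⟨?_, ?_⟩, h0, h1, ?_⟩
  · rcases le_total u δ with h | h
    · rw [h0 u h]
    · rw [← h0 δ le_rfl]; exact hmono h
  · rcases le_total u 1 with h | h
    · rw [← h1 1 (by linarith)]; exact hmono h
    · rw [h1 u (by linarith)]
  · intro u hu
    -- As `f ≤ 1`, both `κ u ≤ u / I` and `κ' ≤ 1 / I`, so `κ κ' ≤ u / I²`.
    have h3 : κ u ≤ I⁻¹ * u := by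
      simp only [hκ]
      gcongr
      have : ∫ v in (0 : ℝ)..u, f v ≤ ∫ v in (0 : ℝ)..u, (1 : ℝ) :=
        intervalIntegral.integral_mono_on hu.le (hfi _ _) (by simp) fun x _ ↦ f.le_one
      simpa using this
    have h4 : 0 ≤ κ u := by rw [← h0 0 hδ.le]; exact hmono hu.le
    rw [(hd u).deriv, abs_of_nonneg (mul_nonneg h4 (mul_nonneg (by positivity) f.nonneg))]
    have h5 : κ u * (I⁻¹ * f u) ≤ (I⁻¹ * u) * (I⁻¹ * 1) := by
      gcongr
      · exact mul_nonneg (by positivity) f.nonneg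
      · exact f.le_one
    have h6 : I⁻¹ * I⁻¹ ≤ 1 + ε := by
      rw [← mul_inv, inv_le_iff_one_le_mul₀ (by positivity)]
      have : (1 - 4 * δ) * (1 - 4 * δ) ≤ I * I := by gcongr; linarith
      nlinarith
    nlinarith

/-- The derivative is continuous and supported in `[a, b]`, hence bounded. The bound `C` decides how
close the two curves in `exists_map_from_disc` have to be. -/
theorem exists_smooth_step {a b : ℝ} (hab : a < b) :
    ∃ (s : ℝ → ℝ) (C : ℝ), 0 < C ∧ ContDiff ℝ ∞ s ∧ (∀ r, 0 ≤ s r ∧ s r ≤ 1) ∧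
      (∀ r ≤ a, s r = 0) ∧ (∀ r, b ≤ r → s r = 1) ∧ ∀ r, |deriv s r| ≤ C := by
  set s : ℝ → ℝ := fun r ↦ Real.smoothTransition ((r - a) / (b - a)) with hs
  have hss : ContDiff ℝ ∞ s := Real.smoothTransition.contDiff.comp (by fun_prop)
  have h0 : ∀ r ≤ a, s r = 0 := fun r hr ↦ Real.smoothTransition.zero_of_nonpos
    (div_nonpos_of_nonpos_of_nonneg (by linarith) (by linarith))
  have h1 : ∀ r, b ≤ r → s r = 1 := fun r hr ↦ Real.smoothTransition.one_of_one_le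
    (by rw [le_div_iff₀ (by linarith)]; linarith)
  have hc : HasCompactSupport (deriv s) := by
    apply HasCompactSupport.of_support_subset_isCompact (isCompact_Icc (a := a) (b := b))
    intro r hr
    by_contra hr'
    apply hr
    rw [mem_Icc, not_and_or, not_le, not_le] at hr'
    rcases hr' with h | h
    · have : s =ᶠ[𝓝 r] fun _ ↦ 0 := by
        filter_upwards [Iio_mem_nhds h] with x hx using h0 x (le_of_lt hx)
      rw [this.deriv_eq]; simp
    · have : s =ᶠ[𝓝 r] fun _ ↦ 1 := by
        filter_upwards [Ioi_mem_nhds h] with x hx using h1 x (le_of_lt hx)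
      rw [this.deriv_eq]; simp
  obtain ⟨C, hC⟩ := hc.exists_bound_of_continuous (hss.continuous_deriv (by simp))
  refine ⟨s, max C 1, by positivity, hss,
    fun r ↦ ⟨Real.smoothTransition.nonneg _, Real.smoothTransition.le_one _⟩, h0, h1, fun r ↦ ?_⟩
  exact (hC r).trans (le_max_left _ _)

theorem add_int_mul_of_add_two_pi {q : ℝ → ℝ} (h : ∀ t, q (t + 2 * Real.pi) = q t + 2 * Real.pi)
    (t : ℝ) (k : ℤ) : q (t + k * (2 * Real.pi)) = q t + k * (2 * Real.pi) := by
  have hp : Function.Periodic (fun t ↦ q t - t) (2 * Real.pi) := fun t ↦ by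
    show q (t + 2 * Real.pi) - _ = _
    rw [h]; ring
  have : q (t + k * (2 * Real.pi)) - (t + k * (2 * Real.pi)) = q t - t := hp.int_mul k t
  linarith

theorem surjective_of_add_two_pi {q : ℝ → ℝ} (hmono : Monotone q) (hc : Continuous q)
    (h : ∀ t, q (t + 2 * Real.pi) = q t + 2 * Real.pi) : Function.Surjective q := by
  have hpi := Real.pi_pos
  have hint := add_int_mul_of_add_two_pi h 0
  apply hc.surjective
  · rw [Filter.tendsto_atTop]
    intro b
    obtain ⟨n, hn⟩ := exists_nat_gt ((b - q 0) / (2 * Real.pi))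
    filter_upwards [Filter.eventually_ge_atTop ((n : ℝ) * (2 * Real.pi))] with t ht
    have h1 := hint n
    rw [div_lt_iff₀ (by positivity)] at hn
    have h2 := hmono ht
    push_cast at h1
    rw [zero_add] at h1
    linarith
  · rw [Filter.tendsto_atBot]
    intro b
    obtain ⟨n, hn⟩ := exists_nat_gt ((q 0 - b) / (2 * Real.pi))
    filter_upwards [Filter.eventually_le_atBot (-(n : ℝ) * (2 * Real.pi))] with t ht
    have h1 := hint (-n)
    rw [div_lt_iff₀ (by positivity)] at hn
    have h2 := hmono ht
    push_cast at h1
    rw [zero_add] at h1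
    linarith

theorem exists_bounds_of_periodic {f : ℝ → ℝ} (hf : Continuous f) (hpos : ∀ t, 0 < f t)
    (hper : ∀ t, f (t + 2 * Real.pi) = f t) : ∃ m M, 0 < m ∧ ∀ t, m ≤ f t ∧ f t ≤ M := by
  have hne : (Icc (0 : ℝ) (0 + 2 * Real.pi)).Nonempty := ⟨0, by simp [Real.pi_pos.le]⟩
  obtain ⟨a, -, ha⟩ := isCompact_Icc.exists_isMinOn hne hf.continuousOn
  obtain ⟨b, -, hb⟩ := isCompact_Icc.exists_isMaxOn hne hf.continuousOn
  refine ⟨f a, f b, hpos a, fun t ↦ ?_⟩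
  obtain ⟨y, hy, hy'⟩ := (show Function.Periodic f (2 * Real.pi) from hper).exists_mem_Ico₀
    Real.two_pi_pos t
  have hy2 : y ∈ Icc (0 : ℝ) (0 + 2 * Real.pi) := ⟨hy.1, by linarith [hy.2]⟩
  rw [hy']
  exact ⟨ha hy2, hb hy2⟩

/-- The normalised primitive of a positive periodic density, and its inverse. -/
theorem exists_area_parametrization {w : ℝ → ℝ} (hw : ContDiff ℝ ∞ w) (hpos : ∀ t, 0 < w t)
    (hper : ∀ t, w (t + 2 * Real.pi) = w t) {c : ℝ}
    (hc : c * ∫ t in (0 : ℝ)..(2 * Real.pi), w t = 2 * Real.pi) :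
    ∃ φ Q : ℝ → ℝ, ContDiff ℝ ∞ φ ∧ ContDiff ℝ ∞ Q ∧ (∀ t, HasDerivAt φ (c * w t) t) ∧
      (∀ t, HasDerivAt Q (c * w (Q t))⁻¹ t) ∧ StrictMono φ ∧ StrictMono Q ∧
      (∀ t, φ (t + 2 * Real.pi) = φ t + 2 * Real.pi) ∧
      (∀ t, Q (t + 2 * Real.pi) = Q t + 2 * Real.pi) := by
  have hpi := Real.pi_pos
  have hI : 0 < ∫ t in (0 : ℝ)..(2 * Real.pi), w t :=
    intervalIntegral.intervalIntegral_pos_of_pos (hw.continuous.intervalIntegrable _ _) hpos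
      (by positivity)
  have hc0 : 0 < c := by
    by_contra h
    have := mul_nonpos_of_nonpos_of_nonneg (not_lt.1 h) hI.le
    linarith
  set φ : ℝ → ℝ := fun u ↦ c * ∫ v in (0 : ℝ)..u, w v with hφ
  have hd : ∀ t, HasDerivAt φ (c * w t) t := hasDerivAt_mul_intervalIntegral hw.continuous c
  have hφs : ContDiff ℝ ∞ φ := contDiff_mul_intervalIntegral hw c
  have hmono : StrictMono φ := strictMono_of_deriv_pos fun t ↦ by
    rw [(hd t).deriv]; exact mul_pos hc0 (hpos t)
  have heq : ∀ t, φ (t + 2 * Real.pi) = φ t + 2 * Real.pi := by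
    intro t
    have hi : ∀ a b, IntervalIntegrable w volume a b := fun a b ↦
      hw.continuous.intervalIntegrable a b
    have h1 : ∫ v in t..(t + 2 * Real.pi), w v = ∫ v in (0 : ℝ)..(2 * Real.pi), w v := by
      have := (show Function.Periodic w (2 * Real.pi) from hper).intervalIntegral_add_eq t 0
      simpa using this
    simp only [hφ]
    rw [← intervalIntegral.integral_add_adjacent_intervals (hi 0 t) (hi t _), mul_add, h1, hc]
  have hsurj := surjective_of_add_two_pi hmono.monotone hφs.continuous heq
  let e : ℝ ≃ₜ ℝ := (hmono.orderIsoOfSurjective φ hsurj).toHomeomorph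
  have he : ∀ t, e t = φ t := fun t ↦ rfl
  have hne : ∀ t, c * w t ≠ 0 := fun t ↦ (mul_pos hc0 (hpos t)).ne'
  have hQs : ContDiff ℝ ∞ e.symm := e.contDiff_symm_deriv hne hd hφs
  have hφQ : ∀ t, φ (e.symm t) = t := fun t ↦ e.apply_symm_apply t
  have hQmono : StrictMono e.symm := (hmono.orderIsoOfSurjective φ hsurj).symm.strictMono
  refine ⟨φ, e.symm, hφs, hQs, hd, fun t ↦ ?_, hmono, hQmono, heq, fun t ↦ ?_⟩
  · exact (hd (e.symm t)).of_local_left_inverse e.symm.continuous.continuousAt (hne _)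
      (Filter.Eventually.of_forall hφQ)
  · apply hmono.injective
    rw [heq, hφQ, hφQ]

/-! ### Almost area-preserving maps between star-shaped domains and the disc -/

theorem fderiv_apply_one_zero {P : ℝ × ℝ → ℝ × ℝ} {r t : ℝ} (hP : DifferentiableAt ℝ P (r, t))
    {v : ℝ × ℝ} (h : HasDerivAt (fun r ↦ P (r, t)) v r) : fderiv ℝ P (r, t) (1, 0) = v := by
  have h1 : HasDerivAt (fun r : ℝ ↦ (r, t)) ((1 : ℝ), (0 : ℝ)) r :=
    (hasDerivAt_id r).prodMk (hasDerivAt_const r t)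
  exact (HasFDerivAt.comp_hasDerivAt r hP.hasFDerivAt h1).unique h

theorem fderiv_apply_zero_one {P : ℝ × ℝ → ℝ × ℝ} {r t : ℝ} (hP : DifferentiableAt ℝ P (r, t))
    {v : ℝ × ℝ} (h : HasDerivAt (fun t ↦ P (r, t)) v t) : fderiv ℝ P (r, t) (0, 1) = v := by
  have h1 : HasDerivAt (fun t : ℝ ↦ (r, t)) ((0 : ℝ), (1 : ℝ)) t :=
    (hasDerivAt_const t r).prodMk (hasDerivAt_id t)
  exact (HasFDerivAt.comp_hasDerivAt t hP.hasFDerivAt h1).unique h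

theorem hasDerivAt_circ (t : ℝ) : HasDerivAt circ (-Real.sin t, Real.cos t) t :=
  (Real.hasDerivAt_cos _).prodMk (Real.hasDerivAt_sin _)

/-- In polar coordinates the map is `(r, t) ↦ (κ (r / ρ t), φ t)` with `φ' = c ρ²`. With `u = r / ρ
t` the area form `r dr dt` becomes `ρ² u du dt`, so the Jacobian is `c κ κ' / u`. Since `κ = 1` from
`u = 1` on, a nonsmooth boundary lying outside the curve is still sent exactly to the circle. -/
theorem exists_map_to_disc {ρ : ℝ → ℝ} (hρ : ContDiff ℝ ∞ ρ) (hpos : ∀ t, 0 < ρ t)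
    (hper : ∀ t, ρ (t + 2 * Real.pi) = ρ t) {ε c : ℝ} (hε : 0 < ε)
    (hc : c * ∫ t in (0 : ℝ)..(2 * Real.pi), ρ t ^ 2 = 2 * Real.pi) :
    ∃ (φ : ℝ → ℝ) (T : ℝ × ℝ → ℝ × ℝ), StrictMono φ ∧
      (∀ t, φ (t + 2 * Real.pi) = φ t + 2 * Real.pi) ∧ ContDiff ℝ ∞ T ∧
      (∀ x, rad (T x) ≤ 1) ∧ (∀ x, |jac T x| ≤ (1 + ε) * c) ∧
      ∀ r t, ρ t ≤ r → T (r • circ t) = circ (φ t) := by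
  obtain ⟨κ, δ, hδ, hδ4, hκs, hκb, hκ0, hκ1, hκd⟩ := exists_radial_cutoff hε
  obtain ⟨φ, -, hφs, -, hφd, -, hφm, -, hφe, -⟩ := exists_area_parametrization (w := fun t ↦ ρ t ^ 2)
    (hρ.pow 2) (fun t ↦ by have := hpos t; positivity) (fun t ↦ by simp only [hper]) hc
  have hc0 : 0 ≤ c := by
    have h1 := hφm.monotone
    have h2 : 0 ≤ deriv φ 0 := h1.deriv_nonneg
    rw [(hφd 0).deriv] at h2
    have h3 := hpos 0
    exact nonneg_of_mul_nonneg_left h2 (by positivity)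
  obtain ⟨m, _, hm, hmρ⟩ := exists_bounds_of_periodic hρ.continuous hpos hper
  set P : ℝ × ℝ → ℝ × ℝ := fun p ↦ κ (p.1 / ρ p.2) • circ (φ p.2) with hP
  have hPs : ContDiff ℝ ∞ P := by
    have h1 : ContDiff ℝ ∞ fun p : ℝ × ℝ ↦ p.1 / ρ p.2 :=
      contDiff_fst.div (hρ.comp contDiff_snd) fun p ↦ (hpos _).ne'
    exact (hκs.comp h1).smul (contDiff_circ.comp (hφs.comp contDiff_snd))
  obtain ⟨T, hTs, hTP, hTj⟩ := exists_map_of_polar (P := P) (δ := δ * m) (c := 0)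
    (K := (1 + ε) * c) hPs
    (fun r t ↦ by simp only [hP, hper, hφe, circ_add_two_pi]) (by positivity)
    (fun r t hr ↦ by
      have : r / ρ t ≤ δ := by
        rw [div_le_iff₀ (hpos t)]
        exact hr.trans (by gcongr; exact (hmρ t).1)
      simp only [hP, hκ0 _ this, zero_smul])
    (fun r t hr ↦ by
      have hρt := hpos t
      have hPd : DifferentiableAt ℝ P (r, t) := hPs.differentiable (by simp) _
      have hκD : ∀ u, HasDerivAt κ (deriv κ u) u := fun u ↦
        (hκs.differentiable (by simp) u).hasDerivAt
      have h1 : HasDerivAt (fun r ↦ P (r, t)) ((deriv κ (r / ρ t) * (1 / ρ t)) • circ (φ t)) r := by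
        have := (hκD (r / ρ t)).comp r ((hasDerivAt_id r).div_const (ρ t))
        exact this.smul_const (circ (φ t))
      have hρD : HasDerivAt ρ (deriv ρ t) t := (hρ.differentiable (by simp) t).hasDerivAt
      have h2 := ((hκD (r / ρ t)).comp t ((hasDerivAt_const t r).div hρD hρt.ne')).smul
        ((hasDerivAt_circ (φ t)).scomp t (hφd t))
      rw [fderiv_apply_one_zero hPd h1, fderiv_apply_zero_one hPd h2]
      have h3 := hκd (r / ρ t) (by positivity)
      -- The dependence of `r / ρ t` on `t` enters only through the radial term `d`, which is
      -- parallel to the first vector and drops out.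
      have h4 : ∀ (A C d : ℝ), cross ((A * (1 / ρ t)) • circ (φ t))
          (C • (c * ρ t ^ 2) • (-Real.sin (φ t), Real.cos (φ t)) + d • circ (φ t))
          = C * A * (ρ t * c) := by
        intro A C d
        simp only [cross, circ, Prod.smul_mk, smul_eq_mul, Prod.mk_add_mk]
        field_simp
        linear_combination A * C * c * ρ t ^ 2 * Real.cos_sq_add_sin_sq (φ t)
      simp only [Function.comp_apply, Pi.div_apply]
      rw [h4 _, abs_mul, abs_of_nonneg (a := ρ t * c) (by positivity)]
      calc _ ≤ (1 + ε) * (r / ρ t) * (ρ t * c) := by gcongr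
        _ = (1 + ε) * c * r := by field_simp)
  refine ⟨φ, T, hφm, hφe, hTs, fun x ↦ ?_, hTj, fun r t hr ↦ ?_⟩
  · rw [← rad_smul_circ_angleFrom 0 x, hTP _ _ (rad_nonneg x)]
    simp only [hP]
    rw [rad_smul_circ (hκb _).1]
    exact (hκb _).2
  · rw [hTP _ _ ((hpos t).le.trans hr)]
    simp only [hP]
    rw [hκ1, one_smul]
    have : 1 ≤ r / ρ t := by rw [le_div_iff₀ (hpos t)]; linarith
    linarith

/-- Given a smooth star-shaped curve `ρ(t) circ t` and a smooth curve `β` sufficiently close to it,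
there is an almost area-preserving map of the disc which fills the star-shaped domain and maps the
boundary circle to `β`. -/
theorem exists_map_from_disc {ε : ℝ} (hε : 0 < ε) : ∃ η > 0, ∀ (ρ : ℝ → ℝ) (β : ℝ → ℝ × ℝ) (c : ℝ),
    ContDiff ℝ ∞ ρ → (∀ t, 0 < ρ t) → (∀ t, ρ (t + 2 * Real.pi) = ρ t) →
    (c * ∫ t in (0 : ℝ)..(2 * Real.pi), ρ t ^ 2 = 2 * Real.pi) →
    ContDiff ℝ ∞ β → (∀ t, β (t + 2 * Real.pi) = β t) →
    (∀ t, |cross (β t - ρ t • circ t) (deriv (fun t ↦ ρ t • circ t) t)| ≤ η * ρ t ^ 2) →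
    (∀ t, |cross (β t - ρ t • circ t) (deriv β t)| ≤ η * ρ t ^ 2) →
    ∃ (Q : ℝ → ℝ) (T : ℝ × ℝ → ℝ × ℝ), StrictMono Q ∧ Continuous Q ∧
      (∀ t, Q (t + 2 * Real.pi) = Q t + 2 * Real.pi) ∧ ContDiff ℝ ∞ T ∧
      (∀ x, |jac T x| ≤ (1 + ε) / c) ∧ (∀ t, T (circ t) = β (Q t)) ∧
      ∀ x, ∃ t, ∃ μ ∈ Icc (0 : ℝ) 1, ∃ s ∈ Icc (0 : ℝ) 1,
        T x = μ • ((1 - s) • ρ t • circ t + s • β t) := by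
  obtain ⟨κ, δ, hδ, hδ4, hκs, hκb, hκ0, hκ1, hκd⟩ := exists_radial_cutoff hε
  obtain ⟨s, C, hC, hss, hsb, hs0, hs1, hsd⟩ :=
    exists_smooth_step (a := 1 - δ / 2) (b := 1) (by linarith)
  -- This closeness makes the polar determinant at most `1 / (2c)` in the interpolation layer, where
  -- `r ≥ 1 - δ / 2` puts it below `(1 + ε) r / c`.
  refine ⟨1 / (2 * C), by positivity, fun ρ β c hρ hpos hper hc hβ hβper hα' hβ' ↦ ?_⟩
  obtain ⟨φ, Q, -, hQs, hφd, hQd, hφm, hQm, -, hQe⟩ :=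
    exists_area_parametrization (w := fun t ↦ ρ t ^ 2)
    (hρ.pow 2) (fun t ↦ by have := hpos t; positivity) (fun t ↦ by simp only [hper]) hc
  have hc0 : 0 ≤ c := by
    have h1 := hφm.monotone
    have h2 : 0 ≤ deriv φ 0 := h1.deriv_nonneg
    rw [(hφd 0).deriv] at h2
    have h3 := hpos 0
    exact nonneg_of_mul_nonneg_left h2 (by positivity)
  have hc1 : 0 < c := hc0.lt_of_ne' (by
    rintro rfl
    rw [zero_mul] at hc
    linarith [Real.two_pi_pos])
  set α : ℝ → ℝ × ℝ := fun t ↦ ρ t • circ t with hα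
  have hαs : ContDiff ℝ ∞ α := hρ.smul contDiff_circ
  have hαper : ∀ t, α (t + 2 * Real.pi) = α t := fun t ↦ by
    simp only [hα, hper, circ_add_two_pi]
  set P : ℝ × ℝ → ℝ × ℝ := fun p ↦
    κ p.1 • ((1 - s p.1) • α (Q p.2) + s p.1 • β (Q p.2)) with hP
  have hPs : ContDiff ℝ ∞ P := by
    have e1 : ContDiff ℝ ∞ fun p : ℝ × ℝ ↦ κ p.1 := hκs.comp contDiff_fst
    have e2 : ContDiff ℝ ∞ fun p : ℝ × ℝ ↦ s p.1 := hss.comp contDiff_fst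
    have e3 : ContDiff ℝ ∞ fun p : ℝ × ℝ ↦ α (Q p.2) := hαs.comp (hQs.comp contDiff_snd)
    have e4 : ContDiff ℝ ∞ fun p : ℝ × ℝ ↦ β (Q p.2) := hβ.comp (hQs.comp contDiff_snd)
    exact e1.smul (((contDiff_const.sub e2).smul e3).add (e2.smul e4))
  obtain ⟨T, hTs, hTP, hTj⟩ := exists_map_of_polar (P := P) (δ := δ) (c := 0)
    (K := (1 + ε) / c) hPs
    (fun r t ↦ by simp only [hP, hQe, hαper, hβper]) hδ
    (fun r t hr ↦ by simp only [hP, hκ0 _ hr, zero_smul])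
    (fun r t hr ↦ by
      have hρt := hpos (Q t)
      have hPd : DifferentiableAt ℝ P (r, t) := hPs.differentiable (by simp) _
      have hκD : HasDerivAt κ (deriv κ r) r := (hκs.differentiable (by simp) r).hasDerivAt
      have hsD : HasDerivAt s (deriv s r) r := (hss.differentiable (by simp) r).hasDerivAt
      have hαD : HasDerivAt (fun t ↦ α (Q t)) ((c * ρ (Q t) ^ 2)⁻¹ • deriv α (Q t)) t :=
        HasDerivAt.scomp t (hαs.differentiable (by simp) (Q t)).hasDerivAt (hQd t)
      have hβD : HasDerivAt (fun t ↦ β (Q t)) ((c * ρ (Q t) ^ 2)⁻¹ • deriv β (Q t)) t :=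
        HasDerivAt.scomp t (hβ.differentiable (by simp) (Q t)).hasDerivAt (hQd t)
      have h1 := hκD.smul (((hsD.const_sub 1).smul_const (α (Q t))).add
        (hsD.smul_const (β (Q t))))
      have h2 := ((hαD.const_smul (1 - s r)).add (hβD.const_smul (s r))).const_smul (κ r)
      rw [fderiv_apply_one_zero hPd h1, fderiv_apply_zero_one hPd h2]
      simp only [Pi.add_apply]
      set a := α (Q t) with ha
      set b := β (Q t) with hb
      set a' := deriv α (Q t) with ha'
      set b' := deriv β (Q t) with hb'
      have hαc : cross a a' = ρ (Q t) ^ 2 := by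
        have : a' = ρ (Q t) • (-Real.sin (Q t), Real.cos (Q t)) + deriv ρ (Q t) • circ (Q t) :=
          (((hρ.differentiable (by simp) (Q t)).hasDerivAt).smul (hasDerivAt_circ (Q t))).deriv
        rw [this, ha]
        simp only [hα, cross, circ, Prod.smul_mk, smul_eq_mul, Prod.mk_add_mk]
        linear_combination ρ (Q t) ^ 2 * Real.cos_sq_add_sin_sq (Q t)
      have hw : 0 < c * ρ (Q t) ^ 2 := by positivity
      -- The two cutoffs vary on disjoint ranges. Below `1 - δ / 2` only `κ` varies and the
      -- star-shaped domain is filled; above it `κ = 1` and only the passage from `α` to `β`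
      -- contributes.
      rcases lt_or_ge r (1 - δ / 2) with h | h
      · have hs' : deriv s r = 0 := by
          have : s =ᶠ[𝓝 r] fun _ ↦ 0 := by
            filter_upwards [Iio_mem_nhds h] with x hx using hs0 x (le_of_lt hx)
          rw [this.deriv_eq]; simp
        rw [hs', hs0 r h.le]
        have e : cross (κ r • (-(0 : ℝ) • a + (0 : ℝ) • b) +
            deriv κ r • ((1 - (0 : ℝ)) • a + (0 : ℝ) • b))
            (κ r • ((1 - (0 : ℝ)) • (c * ρ (Q t) ^ 2)⁻¹ • a' +
              (0 : ℝ) • (c * ρ (Q t) ^ 2)⁻¹ • b')) =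
            κ r * deriv κ r * (1 / c) := by
          have : cross (κ r • (-(0 : ℝ) • a + (0 : ℝ) • b) +
            deriv κ r • ((1 - (0 : ℝ)) • a + (0 : ℝ) • b))
            (κ r • ((1 - (0 : ℝ)) • (c * ρ (Q t) ^ 2)⁻¹ • a' +
              (0 : ℝ) • (c * ρ (Q t) ^ 2)⁻¹ • b')) =
              κ r * deriv κ r * (c * ρ (Q t) ^ 2)⁻¹ * cross a a' := by
            simp [cross]; ring
          rw [this, hαc]; field_simp
        rw [e, abs_mul, abs_of_pos (a := 1 / c) (by positivity)]
        calc _ ≤ (1 + ε) * r * (1 / c) := by gcongr; exact hκd r hr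
          _ = _ := by ring
      · have hκ' : deriv κ r = 0 := by
          have : κ =ᶠ[𝓝 r] fun _ ↦ 1 := by
            filter_upwards [Ioi_mem_nhds (show 1 - δ < r by linarith)] with x hx
              using hκ1 x (le_of_lt hx)
          rw [this.deriv_eq]; simp
        rw [hκ', hκ1 r (by linarith)]
        have e : cross ((1 : ℝ) • (-deriv s r • a + deriv s r • b) +
            (0 : ℝ) • ((1 - s r) • a + s r • b))
            ((1 : ℝ) • ((1 - s r) • (c * ρ (Q t) ^ 2)⁻¹ • a' +
              s r • (c * ρ (Q t) ^ 2)⁻¹ • b')) =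
            deriv s r * (c * ρ (Q t) ^ 2)⁻¹ *
              ((1 - s r) * cross (b - a) a' + s r * cross (b - a) b') := by
          simp [cross]; ring
        rw [e, abs_mul, abs_mul, abs_of_pos (inv_pos.2 hw)]
        have h3 : |(1 - s r) * cross (b - a) a' + s r * cross (b - a) b'| ≤
            1 / (2 * C) * ρ (Q t) ^ 2 := by
          have i1 := hα' (Q t)
          have i2 := hβ' (Q t)
          have i3 := hsb r
          rw [abs_le] at i1 i2 ⊢
          constructor
          · nlinarith [mul_le_mul_of_nonneg_left i1.1 (sub_nonneg.2 i3.2),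
              mul_le_mul_of_nonneg_left i2.1 i3.1]
          · nlinarith [mul_le_mul_of_nonneg_left i1.2 (sub_nonneg.2 i3.2),
              mul_le_mul_of_nonneg_left i2.2 i3.1]
        calc _ ≤ C * (c * ρ (Q t) ^ 2)⁻¹ * (1 / (2 * C) * ρ (Q t) ^ 2) := by
              gcongr; exact hsd r
          _ = (1 / 2) / c := by field_simp
          _ ≤ (1 + ε) * r / c := by gcongr; nlinarith
          _ = _ := by ring)
  refine ⟨Q, T, hQm, hQs.continuous, hQe, hTs, hTj, fun t ↦ ?_, fun x ↦ ?_⟩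
  · have := hTP 1 t zero_le_one
    rw [one_smul] at this
    rw [this]
    simp only [hP, hs1 1 le_rfl, hκ1 1 (by linarith)]
    simp
  · refine ⟨Q (angleFrom 0 x), κ (rad x), hκb _, s (rad x), hsb _, ?_⟩
    have := hTP _ (angleFrom 0 x) (rad_nonneg x)
    rw [rad_smul_circ_angleFrom] at this
    exact this

/-! ### Reparametrisations that are flat at prescribed points -/

/-- A smooth monotone staircase, constant near the integers. -/
noncomputable def staircase (x : ℝ) : ℝ := ⌊x⌋ + Real.smoothTransition (3 * Int.fract x - 1)

theorem floor_le_staircase (x : ℝ) : (⌊x⌋ : ℝ) ≤ staircase x :=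
  le_add_of_nonneg_right (Real.smoothTransition.nonneg _)

theorem staircase_le_floor_add_one (x : ℝ) : staircase x ≤ ⌊x⌋ + 1 :=
  add_le_add_right (Real.smoothTransition.le_one _) _

theorem le_staircase {n : ℤ} {x : ℝ} (h : n - 1 / 3 ≤ x) : n ≤ staircase x := by
  rcases le_or_gt n ⌊x⌋ with h1 | h1
  · exact le_trans (by exact_mod_cast h1) (floor_le_staircase x)
  · have h2 : ⌊x⌋ = n - 1 := by
      have : n - 1 ≤ ⌊x⌋ := Int.le_floor.2 (by push_cast; linarith)
      omega
    have h3 : Int.fract x = x - (n - 1) := by rw [Int.fract, h2]; push_cast; ring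
    rw [staircase, h2, Real.smoothTransition.one_of_one_le]
    · push_cast; linarith
    · rw [h3]; linarith

theorem staircase_le {n : ℤ} {x : ℝ} (h : x ≤ n + 1 / 3) : staircase x ≤ n := by
  rcases lt_or_ge ⌊x⌋ n with h1 | h1
  · refine (staircase_le_floor_add_one x).trans ?_
    exact_mod_cast h1
  · have h2 : ⌊x⌋ = n := by
      refine le_antisymm (Int.lt_add_one_iff.1 (Int.floor_lt.2 ?_)) h1
      push_cast; linarith
    have h3 : Int.fract x = x - n := by rw [Int.fract, h2]
    rw [staircase, h2, Real.smoothTransition.zero_of_nonpos]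
    · simp
    · rw [h3]; linarith

theorem staircase_monotone : Monotone staircase := by
  intro x y h
  rcases (Int.floor_mono h).eq_or_lt with h1 | h1
  · rw [staircase, staircase, h1]
    have : Int.fract x ≤ Int.fract y := by rw [Int.fract, Int.fract, h1]; linarith
    gcongr
    apply Real.smoothTransition.monotone
    linarith
  · calc staircase x ≤ ⌊x⌋ + 1 := staircase_le_floor_add_one x
      _ ≤ ⌊y⌋ := by exact_mod_cast h1
      _ ≤ _ := floor_le_staircase y

theorem staircase_add_nat (x : ℝ) (n : ℕ) : staircase (x + n) = staircase x + n := by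
  simp [staircase]; ring

theorem abs_staircase_sub_le (x : ℝ) : |staircase x - x| ≤ 1 := by
  rw [abs_le]
  constructor <;> linarith [floor_le_staircase x, staircase_le_floor_add_one x, Int.floor_le x,
    Int.lt_floor_add_one x]

theorem contDiff_staircase : ContDiff ℝ ∞ staircase := by
  rw [contDiff_iff_contDiffAt]
  intro x
  by_cases hx : (⌊x⌋ : ℝ) = x
  · have : staircase =ᶠ[𝓝 x] fun _ ↦ (⌊x⌋ : ℝ) := by
      filter_upwards [Ioo_mem_nhds (show x - 1 / 3 < x by linarith)
        (show x < x + 1 / 3 by linarith)] with y hy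
      exact le_antisymm (staircase_le (by rw [hx]; exact hy.2.le))
        (le_staircase (by rw [hx]; exact hy.1.le))
    exact contDiffAt_const.congr_of_eventuallyEq this
  · have : staircase =ᶠ[𝓝 x] fun y ↦ ⌊x⌋ + Real.smoothTransition (3 * (y - ⌊x⌋) - 1) := by
      filter_upwards [Ioo_mem_nhds (lt_of_le_of_ne (Int.floor_le x) hx)
        (Int.lt_floor_add_one x)] with y hy
      have : ⌊y⌋ = ⌊x⌋ := Int.floor_eq_iff.2 ⟨hy.1.le, hy.2⟩
      rw [staircase, Int.fract, this]
    refine ContDiffAt.congr_of_eventuallyEq ?_ this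
    refine contDiffAt_const.add (ContDiff.contDiffAt ?_)
    exact Real.smoothTransition.contDiff.comp (by fun_prop)

theorem exists_deriv_staircase_le : ∃ C, 1 ≤ C ∧ ∀ x, |deriv staircase x| ≤ C := by
  have hper : Function.Periodic (deriv staircase) 1 := by
    intro x
    have h : (fun y ↦ staircase (y + 1)) = fun y ↦ staircase y + 1 := by
      ext y; exact_mod_cast staircase_add_nat y 1
    have := deriv_comp_add_const staircase 1 x
    rw [← this, h, deriv_add_const]
  obtain ⟨C, hC⟩ := (isCompact_Icc (a := (0 : ℝ)) (b := 1)).exists_bound_of_continuousOn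
    (contDiff_staircase.continuous_deriv (by simp)).continuousOn
  refine ⟨max C 1, le_max_right _ _, fun x ↦ ?_⟩
  obtain ⟨y, hy, hxy⟩ := hper.exists_mem_Ico₀ one_pos x
  rw [hxy]
  exact (hC y (Ico_subset_Icc_self hy)).trans (le_max_left _ _)

/-- Values are at most `n` left of `n + 1/3` and at least `n` right of `n - 1/3`, and one of these
half-lines is a neighbourhood of `x`. Local extremality is the form of flatness used later: near `x`
the function stays on one side of its value. -/
theorem staircase_isLocalExtr {x : ℝ} {n : ℤ} (h : staircase x = n) : IsLocalExtr staircase x := by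
  rcases le_total x n with hx | hx
  · refine Or.inr ?_
    filter_upwards [Iio_mem_nhds (show x < n + 1 / 3 by linarith)] with y hy
    rw [h]; exact staircase_le (le_of_lt hy)
  · refine Or.inl ?_
    filter_upwards [Ioi_mem_nhds (show (n : ℝ) - 1 / 3 < x by linarith)] with y hy
    rw [h]; exact le_staircase (le_of_lt hy)

/-- Smooth monotone lifts of circle maps that are `δ`-close to the identity, with derivative
bounded by `L`. -/
structure IsNearIdentity (L δ : ℝ) (q : ℝ → ℝ) : Prop where
  contDiff : ContDiff ℝ ∞ q
  monotone : Monotone q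
  add_two_pi : ∀ t, q (t + 2 * Real.pi) = q t + 2 * Real.pi
  abs_sub_le : ∀ t, |q t - t| ≤ δ
  abs_deriv_le : ∀ t, |deriv q t| ≤ L

theorem IsNearIdentity.surjective {L δ : ℝ} {q : ℝ → ℝ} (hq : IsNearIdentity L δ q) :
    Function.Surjective q :=
  surjective_of_add_two_pi hq.monotone hq.contDiff.continuous hq.add_two_pi

theorem IsNearIdentity.comp {L L' δ δ' : ℝ} {q q' : ℝ → ℝ} (hq : IsNearIdentity L δ q)
    (hq' : IsNearIdentity L' δ' q') : IsNearIdentity (L * L') (δ + δ') (q ∘ q') where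
  contDiff := hq.contDiff.comp hq'.contDiff
  monotone := hq.monotone.comp hq'.monotone
  add_two_pi t := by simp only [Function.comp_apply, hq'.add_two_pi, hq.add_two_pi]
  abs_sub_le t := by
    have h1 := hq.abs_sub_le (q' t)
    have h2 := hq'.abs_sub_le t
    rw [abs_le] at *
    constructor <;> simp only [Function.comp_apply] <;> linarith
  abs_deriv_le t := by
    rw [deriv_comp t (hq.contDiff.differentiable (by simp) _)
      (hq'.contDiff.differentiable (by simp) _), abs_mul]
    exact mul_le_mul (hq.abs_deriv_le _) (hq'.abs_deriv_le _) (abs_nonneg _)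
      ((abs_nonneg _).trans (hq.abs_deriv_le t))

/-- A staircase with `m` steps per turn, anchored at `y`. Large `m` brings it within `2π / m` of the
identity, while the slope bound is independent of `m`, since both axes are rescaled equally. -/
theorem exists_isNearIdentity_flat_at : ∃ C, 1 ≤ C ∧ ∀ (y : ℝ) {δ : ℝ}, 0 < δ →
    ∃ q, IsNearIdentity C δ q ∧ ∀ t (k : ℤ), q t = y + k * (2 * Real.pi) → IsLocalExtr q t := by
  obtain ⟨C, hC1, hC⟩ := exists_deriv_staircase_le
  refine ⟨C, hC1, fun y δ hδ ↦ ?_⟩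
  have hpi := Real.pi_pos
  obtain ⟨m, hm⟩ := exists_nat_gt (2 * Real.pi / δ)
  have hm0 : (0 : ℝ) < m := lt_trans (by positivity) hm
  set a : ℝ := m / (2 * Real.pi) with ha
  have ha0 : 0 < a := by positivity
  set q : ℝ → ℝ := fun t ↦ y + a⁻¹ * staircase (a * (t - y)) with hq
  have hd : ∀ t, HasDerivAt q (deriv staircase (a * (t - y))) t := by
    intro t
    have h1 : HasDerivAt (fun t ↦ a * (t - y)) (a * 1) t :=
      ((hasDerivAt_id t).sub_const y).const_mul a
    have h2 := ((contDiff_staircase.differentiable (by simp) _).hasDerivAt.comp t h1)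
    have h3 : deriv staircase (a * (t - y)) = a⁻¹ * (deriv staircase (a * (t - y)) * (a * 1)) := by
      field_simp
    rw [h3]
    exact (h2.const_mul a⁻¹).const_add y
  refine ⟨q, ⟨?_, ?_, fun t ↦ ?_, fun t ↦ ?_, fun t ↦ ?_⟩, fun t k h ↦ ?_⟩
  · exact contDiff_const.add (contDiff_const.mul (contDiff_staircase.comp (by fun_prop)))
  · intro s t h
    simp only [hq]
    gcongr
    apply staircase_monotone
    gcongr
  · simp only [hq]
    have : a * (t + 2 * Real.pi - y) = a * (t - y) + m := by rw [ha]; field_simp; ring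
    rw [this, staircase_add_nat, mul_add, ha]
    field_simp
    ring
  · have h1 : q t - t = a⁻¹ * (staircase (a * (t - y)) - a * (t - y)) := by
      simp only [hq]; field_simp; ring
    rw [h1, abs_mul, abs_of_pos (inv_pos.2 ha0)]
    calc _ ≤ a⁻¹ * 1 := by gcongr; exact abs_staircase_sub_le _
      _ ≤ δ := by
        rw [div_lt_iff₀ hδ] at hm
        rw [mul_one, ha, inv_div, div_le_iff₀ hm0]
        linarith
  · rw [(hd t).deriv]; exact hC _
  · have h1 : staircase (a * (t - y)) = ((k * m : ℤ) : ℝ) := by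
      simp only [hq] at h
      have h2 : a⁻¹ * staircase (a * (t - y)) = k * (2 * Real.pi) := by linarith
      rw [inv_mul_eq_iff_eq_mul₀ ha0.ne'] at h2
      rw [h2, ha]; push_cast; field_simp
    have hcont : Filter.Tendsto (fun t ↦ a * (t - y)) (𝓝 t) (𝓝 (a * (t - y))) :=
      (by fun_prop : Continuous fun t ↦ a * (t - y)).continuousAt
    rcases staircase_isLocalExtr h1 with h3 | h3
    · refine Or.inl ?_
      filter_upwards [hcont.eventually h3] with s hs
      simp only [hq]; gcongr
    · refine Or.inr ?_
      filter_upwards [hcont.eventually h3] with s hs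
      simp only [hq]; gcongr

/-- Induction on `F`: a map `q` that is flat over the old values is precomposed with a map `p` that
is flat over a preimage `y` of the new one. Slope bounds multiply, so `L` depends on `F` but not on
`δ`; displacements add, hence `δ / 2` for each. -/
theorem exists_isNearIdentity_flat_on (F : Finset ℝ) : ∃ L, 1 ≤ L ∧ ∀ δ > 0,
    ∃ q, IsNearIdentity L δ q ∧
      ∀ t, ∀ f ∈ F, ∀ k : ℤ, q t = f + k * (2 * Real.pi) → IsLocalExtr q t := by
  classical
  obtain ⟨C, hC1, hC⟩ := exists_isNearIdentity_flat_at
  induction F using Finset.induction_on with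
  | empty =>
    refine ⟨1, le_rfl, fun δ hδ ↦ ⟨id, ⟨contDiff_id, monotone_id, fun t ↦ rfl, fun t ↦ ?_,
      fun t ↦ ?_⟩, by simp⟩⟩
    · simp [hδ.le]
    · simp
  | insert f F _ ih =>
    obtain ⟨L, hL1, hL⟩ := ih
    refine ⟨L * C, one_le_mul_of_one_le_of_one_le hL1 hC1, fun δ hδ ↦ ?_⟩
    obtain ⟨q, hq, hqF⟩ := hL (δ / 2) (by positivity)
    obtain ⟨y, hy⟩ := hq.surjective f
    obtain ⟨p, hp, hpy⟩ := hC y (δ := δ / 2) (by positivity)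
    have hcomp := hq.comp hp
    rw [add_halves] at hcomp
    refine ⟨q ∘ p, hcomp, fun t f' hf' k h ↦ ?_⟩
    have hpt : Filter.Tendsto p (𝓝 t) (𝓝 (p t)) := hp.contDiff.continuous.continuousAt
    have lift : IsLocalExtr q (p t) → IsLocalExtr (q ∘ p) t := by
      rintro (h1 | h1)
      · exact Or.inl (hpt.eventually h1)
      · exact Or.inr (hpt.eventually h1)
    rw [Function.comp_apply] at h
    rcases Finset.mem_insert.1 hf' with rfl | hf'
    · have hyk : q (y + k * (2 * Real.pi)) = q (p t) := by
        rw [add_int_mul_of_add_two_pi hq.add_two_pi, hy, h]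
      -- The monotone `q` takes the same value at `p t` and at `y + 2πk`. If these points differ, `p
      -- t` is already a local extremum of `q`; if they agree, the flatness of `p` is used.
      rcases lt_trichotomy (p t) (y + k * (2 * Real.pi)) with h1 | h1 | h1
      · apply lift
        refine Or.inr ?_
        filter_upwards [Iio_mem_nhds h1] with s hs
        rw [← hyk]; exact hq.monotone (le_of_lt hs)
      · rcases hpy t k h1 with h2 | h2
        · exact Or.inl (h2.mono fun s hs ↦ hq.monotone hs)
        · exact Or.inr (h2.mono fun s hs ↦ hq.monotone hs)
      · apply lift
        refine Or.inl ?_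
        filter_upwards [Ioi_mem_nhds h1] with s hs
        rw [← hyk]; exact hq.monotone (le_of_lt hs)
    · exact lift (hqF (p t) f' hf' k h)

/-- `G` agrees with smooth functions on a right and on a left neighbourhood of every point. -/
def IsPiecewiseSmooth (G : ℝ → ℝ) : Prop :=
  ∀ t, (∃ g, ContDiff ℝ ∞ g ∧ G =ᶠ[𝓝[≥] t] g) ∧ ∃ g, ContDiff ℝ ∞ g ∧ G =ᶠ[𝓝[≤] t] g

/-- The one-sided germs at `t` are two-sided germs at all nearby points other than `t`, so
compactness of a period leaves finitely many exceptions. -/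
theorem IsPiecewiseSmooth.exists_singular {G : ℝ → ℝ} (hG : IsPiecewiseSmooth G)
    (hper : ∀ t, G (t + 2 * Real.pi) = G t) : ∃ F : Finset ℝ, ∀ t,
      (∀ f ∈ F, ∀ k : ℤ, t ≠ f + k * (2 * Real.pi)) →
      ∃ g, ContDiff ℝ ∞ g ∧ G =ᶠ[𝓝 t] g := by
  have hloc : ∀ t, ∃ U ∈ 𝓝 t, ∀ s ∈ U, s ≠ t → ∃ g, ContDiff ℝ ∞ g ∧ G =ᶠ[𝓝 s] g := by
    intro t
    obtain ⟨⟨g, hg, hGg⟩, g', hg', hGg'⟩ := hG t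
    obtain ⟨u, hu, hu'⟩ := mem_nhdsGE_iff_exists_Ico_subset.1 hGg
    obtain ⟨l, hl, hl'⟩ := mem_nhdsLE_iff_exists_Ioc_subset.1 hGg'
    refine ⟨Ioo l u, Ioo_mem_nhds hl hu, fun s hs hst ↦ ?_⟩
    rcases lt_or_gt_of_ne hst with h | h
    · refine ⟨g', hg', ?_⟩
      filter_upwards [Ioo_mem_nhds hs.1 h] with x hx
      exact hl' ⟨hx.1, hx.2.le⟩
    · refine ⟨g, hg, ?_⟩
      filter_upwards [Ioo_mem_nhds h hs.2] with x hx
      exact hu' ⟨hx.1.le, hx.2⟩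
  choose U hU hUs using hloc
  obtain ⟨F, -, hF⟩ := (isCompact_Icc (a := (0 : ℝ)) (b := 2 * Real.pi)).elim_nhds_subcover U
    fun t _ ↦ hU t
  refine ⟨F, fun t ht ↦ ?_⟩
  obtain ⟨k, hk, -⟩ := existsUnique_add_zsmul_mem_Ico Real.two_pi_pos t 0
  rw [zsmul_eq_mul, zero_add] at hk
  obtain ⟨f, hf, hfU⟩ := mem_iUnion₂.1 (hF (Ico_subset_Icc_self hk))
  obtain ⟨g, hg, hGg⟩ := hUs f _ hfU fun h ↦ ht f hf (-k) (by push_cast; linarith)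
  refine ⟨fun s ↦ g (s + k * (2 * Real.pi)), hg.comp (by fun_prop), ?_⟩
  have hc : Filter.Tendsto (fun s ↦ s + k * (2 * Real.pi)) (𝓝 t) (𝓝 (t + k * (2 * Real.pi))) :=
    (by fun_prop : Continuous fun s ↦ s + k * (2 * Real.pi)).continuousAt
  filter_upwards [hc.eventually hGg] with s hs
  rw [← hs]
  exact (exists_periodic_shift hper s k).symm

/-- A periodic piecewise smooth function becomes smooth after a reparametrisation close to the
identity, with a uniform bound on the derivative. -/
theorem IsPiecewiseSmooth.exists_reparametrization {G : ℝ → ℝ} (hG : IsPiecewiseSmooth G)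
    (hper : ∀ t, G (t + 2 * Real.pi) = G t) : ∃ L, 1 ≤ L ∧ ∀ δ > 0,
      ∃ q, IsNearIdentity L δ q ∧ ContDiff ℝ ∞ (G ∘ q) := by
  obtain ⟨F, hF⟩ := hG.exists_singular hper
  obtain ⟨L, hL1, hL⟩ := exists_isNearIdentity_flat_on F
  refine ⟨L, hL1, fun δ hδ ↦ ?_⟩
  obtain ⟨q, hq, hqF⟩ := hL δ hδ
  refine ⟨q, hq, contDiff_iff_contDiffAt.2 fun t ↦ ?_⟩
  have hqt : Filter.Tendsto q (𝓝 t) (𝓝 (q t)) := hq.contDiff.continuous.continuousAt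
  have fin : ∀ g, ContDiff ℝ ∞ g → (∀ᶠ s in 𝓝 t, G (q s) = g (q s)) →
      ContDiffAt ℝ ∞ (G ∘ q) t := fun g hg h ↦
    (hg.comp hq.contDiff).contDiffAt.congr_of_eventuallyEq h
  by_cases h : ∀ f ∈ F, ∀ k : ℤ, q t ≠ f + k * (2 * Real.pi)
  · obtain ⟨g, hg, hGg⟩ := hF _ h
    exact fin g hg (hqt.eventually hGg)
  · push Not at h
    obtain ⟨f, hf, k, hk⟩ := h
    -- Near `t` the map `q` stays on one side of the singular value `q t`, where `G` agrees with a
    -- single smooth function.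
    rcases hqF t f hf k hk with h1 | h1
    · obtain ⟨g, hg, hGg⟩ := (hG (q t)).1
      exact fin g hg ((tendsto_nhdsWithin_iff.2 ⟨hqt, h1⟩).eventually hGg)
    · obtain ⟨g, hg, hGg⟩ := (hG (q t)).2
      exact fin g hg ((tendsto_nhdsWithin_iff (s := Iic (q t)).2 ⟨hqt, h1⟩).eventually hGg)

/-! ### The gauge of a planar convex body along the unit circle -/

theorem circ_ne_zero (t : ℝ) : circ t ≠ 0 := by
  intro h
  have := rad_smul_circ zero_le_one t
  rw [h] at this
  have h2 := rad_sq (1 • (0 : ℝ × ℝ))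
  simp only [smul_zero] at this h2
  rw [this] at h2
  norm_num at h2

theorem gauge_pos_of_ne_zero {K : Set (ℝ × ℝ)} (hK : IsCompact K) (h0 : K ∈ 𝓝 0) {x : ℝ × ℝ}
    (hx : x ≠ 0) : 0 < gauge K x :=
  (gauge_pos (absorbent_nhds_zero h0)
    ((NormedSpace.isVonNBounded_iff ℝ).2 hK.isBounded)).2 hx

theorem mem_iff_gauge_le_one {K : Set (ℝ × ℝ)} (hK : IsCompact K) (hconv : Convex ℝ K)
    (h0 : K ∈ 𝓝 0) {x : ℝ × ℝ} : x ∈ K ↔ gauge K x ≤ 1 := by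
  rw [gauge_le_one_iff_mem_closure hconv h0, hK.isClosed.closure_eq]

theorem gauge_smul_circ {K : Set (ℝ × ℝ)} {r : ℝ} (hr : 0 ≤ r) (t : ℝ) :
    gauge K (r • circ t) = r * gauge K (circ t) := by
  rw [gauge_smul_of_nonneg hr, smul_eq_mul]

theorem norm_circ_sub_circ_le (s t : ℝ) : ‖circ s - circ t‖ ≤ |s - t| := by
  rw [circ, circ, Prod.mk_sub_mk, Prod.norm_mk, max_le_iff]
  exact ⟨Real.abs_cos_sub_cos_le s t, Real.abs_sin_sub_sin_le s t⟩

theorem exists_gauge_circ_lipschitz {K : Set (ℝ × ℝ)} (hconv : Convex ℝ K) (h0 : K ∈ 𝓝 0) :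
    ∃ C, 0 < C ∧ ∀ s t, |gauge K (circ s) - gauge K (circ t)| ≤ C * |s - t| := by
  obtain ⟨C, hC⟩ := hconv.lipschitz_gauge h0
  refine ⟨C + 1, by positivity, fun s t ↦ ?_⟩
  have := hC.dist_le_mul (circ s) (circ t)
  rw [Real.dist_eq, dist_eq_norm] at this
  refine this.trans ?_
  gcongr
  · simp
  · exact norm_circ_sub_circ_le s t

theorem continuous_gauge_circ {K : Set (ℝ × ℝ)} (hconv : Convex ℝ K) (h0 : K ∈ 𝓝 0) :
    Continuous fun t ↦ gauge K (circ t) :=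
  (continuous_gauge hconv h0).comp contDiff_circ.continuous

/-- The area of a convex body in terms of its radial function. -/
theorem integral_inv_gauge_sq {K : Set (ℝ × ℝ)} (hK : IsCompact K) (hconv : Convex ℝ K)
    (h0 : K ∈ 𝓝 0) (hvol : volume K = 1) :
    ∫ t in (0 : ℝ)..(2 * Real.pi), (gauge K (circ t))⁻¹ ^ 2 = 2 := by
  set ρ : ℝ → ℝ := fun t ↦ (gauge K (circ t))⁻¹ with hρ
  have hG : ∀ t, 0 < gauge K (circ t) := fun t ↦ gauge_pos_of_ne_zero hK h0 (circ_ne_zero t)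
  have hρpos : ∀ t, 0 < ρ t := fun t ↦ inv_pos.2 (hG t)
  have hρc : Continuous ρ := (continuous_gauge_circ hconv h0).inv₀ fun t ↦ (hG t).ne'
  have hmem : ∀ r t, 0 < r → (r • circ t ∈ K ↔ r ≤ ρ t) := by
    intro r t hr
    rw [mem_iff_gauge_le_one hK hconv h0, gauge_smul_circ hr.le]
    simp only [hρ]
    rw [← one_div, le_div_iff₀ (hG t)]
  have h1 := lintegral_comp_polarCoord_symm (K.indicator 1)
  rw [lintegral_indicator_one hK.measurableSet, hvol] at h1
  have hsymm : ∀ p : ℝ × ℝ, polarCoord.symm p = p.1 • circ p.2 := fun p ↦ rfl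
  have htarget : polarCoord.target = Ioi (0 : ℝ) ×ˢ Ioo (-Real.pi) Real.pi := rfl
  -- For fixed `t` the integral of `r` over `(0, ρ t]` is `ρ t ^ 2 / 2`.
  have h2 : ∫⁻ p in Ioi (0 : ℝ) ×ˢ Ioo (-Real.pi) Real.pi,
      ENNReal.ofReal p.1 • K.indicator 1 (polarCoord.symm p) =
      ∫⁻ t in Ioo (-Real.pi) Real.pi, ENNReal.ofReal (ρ t ^ 2 / 2) := by
    rw [Measure.volume_eq_prod, ← Measure.prod_restrict, lintegral_prod_symm]
    · refine lintegral_congr fun t ↦ ?_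
      have h3 : ∫⁻ r in Ioi (0 : ℝ), ENNReal.ofReal r • K.indicator 1 (polarCoord.symm (r, t)) =
          ∫⁻ r in Ioi (0 : ℝ), (Ioc 0 (ρ t)).indicator (fun r ↦ ENNReal.ofReal r) r := by
        apply setLIntegral_congr_fun measurableSet_Ioi
        intro r hr
        simp only [hsymm, smul_eq_mul]
        by_cases h : r ≤ ρ t
        · rw [indicator_of_mem ((hmem r t hr).2 h), indicator_of_mem (show r ∈ Ioc 0 (ρ t) from
            ⟨hr, h⟩)]
          simp
        · rw [indicator_of_notMem fun h' ↦ h ((hmem r t hr).1 h'),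
            indicator_of_notMem fun h' : r ∈ Ioc 0 (ρ t) ↦ h h'.2]
          simp
      rw [h3, setLIntegral_indicator measurableSet_Ioc,
        inter_eq_self_of_subset_left Ioc_subset_Ioi_self]
      rw [← ofReal_integral_eq_lintegral_ofReal]
      · rw [← intervalIntegral.integral_of_le (hρpos t).le, integral_id]
        congr 1; ring
      · exact (continuous_id.integrableOn_Icc).mono_set Ioc_subset_Icc_self
      · filter_upwards [ae_restrict_mem measurableSet_Ioc] with r hr using hr.1.le
    · apply Measurable.aemeasurable
      apply (ENNReal.measurable_ofReal.comp measurable_fst).smul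
      exact (measurable_one.indicator hK.measurableSet).comp
        continuous_polarCoord_symm.measurable
  rw [htarget, h2, ← ofReal_integral_eq_lintegral_ofReal] at h1
  · rw [← integral_Ioc_eq_integral_Ioo, ← intervalIntegral.integral_of_le
      (by linarith [Real.pi_pos]), intervalIntegral.integral_div, ENNReal.ofReal_eq_one] at h1
    have hper : Function.Periodic (fun t ↦ ρ t ^ 2) (2 * Real.pi) := fun t ↦ by
      simp only [hρ, circ_add_two_pi]
    have h4 := hper.intervalIntegral_add_eq 0 (-Real.pi)
    rw [zero_add, show -Real.pi + 2 * Real.pi = Real.pi by ring] at h4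
    rw [h4]
    linarith
  · exact ((by fun_prop : Continuous fun t ↦ ρ t ^ 2 / 2).integrableOn_Icc).mono_set
      Ioo_subset_Icc_self
  · exact Filter.Eventually.of_forall fun t ↦ by have := hρpos t; positivity

/-! ### Polygonal and smooth boundaries -/

/-- A sinusoid vanishing at `t` is a multiple of `sin (s - t)`, which has a constant sign on each
side of `t`. Applied to differences, this makes linear functionals on the circle comparable on
either side of a direction. -/
theorem sinusoid_eventually_comparable (a b t : ℝ) (l : Filter ℝ)
    (hl : l = 𝓝[>] t ∨ l = 𝓝[<] t) :
    (∀ᶠ s in l, 0 ≤ a * Real.cos s + b * Real.sin s) ∨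
      ∀ᶠ s in l, a * Real.cos s + b * Real.sin s ≤ 0 := by
  have hl' : l ≤ 𝓝 t := by rcases hl with rfl | rfl <;> exact nhdsWithin_le_nhds
  have hcont : Filter.Tendsto (fun s ↦ a * Real.cos s + b * Real.sin s) l
      (𝓝 (a * Real.cos t + b * Real.sin t)) :=
    ((by fun_prop : Continuous fun s ↦ a * Real.cos s + b * Real.sin s).tendsto t).mono_left hl'
  rcases lt_trichotomy (a * Real.cos t + b * Real.sin t) 0 with h | h | h
  · exact Or.inr ((hcont.eventually (gt_mem_nhds h)).mono fun s hs ↦ le_of_lt hs)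
  · have key : ∀ s, a * Real.cos s + b * Real.sin s =
        (b * Real.cos t - a * Real.sin t) * Real.sin (s - t) := by
      intro s
      rw [Real.sin_sub]
      linear_combination (-(a * Real.cos s + b * Real.sin s)) * Real.cos_sq_add_sin_sq t +
        (Real.cos t * Real.cos s + Real.sin s * Real.sin t) * h
    simp only [key]
    have hsin : (∀ᶠ s in l, 0 ≤ Real.sin (s - t)) ∨ ∀ᶠ s in l, Real.sin (s - t) ≤ 0 := by
      rcases hl with rfl | rfl
      · left
        filter_upwards [Ioo_mem_nhdsGT (show t < t + Real.pi by linarith [Real.pi_pos])] with s hs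
        exact Real.sin_nonneg_of_nonneg_of_le_pi (by linarith [hs.1]) (by linarith [hs.2])
      · right
        filter_upwards [Ioo_mem_nhdsLT (show t - Real.pi < t by linarith [Real.pi_pos])] with s hs
        exact Real.sin_nonpos_of_nonpos_of_neg_pi_le (by linarith [hs.2]) (by linarith [hs.1])
    rcases le_total 0 (b * Real.cos t - a * Real.sin t) with hb | hb
    · rcases hsin with h1 | h1
      · exact Or.inl (h1.mono fun s hs ↦ mul_nonneg hb hs)
      · exact Or.inr (h1.mono fun s hs ↦ mul_nonpos_of_nonneg_of_nonpos hb hs)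
    · rcases hsin with h1 | h1
      · exact Or.inr (h1.mono fun s hs ↦ mul_nonpos_of_nonpos_of_nonneg hb hs)
      · exact Or.inl (h1.mono fun s hs ↦ mul_nonneg_of_nonpos_of_nonpos hb hs)
  · exact Or.inl ((hcont.eventually (lt_mem_nhds h)).mono fun s hs ↦ le_of_lt hs)

/-- Among finitely many functions that are pairwise comparable along a filter, one is the largest. -/
theorem exists_eventually_max {ι : Type*} {l : Filter ℝ} {u : ι → ℝ → ℝ}
    (hu : ∀ i j, u i ≤ᶠ[l] u j ∨ u j ≤ᶠ[l] u i) (J : Finset ι) (hJ : J.Nonempty) :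
    ∃ j ∈ J, ∀ i ∈ J, u i ≤ᶠ[l] u j := by
  classical
  induction hJ using Finset.Nonempty.cons_induction with
  | singleton a =>
    exact ⟨a, by simp, fun i hi ↦ by rw [Finset.mem_singleton.1 hi]⟩
  | cons a s _ _ ih =>
    obtain ⟨j, hj, hmax⟩ := ih
    rcases hu a j with h | h
    · refine ⟨j, by simp [hj], fun i hi ↦ ?_⟩
      rcases Finset.mem_cons.1 hi with rfl | hi
      · exact h
      · exact hmax i hi
    · refine ⟨a, by simp, fun i hi ↦ ?_⟩
      rcases Finset.mem_cons.1 hi with rfl | hi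
      · rfl
      · exact (hmax i hi).trans h

/-- The linear functional equal to `1` at `p.1` and `p.2`. -/
noncomputable def lineFunctional (p : (ℝ × ℝ) × (ℝ × ℝ)) (x : ℝ × ℝ) : ℝ :=
  cross x (p.2 - p.1) / cross p.1 p.2

theorem lineFunctional_smul (p : (ℝ × ℝ) × (ℝ × ℝ)) (c : ℝ) (x : ℝ × ℝ) :
    lineFunctional p (c • x) = c * lineFunctional p x := by
  simp [lineFunctional, cross]; ring

theorem lineFunctional_le_gauge {K : Set (ℝ × ℝ)} (hK : IsCompact K) (hconv : Convex ℝ K)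
    (h0 : K ∈ 𝓝 0) {p : (ℝ × ℝ) × (ℝ × ℝ)} (hp : ∀ y ∈ K, lineFunctional p y ≤ 1) {x : ℝ × ℝ}
    (hx : x ≠ 0) : lineFunctional p x ≤ gauge K x := by
  have hg := gauge_pos_of_ne_zero hK h0 hx
  have hmem : (gauge K x)⁻¹ • x ∈ K := by
    rw [mem_iff_gauge_le_one hK hconv h0, gauge_smul_of_nonneg (by positivity), smul_eq_mul, inv_mul_cancel₀ hg.ne']
  have := hp _ hmem
  rw [lineFunctional_smul, inv_mul_le_iff₀ hg] at this
  linarith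

/-- In a direction that does not meet a vertex, the gauge of a polygon is given by an edge. -/
theorem exists_lineFunctional_eq_gauge {s : Finset (ℝ × ℝ)}
    (hK : IsCompact (convexHull ℝ (s : Set (ℝ × ℝ))))
    (h0 : convexHull ℝ (s : Set (ℝ × ℝ)) ∈ 𝓝 0) {x : ℝ × ℝ} (hx : x ≠ 0)
    (hxs : ∀ v ∈ s, ∀ r : ℝ, 0 < r → v ≠ r • x) :
    ∃ p ∈ s ×ˢ s, (∀ y ∈ convexHull ℝ (s : Set (ℝ × ℝ)), lineFunctional p y ≤ 1) ∧
      gauge (convexHull ℝ (s : Set (ℝ × ℝ))) x = lineFunctional p x := by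
  set K := convexHull ℝ (s : Set (ℝ × ℝ)) with hKdef
  have hconv : Convex ℝ K := convex_convexHull ℝ _
  have hg := gauge_pos_of_ne_zero hK h0 hx
  set y := (gauge K x)⁻¹ • x with hy
  have hgy : gauge K y = 1 := by
    rw [hy, gauge_smul_of_nonneg (by positivity), smul_eq_mul, inv_mul_cancel₀ hg.ne']
  have hyK : y ∈ K := by
    rw [mem_iff_gauge_le_one hK hconv h0, hgy]
  have hyint : y ∉ interior K := fun h ↦ by
    have := (gauge_lt_one_iff_mem_interior hconv h0).2 h
    linarith
  -- A supporting line at the boundary point `y`. The points of `s` with nonzero weight in `y` all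
  -- lie on it, and there are at least two of them because `y` is not in `s`; two of them determine
  -- the line.
  obtain ⟨f, hf⟩ := geometric_hahn_banach_open_point hconv.interior isOpen_interior hyint
  have hfy : 0 < f y := by
    have := hf 0 (mem_interior_iff_mem_nhds.2 h0)
    simpa using this
  have hfK : ∀ z ∈ K, f z ≤ f y := by
    intro z hz
    have h1 : z ∈ closure (interior K) := by
      rw [hconv.closure_interior_eq_closure_of_nonempty_interior ⟨0, mem_interior_iff_mem_nhds.2 h0⟩]
      exact subset_closure hz
    exact closure_minimal (fun a ha ↦ (hf a ha).le) (isClosed_le f.continuous continuous_const) h1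
  have hsK : ∀ v ∈ s, v ∈ K := fun v hv ↦ subset_convexHull ℝ _ hv
  obtain ⟨w, hw0, hw1, hwy⟩ := Finset.mem_convexHull.1 hyK
  rw [Finset.centerMass_eq_of_sum_1 _ _ hw1] at hwy
  simp only [id] at hwy
  have hfw : ∀ v ∈ s, w v ≠ 0 → f v = f y := by
    have hsum : ∑ v ∈ s, w v * (f y - f v) = 0 := by
      have : f y = ∑ v ∈ s, w v * f v := by
        conv_lhs => rw [← hwy]
        simp
      simp only [mul_sub]
      rw [Finset.sum_sub_distrib, ← Finset.sum_mul, hw1, ← this]; ring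
    have := (Finset.sum_eq_zero_iff_of_nonneg fun v hv ↦
      mul_nonneg (hw0 v hv) (sub_nonneg.2 (hfK v (hsK v hv)))).1 hsum
    intro v hv hwv
    rcases mul_eq_zero.1 (this v hv) with h | h
    · exact absurd h hwv
    · linarith
  obtain ⟨u, hu, hwu⟩ : ∃ u ∈ s, w u ≠ 0 := by
    by_contra! h
    rw [Finset.sum_eq_zero h] at hw1
    norm_num at hw1
  obtain ⟨v, hv, hwv, huv⟩ : ∃ v ∈ s, w v ≠ 0 ∧ v ≠ u := by
    by_contra! h
    have h1 : ∀ v ∈ s, v ≠ u → w v = 0 := fun v hv hvu ↦ by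
      by_contra h2; exact hvu (h v hv h2)
    rw [Finset.sum_eq_single_of_mem u hu h1] at hw1
    rw [Finset.sum_eq_single_of_mem u hu fun v hv hvu ↦ by rw [h1 v hv hvu, zero_smul], hw1,
      one_smul] at hwy
    exact hxs u hu _ (inv_pos.2 hg) (hwy.trans hy)
  have hfu := hfw u hu hwu
  have hfv := hfw v hv hwv
  have hfc : ∀ z : ℝ × ℝ, f z = z.1 * f (1, 0) + z.2 * f (0, 1) := fun z ↦ by
    rw [← smul_eq_mul, ← smul_eq_mul, ← map_smul, ← map_smul, ← map_add]; congr 1; ext <;> simp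
  set a := f (1, 0)
  set b := f (0, 1)
  have hcross : cross u v ≠ 0 := by
    intro hc
    apply huv
    rw [hfc] at hfu hfv
    simp only [cross] at hc
    ext
    · apply mul_left_cancel₀ hfy.ne'
      linear_combination v.1 * (-hfu) + u.1 * hfv + b * (-hc)
    · apply mul_left_cancel₀ hfy.ne'
      linear_combination v.2 * (-hfu) + u.2 * hfv + a * hc
  have hline : ∀ z, lineFunctional (u, v) z = f z / f y := by
    intro z
    rw [lineFunctional, div_eq_div_iff hcross hfy.ne', hfc z]
    rw [hfc] at hfu hfv
    simp only [cross, Prod.fst_sub, Prod.snd_sub]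
    linear_combination (-(z.1 * v.2 - z.2 * v.1)) * hfu + (z.1 * u.2 - z.2 * u.1) * hfv
  refine ⟨(u, v), Finset.mem_product.2 ⟨hu, hv⟩, fun z hz ↦ ?_, ?_⟩
  · rw [hline, div_le_one hfy]
    exact hfK z hz
  · rw [hline, hy, map_smul, smul_eq_mul]
    have : f x ≠ 0 := by
      intro h
      rw [hy, map_smul, h] at hfy
      simp at hfy
    field_simp

theorem eventually_notMem_of_finite {S : Set ℝ} (hS : S.Finite) (t : ℝ) :
    ∀ᶠ s in 𝓝[≠] t, s ∉ S := by
  have h := (hS.subset (sdiff_subset (t := {t}))).isClosed.isOpen_compl.mem_nhds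
    (show t ∈ (S \ {t})ᶜ by simp)
  filter_upwards [mem_nhdsWithin_of_mem_nhds h, self_mem_nhdsWithin] with s hs hst hsS
  exact hs ⟨hsS, hst⟩

theorem eventually_ne_smul_circ (v : ℝ × ℝ) (t : ℝ) :
    ∀ᶠ s in 𝓝[≠] t, ∀ r : ℝ, 0 < r → v ≠ r • circ s := by
  have hsub : {s ∈ Ioo (t - 1) (t + 1) | ∃ r : ℝ, 0 < r ∧ v = r • circ s}.Subsingleton := by
    rintro s₁ ⟨h₁, r₁, hr₁, e₁⟩ s₂ ⟨h₂, r₂, hr₂, e₂⟩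
    have hpi := Real.pi_gt_three
    have i₁ := angleFrom_smul_circ (m := t) (t := s₁) hr₁ (by linarith [h₁.1]) (by linarith [h₁.2])
    have i₂ := angleFrom_smul_circ (m := t) (t := s₂) hr₂ (by linarith [h₂.1]) (by linarith [h₂.2])
    rw [← i₁, ← i₂, ← e₁, ← e₂]
  filter_upwards [eventually_notMem_of_finite hsub.finite t,
    mem_nhdsWithin_of_mem_nhds (Ioo_mem_nhds (show t - 1 < t by linarith)
      (show t < t + 1 by linarith))] with s hs hs' r hr h
  exact hs ⟨hs', r, hr, h⟩

theorem contDiff_lineFunctional_circ (p : (ℝ × ℝ) × (ℝ × ℝ)) :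
    ContDiff ℝ ∞ fun t ↦ lineFunctional p (circ t) := by
  have h1 : ContDiff ℝ ∞ fun t ↦ (circ t).1 := Real.contDiff_cos
  have h2 : ContDiff ℝ ∞ fun t ↦ (circ t).2 := Real.contDiff_sin
  unfold lineFunctional cross
  exact ((h1.mul contDiff_const).sub (h2.mul contDiff_const)).div_const _

/-- Directions close to `t` and different from it avoid the finite set `s`, so the gauge equals
there one of finitely many functionals in `J`, all bounded by the gauge. It is their maximum, and on
one side of `t` a single one is eventually the largest. -/
theorem polygon_gauge_germ {s : Finset (ℝ × ℝ)}
    (hK : IsCompact (convexHull ℝ (s : Set (ℝ × ℝ))))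
    (h0 : convexHull ℝ (s : Set (ℝ × ℝ)) ∈ 𝓝 0) (t : ℝ) (l : Filter ℝ)
    (hl : l = 𝓝[>] t ∨ l = 𝓝[<] t) :
    ∃ p, (fun t ↦ gauge (convexHull ℝ (s : Set (ℝ × ℝ))) (circ t)) =ᶠ[l]
      fun t ↦ lineFunctional p (circ t) := by
  classical
  set K := convexHull ℝ (s : Set (ℝ × ℝ)) with hKdef
  have hconv : Convex ℝ K := convex_convexHull ℝ _
  have hne : l.NeBot := by rcases hl with rfl | rfl <;> infer_instance
  have hl' : l ≤ 𝓝[≠] t := by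
    rcases hl with rfl | rfl
    · exact nhdsWithin_mono _ fun x hx ↦ ne_of_gt hx
    · exact nhdsWithin_mono _ fun x hx ↦ ne_of_lt hx
  let J := (s ×ˢ s).filter fun p ↦ ∀ y ∈ K, lineFunctional p y ≤ 1
  have hex : ∀ᶠ t' in l, ∃ p ∈ J, gauge K (circ t') = lineFunctional p (circ t') := by
    have : ∀ᶠ t' in 𝓝[≠] t, ∀ v ∈ s, ∀ r : ℝ, 0 < r → v ≠ r • circ t' :=
      (Filter.eventually_all_finset s).2 fun v _ ↦ eventually_ne_smul_circ v t
    filter_upwards [hl' this] with t' ht'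
    obtain ⟨p, hp, hp1, hp2⟩ := exists_lineFunctional_eq_gauge hK h0 (circ_ne_zero t') ht'
    exact ⟨p, Finset.mem_filter.2 ⟨hp, hp1⟩, hp2⟩
  have hJ : J.Nonempty := by
    obtain ⟨t', p, hp, -⟩ := hex.exists
    exact ⟨p, hp⟩
  obtain ⟨p, hp, hmax⟩ := exists_eventually_max (l := l)
    (u := fun p t ↦ lineFunctional p (circ t)) (fun p q ↦ by
      have e : ∀ t', lineFunctional p (circ t') - lineFunctional q (circ t') =
          ((p.2 - p.1).2 / cross p.1 p.2 - (q.2 - q.1).2 / cross q.1 q.2) * Real.cos t' +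
          ((q.2 - q.1).1 / cross q.1 q.2 - (p.2 - p.1).1 / cross p.1 p.2) * Real.sin t' := by
        intro t'
        simp only [lineFunctional, cross, circ]
        ring
      rcases sinusoid_eventually_comparable
        ((p.2 - p.1).2 / cross p.1 p.2 - (q.2 - q.1).2 / cross q.1 q.2)
        ((q.2 - q.1).1 / cross q.1 q.2 - (p.2 - p.1).1 / cross p.1 p.2) t l hl with h | h
      · right
        filter_upwards [h] with t' ht'
        linarith [e t']
      · left
        filter_upwards [h] with t' ht'
        linarith [e t']) J hJ
  refine ⟨p, ?_⟩
  filter_upwards [hex, (Filter.eventually_all_finset J).2 hmax] with t' ⟨q, hq, hq'⟩ hm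
  refine le_antisymm (hq'.trans_le (hm q hq)) ?_
  exact lineFunctional_le_gauge hK hconv h0 (Finset.mem_filter.1 hp).2 (circ_ne_zero t')

theorem isPiecewiseSmooth_gauge_of_polygon {K : Set (ℝ × ℝ)} (hK : IsCompact K)
    (h0 : K ∈ 𝓝 0) (hpoly : IsConvexPolygon K) :
    IsPiecewiseSmooth fun t ↦ gauge K (circ t) := by
  obtain ⟨s, rfl⟩ := hpoly
  have hcont := continuous_gauge_circ (convex_convexHull ℝ (s : Set (ℝ × ℝ))) h0
  intro t
  constructor
  · obtain ⟨p, hp⟩ := polygon_gauge_germ hK h0 t _ (Or.inl rfl)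
    refine ⟨_, contDiff_lineFunctional_circ p, ?_⟩
    have heq := tendsto_nhds_unique_of_eventuallyEq (hcont.continuousAt.mono_left
      nhdsWithin_le_nhds) ((contDiff_lineFunctional_circ p).continuous.continuousAt.mono_left
      nhdsWithin_le_nhds) hp
    rw [← nhdsGT_sup_nhdsWithin_singleton]
    exact Filter.eventually_sup.2 ⟨hp, by rw [nhdsWithin_singleton]; exact heq⟩
  · obtain ⟨p, hp⟩ := polygon_gauge_germ hK h0 t _ (Or.inr rfl)
    refine ⟨_, contDiff_lineFunctional_circ p, ?_⟩
    have heq := tendsto_nhds_unique_of_eventuallyEq (hcont.continuousAt.mono_left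
      nhdsWithin_le_nhds) ((contDiff_lineFunctional_circ p).continuous.continuousAt.mono_left
      nhdsWithin_le_nhds) hp
    rw [← nhdsLT_sup_nhdsWithin_singleton]
    exact Filter.eventually_sup.2 ⟨hp, by rw [nhdsWithin_singleton]; exact heq⟩

/-- A defining function of the boundary of a convex body has nonzero radial derivative. -/
theorem fderiv_self_ne_zero_of_frontier {K : Set (ℝ × ℝ)} (hconv : Convex ℝ K)
    (h0 : K ∈ 𝓝 0) {x : ℝ × ℝ} (hx : x ∈ frontier K) {f : ℝ × ℝ → ℝ} (hf : ContDiff ℝ ∞ f)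
    (hfx : fderiv ℝ f x ≠ 0) (hfr : ∀ᶠ y in 𝓝 x, (y ∈ frontier K ↔ f y = 0)) :
    fderiv ℝ f x x ≠ 0 := by
  -- Otherwise `x` is tangent to the level set of `f`, and the implicit function theorem gives a
  -- boundary curve `γ` with `γ 0 = x` and velocity `x` at `0`. Then `γ h`, of gauge 1, is within
  -- `o(h)` of `(1 + h) x`, of gauge `1 + h`, against the Lipschitz bound.
  intro hker
  have hstrict : HasStrictFDerivAt f (fderiv ℝ f x) x := hf.contDiffAt.hasStrictFDerivAt (by simp)
  have hrange : (fderiv ℝ f x).range = ⊤ := by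
    obtain ⟨v, hv⟩ := DFunLike.ne_iff.1 hfx
    rw [LinearMap.range_eq_top]
    intro c
    refine ⟨(c / fderiv ℝ f x v) • v, ?_⟩
    have hv' : fderiv ℝ f x v ≠ 0 := by simpa using hv
    simp [hv']
  have hfx0 : f x = 0 := hfr.self_of_nhds.1 hx
  let k : (fderiv ℝ f x).ker := ⟨x, hker⟩
  set γ : ℝ → ℝ × ℝ := fun h ↦ hstrict.implicitFunction f (fderiv ℝ f x) hrange (f x) (h • k)
    with hγ
  have hγ0 : γ 0 = x := by
    have := (hstrict.implicitFunction_apply_image hrange)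
    simp only [hγ, zero_smul]
    exact this
  have hγd : HasDerivAt γ x 0 := by
    have h1 : HasFDerivAt (hstrict.implicitFunction f (fderiv ℝ f x) hrange (f x))
        (fderiv ℝ f x).ker.subtypeL ((0 : ℝ) • k) := by
      rw [zero_smul]
      exact (hstrict.to_implicitFunction hrange).hasFDerivAt
    have h2 : HasDerivAt (fun h : ℝ ↦ h • k) ((1 : ℝ) • k) 0 := (hasDerivAt_id (0 : ℝ)).smul_const k
    have h3 := h1.comp_hasDerivAt (0 : ℝ) h2
    rw [one_smul] at h3
    exact h3
  have hγf : ∀ᶠ h in 𝓝 (0 : ℝ), f (γ h) = f x := by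
    have h1 := hstrict.map_implicitFunction_eq hrange
    have h2 : Filter.Tendsto (fun h : ℝ ↦ (f x, h • k)) (𝓝 0) (𝓝 (f x, 0)) := by
      have : Continuous fun h : ℝ ↦ (f x, h • k) := by fun_prop
      simpa using this.tendsto 0
    exact h2.eventually h1
  have hγg : ∀ᶠ h in 𝓝 (0 : ℝ), gauge K (γ h) = 1 := by
    have h2 : Filter.Tendsto γ (𝓝 0) (𝓝 x) := by
      simpa [hγ0] using hγd.continuousAt.tendsto
    filter_upwards [hγf, h2.eventually hfr] with h h3 h4
    rw [gauge_eq_one_iff_mem_frontier hconv h0, h4, h3, hfx0]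
  obtain ⟨C, hC⟩ := hconv.lipschitz_gauge h0
  have hlittle := hγd.isLittleO
  rw [hγ0] at hlittle
  have hlt := hlittle.def (show (0 : ℝ) < 1 / (2 * (C + 1)) by positivity)
  have hgx : gauge K x = 1 := (gauge_eq_one_iff_mem_frontier hconv h0).2 hx
  obtain ⟨h, ⟨h1, h2⟩, hpos⟩ := ((hγg.and hlt).filter_mono nhdsWithin_le_nhds |>.and
    (self_mem_nhdsWithin : ∀ᶠ h in 𝓝[>] (0 : ℝ), h ∈ Ioi 0)).exists
  have hpos' : (0 : ℝ) < h := hpos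
  have h3 := hC.dist_le_mul (γ h) ((1 + h) • x)
  rw [gauge_smul_of_nonneg (by linarith), hgx, h1, Real.dist_eq, dist_eq_norm] at h3
  have e1 : γ h - (1 + h) • x = γ h - x - (h - 0) • x := by rw [add_smul, one_smul, sub_zero]; abel
  rw [e1] at h3
  rw [sub_zero, Real.norm_of_nonneg hpos'.le] at h2
  rw [sub_zero] at h3
  have h4 : |1 - (1 + h) • (1 : ℝ)| = h := by
    rw [smul_eq_mul, mul_one, show (1 : ℝ) - (1 + h) = -h by ring, abs_neg, abs_of_pos hpos']
  rw [h4] at h3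
  have h5 : (C : ℝ) * (1 / (2 * (C + 1)) * h) < h := by
    have : (C : ℝ) * (1 / (2 * (C + 1)) * h) = (C / (2 * (C + 1))) * h := by ring
    rw [this]
    have h6 : (C : ℝ) / (2 * (C + 1)) < 1 := by
      rw [div_lt_one (by positivity)]
      have := C.coe_nonneg
      linarith
    nlinarith
  have h6 : (C : ℝ) * ‖γ h - x - h • x‖ ≤ C * (1 / (2 * (C + 1)) * h) := by gcongr
  linarith

/-- The radial derivative of a defining function is nonzero, so the implicit function theorem solves
for `r` along the ray at angle `t`; by continuity, the radial function is that solution. -/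
theorem contDiff_gauge_of_smooth {K : Set (ℝ × ℝ)} (hK : IsCompact K) (hconv : Convex ℝ K)
    (h0 : K ∈ 𝓝 0) (hsm : HasSmoothBoundary K) : ContDiff ℝ ∞ fun t ↦ gauge K (circ t) := by
  have hG : ∀ t, 0 < gauge K (circ t) := fun t ↦ gauge_pos_of_ne_zero hK h0 (circ_ne_zero t)
  set ρ : ℝ → ℝ := fun t ↦ (gauge K (circ t))⁻¹ with hρ
  have hρpos : ∀ t, 0 < ρ t := fun t ↦ inv_pos.2 (hG t)
  have hρc : Continuous ρ := (continuous_gauge_circ hconv h0).inv₀ fun t ↦ (hG t).ne'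
  have hfront : ∀ t, ρ t • circ t ∈ frontier K := fun t ↦ by
    rw [← gauge_eq_one_iff_mem_frontier hconv h0, gauge_smul_circ (hρpos t).le]
    exact inv_mul_cancel₀ (hG t).ne'
  have hρs : ContDiff ℝ ∞ ρ := by
    rw [contDiff_iff_contDiffAt]
    intro t
    obtain ⟨f, hf, hfx, hfr⟩ := hsm _ (hfront t)
    have hrad := fderiv_self_ne_zero_of_frontier hconv h0 (hfront t) hf hfx hfr
    set P : ℝ × ℝ → ℝ × ℝ := fun p ↦ p.2 • circ p.1 with hP
    have hPs : ContDiff ℝ ∞ P := contDiff_snd.smul (contDiff_circ.comp contDiff_fst)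
    have hΦ : ContDiffAt ℝ ∞ (f ∘ P) (t, ρ t) := (hf.comp hPs).contDiffAt
    have hPd : HasDerivAt (fun r ↦ P (t, r)) (circ t) (ρ t) := by
      simpa using (hasDerivAt_id (ρ t)).smul_const (circ t)
    have hval : fderiv ℝ (f ∘ P) (t, ρ t) (0, 1) = fderiv ℝ f (ρ t • circ t) (circ t) := by
      rw [fderiv_comp _ (hf.differentiable (by simp) _) (hPs.differentiable (by simp) _),
        ContinuousLinearMap.comp_apply,
        fderiv_apply_zero_one (hPs.differentiable (by simp) _) hPd]
    have hne : fderiv ℝ (f ∘ P) (t, ρ t) (0, 1) ≠ 0 := by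
      rw [hval]
      intro h
      apply hrad
      rw [map_smul, h, smul_zero]
    have hinv : (fderiv ℝ (f ∘ P) (t, ρ t) ∘L .inr ℝ ℝ ℝ).IsInvertible := by
      refine ⟨ContinuousLinearEquiv.unitsEquivAut ℝ (Units.mk0 _ hne), ?_⟩
      ext
      simp
    have hiff := hΦ.eventually_apply_eq_iff_implicitFunction (by simp) hinv
    have hsmooth := hΦ.contDiffAt_implicitFunction (by simp) hinv
    refine hsmooth.congr_of_eventuallyEq ?_
    have ht1 : Filter.Tendsto (fun t' ↦ (t', ρ t')) (𝓝 t) (𝓝 (t, ρ t)) :=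
      (continuous_id.prodMk hρc).continuousAt
    have ht2 : Filter.Tendsto (fun t' ↦ ρ t' • circ t') (𝓝 t) (𝓝 (ρ t • circ t)) :=
      (hρc.smul contDiff_circ.continuous).continuousAt
    filter_upwards [ht1.eventually hiff, ht2.eventually hfr] with t' h1 h2
    refine (h1.1 ?_).symm
    have e1 : f (ρ t' • circ t') = 0 := h2.1 (hfront t')
    have e2 : f (ρ t • circ t) = 0 := hfr.self_of_nhds.1 (hfront t)
    show f (ρ t' • circ t') = f (ρ t • circ t)
    rw [e1, e2]
  have : (fun t ↦ gauge K (circ t)) = fun t ↦ (ρ t)⁻¹ := by ext t; simp [hρ]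
  rw [this]
  exact hρs.inv fun t ↦ (hρpos t).ne'

theorem isPiecewiseSmooth_gauge {K : Set (ℝ × ℝ)} (hK : IsCompact K) (hconv : Convex ℝ K)
    (h0 : K ∈ 𝓝 0) (hb : HasSmoothBoundary K ∨ IsConvexPolygon K) :
    IsPiecewiseSmooth fun t ↦ gauge K (circ t) := by
  rcases hb with hb | hb
  · have := contDiff_gauge_of_smooth hK hconv h0 hb
    exact fun t ↦ ⟨⟨_, this, Filter.EventuallyEq.rfl⟩, _, this, Filter.EventuallyEq.rfl⟩
  · exact isPiecewiseSmooth_gauge_of_polygon hK h0 hb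

/-! ### Almost area-preserving maps between convex bodies and the disc -/

/-- The radial function of a planar convex body. -/
noncomputable def radial (K : Set (ℝ × ℝ)) (t : ℝ) : ℝ := (gauge K (circ t))⁻¹

theorem radial_add_two_pi (K : Set (ℝ × ℝ)) (t : ℝ) :
    radial K (t + 2 * Real.pi) = radial K t := by
  rw [radial, circ_add_two_pi, radial]

theorem radial_pos {K : Set (ℝ × ℝ)} (hK : IsCompact K) (h0 : K ∈ 𝓝 0) (t : ℝ) :
    0 < radial K t := inv_pos.2 (gauge_pos_of_ne_zero hK h0 (circ_ne_zero t))

theorem continuous_radial {K : Set (ℝ × ℝ)} (hK : IsCompact K) (hconv : Convex ℝ K)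
    (h0 : K ∈ 𝓝 0) : Continuous (radial K) :=
  (continuous_gauge_circ hconv h0).inv₀ fun t ↦
    (gauge_pos_of_ne_zero hK h0 (circ_ne_zero t)).ne'

theorem smul_circ_mem_iff {K : Set (ℝ × ℝ)} (hK : IsCompact K) (hconv : Convex ℝ K)
    (h0 : K ∈ 𝓝 0) {r : ℝ} (hr : 0 ≤ r) (t : ℝ) : r • circ t ∈ K ↔ r ≤ radial K t := by
  rw [mem_iff_gauge_le_one hK hconv h0, gauge_smul_circ hr, radial, ← one_div,
    le_div_iff₀ (gauge_pos_of_ne_zero hK h0 (circ_ne_zero t))]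

theorem smul_circ_mem_frontier_iff {K : Set (ℝ × ℝ)} (hK : IsCompact K) (hconv : Convex ℝ K)
    (h0 : K ∈ 𝓝 0) {r : ℝ} (hr : 0 ≤ r) (t : ℝ) : r • circ t ∈ frontier K ↔ r = radial K t := by
  rw [← gauge_eq_one_iff_mem_frontier hconv h0, gauge_smul_circ hr, radial,
    ← one_div, eq_div_iff (gauge_pos_of_ne_zero hK h0 (circ_ne_zero t)).ne']

/-- The constants `m`, `R`, `C`, `L` precede `lam` and `δ`, so derivative bounds survive a later
choice of small `δ`. A displacement of at most `(1 - lam) m / C` changes the radial function by a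
proportion of at most `1 - lam`. -/
theorem exists_radial_approximation {K : Set (ℝ × ℝ)} (hK : IsCompact K) (hconv : Convex ℝ K)
    (h0 : K ∈ 𝓝 0) (hb : HasSmoothBoundary K ∨ IsConvexPolygon K) :
    ∃ m R C L : ℝ, 0 < m ∧ 0 < R ∧ 0 < C ∧ 1 ≤ L ∧ (∀ t, m ≤ radial K t ∧ radial K t ≤ R) ∧
      (∀ s t, |radial K s - radial K t| ≤ C * |s - t|) ∧
      ∀ lam < 1, ∀ δ > 0, ∃ q, IsNearIdentity L δ q ∧
        ContDiff ℝ ∞ (fun t ↦ radial K (q t)) ∧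
        ∀ t, lam * radial K (q t) ≤ radial K t ∧ lam * radial K t ≤ radial K (q t) := by
  have hG : ∀ t, 0 < gauge K (circ t) := fun t ↦ gauge_pos_of_ne_zero hK h0 (circ_ne_zero t)
  obtain ⟨m, R, hm, hmR⟩ := exists_bounds_of_periodic (continuous_radial hK hconv h0)
    (radial_pos hK h0) (radial_add_two_pi K)
  obtain ⟨C₀, hC₀, hlip⟩ := exists_gauge_circ_lipschitz hconv h0
  obtain ⟨L, hL1, hL⟩ := (isPiecewiseSmooth_gauge hK hconv h0 hb).exists_reparametrization
    fun t ↦ by simp only [circ_add_two_pi]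
  have hR : 0 < R := hm.trans_le ((hmR 0).1.trans (hmR 0).2)
  have hlipρ : ∀ s t, |radial K s - radial K t| ≤ (R * R * C₀) * |s - t| := by
    intro s t
    have e : radial K s - radial K t =
        radial K s * radial K t * (gauge K (circ t) - gauge K (circ s)) := by
      rw [radial, radial]
      have h1 := (hG s).ne'
      have h2 := (hG t).ne'
      field_simp
    have hs := radial_pos hK h0 s
    have ht := radial_pos hK h0 t
    rw [e, abs_mul, abs_of_pos (by positivity)]
    calc _ ≤ (R * R) * (C₀ * |t - s|) := by
          gcongr
          · exact (hmR s).2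
          · exact (hmR t).2
          · exact hlip t s
      _ = _ := by rw [abs_sub_comm]; ring
  refine ⟨m, R, R * R * C₀, L, hm, hR, by positivity, hL1, hmR, hlipρ, fun lam hlam δ hδ ↦ ?_⟩
  set C := R * R * C₀ with hC
  have hC0 : 0 < C := by positivity
  obtain ⟨q, hq, hqs⟩ := hL (min δ ((1 - lam) * m / C))
    (lt_min hδ (by have := sub_pos.2 hlam; positivity))
  refine ⟨q, ⟨hq.contDiff, hq.monotone, hq.add_two_pi, fun t ↦ (hq.abs_sub_le t).trans
    (min_le_left _ _), hq.abs_deriv_le⟩, hqs.inv fun t ↦ (hG _).ne', fun t ↦ ?_⟩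
  have h1 : |radial K (q t) - radial K t| ≤ (1 - lam) * m := by
    calc _ ≤ C * |q t - t| := hlipρ _ _
      _ ≤ C * ((1 - lam) * m / C) := by
        gcongr; exact (hq.abs_sub_le t).trans (min_le_right _ _)
      _ = _ := by field_simp
  rw [abs_le] at h1
  have h2 : (1 - lam) * m ≤ (1 - lam) * radial K t :=
    mul_le_mul_of_nonneg_left (hmR t).1 (sub_pos.2 hlam).le
  have h3 : (1 - lam) * m ≤ (1 - lam) * radial K (q t) :=
    mul_le_mul_of_nonneg_left (hmR (q t)).1 (sub_pos.2 hlam).le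
  constructor <;> nlinarith

/-- The disc map is built for the smooth curve `lam * radial K (q t)` inside `K`; everything from
this curve outwards, including the boundary of `K`, goes to the circle. The curve satisfies `∫ ρ² ≥
2 lam⁴`, which costs the additional factor `(1 + ε) ^ 4`. -/
theorem exists_map_body_to_disc {K : Set (ℝ × ℝ)} (hK : IsCompact K) (hconv : Convex ℝ K)
    (h0 : K ∈ 𝓝 0) (hvol : volume K = 1) (hb : HasSmoothBoundary K ∨ IsConvexPolygon K)
    {ε : ℝ} (hε : 0 < ε) :
    ∃ (φ : ℝ → ℝ) (T : ℝ × ℝ → ℝ × ℝ), StrictMono φ ∧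
      (∀ t, φ (t + 2 * Real.pi) = φ t + 2 * Real.pi) ∧ ContDiff ℝ ∞ T ∧
      (∀ x, rad (T x) ≤ 1) ∧ (∀ x, |jac T x| ≤ (1 + ε) ^ 5 * Real.pi) ∧
      ∀ t, T (radial K t • circ t) = circ (φ t) := by
  obtain ⟨m, R, C, L, hm, hR, hC, hL, hmR, hlip, happ⟩ := exists_radial_approximation hK hconv h0 hb
  set lam : ℝ := (1 + ε)⁻¹ with hlam
  have hlam0 : 0 < lam := by positivity
  obtain ⟨q, hq, hqs, hql⟩ := happ lam (inv_lt_one_of_one_lt₀ (by linarith)) 1 one_pos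
  set ρ : ℝ → ℝ := fun t ↦ lam * radial K (q t) with hρ
  have hρs : ContDiff ℝ ∞ ρ := contDiff_const.mul hqs
  have hρpos : ∀ t, 0 < ρ t := fun t ↦ mul_pos hlam0 (radial_pos hK h0 _)
  have hρper : ∀ t, ρ (t + 2 * Real.pi) = ρ t := fun t ↦ by
    simp only [hρ, hq.add_two_pi, radial_add_two_pi]
  have harea : ∫ t in (0 : ℝ)..(2 * Real.pi), radial K t ^ 2 = 2 :=
    integral_inv_gauge_sq hK hconv h0 hvol
  have hint : lam ^ 4 * 2 ≤ ∫ t in (0 : ℝ)..(2 * Real.pi), ρ t ^ 2 := by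
    have h3 : lam ^ 4 * 2 = ∫ t in (0 : ℝ)..(2 * Real.pi), lam ^ 4 * radial K t ^ 2 := by
      rw [intervalIntegral.integral_const_mul, harea]
    rw [h3]
    apply intervalIntegral.integral_mono_on Real.two_pi_pos.le
    · exact (continuous_const.mul ((continuous_radial hK hconv h0).pow 2)).intervalIntegrable _ _
    · exact (hρs.continuous.pow 2).intervalIntegrable _ _
    · intro t _
      have h1 : lam * (lam * radial K t) ≤ ρ t := by
        simp only [hρ]; gcongr; exact (hql t).2
      have h2 := radial_pos hK h0 t
      calc lam ^ 4 * radial K t ^ 2 = (lam * (lam * radial K t)) ^ 2 := by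
            ring
        _ ≤ ρ t ^ 2 := by gcongr
  set I := ∫ t in (0 : ℝ)..(2 * Real.pi), ρ t ^ 2 with hI
  have hI0 : 0 < I := lt_of_lt_of_le (by positivity) hint
  obtain ⟨φ, T, hφ, hφe, hT, hTr, hTj, hTb⟩ := exists_map_to_disc hρs hρpos hρper hε
    (c := 2 * Real.pi / I) (by rw [← hI]; field_simp)
  refine ⟨φ, T, hφ, hφe, hT, hTr, fun x ↦ (hTj x).trans ?_, fun t ↦ hTb _ t (hql t).1⟩
  have hpi := Real.pi_pos
  calc (1 + ε) * (2 * Real.pi / I) ≤ (1 + ε) * (2 * Real.pi / (lam ^ 4 * 2)) := by gcongr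
    _ = (1 + ε) ^ 5 * Real.pi := by rw [hlam]; field_simp

theorem abs_cross_le (u v : ℝ × ℝ) : |cross u v| ≤ 2 * ‖u‖ * ‖v‖ := by
  have h1 := norm_fst_le u
  have h2 := norm_snd_le u
  have h3 := norm_fst_le v
  have h4 := norm_snd_le v
  rw [Real.norm_eq_abs] at h1 h2 h3 h4
  calc |cross u v| ≤ |u.1 * v.2| + |u.2 * v.1| := abs_sub _ _
    _ = |u.1| * |v.2| + |u.2| * |v.1| := by rw [abs_mul, abs_mul]
    _ ≤ ‖u‖ * ‖v‖ + ‖u‖ * ‖v‖ := by gcongr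
    _ = _ := by ring

theorem norm_circ_le (t : ℝ) : ‖circ t‖ ≤ 1 := by
  rw [circ, Prod.norm_mk, max_le_iff]
  exact ⟨Real.abs_cos_le_one t, Real.abs_sin_le_one t⟩

theorem norm_smul_circ_sub_le (a b s t : ℝ) :
    ‖a • circ s - b • circ t‖ ≤ |a - b| + |a| * |s - t| := by
  have e : a • circ s - b • circ t = (a - b) • circ t + a • (circ s - circ t) := by module
  rw [e]
  refine (norm_add_le _ _).trans ?_
  rw [norm_smul, norm_smul, Real.norm_eq_abs, Real.norm_eq_abs]
  gcongr
  · exact mul_le_of_le_one_right (abs_nonneg _) (norm_circ_le t)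
  · exact norm_circ_sub_circ_le s t

theorem norm_deriv_le_of_forall_norm_sub_le {f : ℝ → ℝ × ℝ} {B : ℝ} (hB : 0 ≤ B)
    (h : ∀ s t, ‖f s - f t‖ ≤ B * |s - t|) (t : ℝ) : ‖deriv f t‖ ≤ B :=
  norm_deriv_le_of_lip' hB (Filter.Eventually.of_forall fun s ↦ h s t)

theorem IsNearIdentity.abs_sub_le_mul {L δ : ℝ} {q : ℝ → ℝ} (hq : IsNearIdentity L δ q)
    (s t : ℝ) : |q s - q t| ≤ L * |s - t| :=
  Convex.norm_image_sub_le_of_norm_deriv_le (s := univ)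
    (fun x _ ↦ hq.contDiff.differentiable (by simp) x) (fun x _ ↦ hq.abs_deriv_le x) convex_univ
    (mem_univ t) (mem_univ s)

/-- The disc fills a smooth curve in `K` and is joined in a thin layer to `β`, which traces the
boundary of `K` smoothly through `q`, corners included. Convexity keeps the layer in `K`. The
boundary map `ψ = q ∘ Q` is only weakly monotone, as `q` is. -/
theorem exists_map_disc_to_body {K : Set (ℝ × ℝ)} (hK : IsCompact K) (hconv : Convex ℝ K)
    (h0 : K ∈ 𝓝 0) (hvol : volume K = 1) (hb : HasSmoothBoundary K ∨ IsConvexPolygon K)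
    {ε : ℝ} (hε : 0 < ε) :
    ∃ (ψ : ℝ → ℝ) (T : ℝ × ℝ → ℝ × ℝ), Monotone ψ ∧ Continuous ψ ∧
      (∀ t, ψ (t + 2 * Real.pi) = ψ t + 2 * Real.pi) ∧ ContDiff ℝ ∞ T ∧
      (∀ x, T x ∈ K) ∧ (∀ x, |jac T x| ≤ (1 + ε) / Real.pi) ∧
      ∀ t, T (circ t) = radial K (ψ t) • circ (ψ t) := by
  obtain ⟨m, R, C, L, hm, hR, hC, hL, hmR, hlip, happ⟩ := exists_radial_approximation hK hconv h0 hb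
  obtain ⟨η, hη, hmap⟩ := exists_map_from_disc hε
  have hpi := Real.pi_pos
  set B : ℝ := (C + R) * L with hB
  have hB0 : 0 < B := by positivity
  -- The curves differ by at most `2Rδ`, and their derivatives are bounded by `B` independently of
  -- `δ`. The cross products are then at most `4BRδ ≤ η (m / 2)²`, and `δ ≤ 1 / 2` gives `ρ ≥ m /
  -- 2`.
  set δ : ℝ := min (1 / 2) (η * m ^ 2 / (16 * B * R)) with hδ
  have hδ0 : 0 < δ := by positivity
  have hδ2 : δ ≤ 1 / 2 := min_le_left _ _
  have hδη : 4 * B * R * δ ≤ η * (m / 2) ^ 2 := by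
    have : δ ≤ η * m ^ 2 / (16 * B * R) := min_le_right _ _
    rw [le_div_iff₀ (by positivity)] at this
    nlinarith
  set lam : ℝ := 1 - δ with hlam
  obtain ⟨q, hq, hqs, hql⟩ := happ lam (by linarith) δ hδ0
  set ρ : ℝ → ℝ := fun t ↦ lam * radial K (q t) with hρ
  have hlam0 : 0 < lam := by linarith
  have hρs : ContDiff ℝ ∞ ρ := contDiff_const.mul hqs
  have hρpos : ∀ t, 0 < ρ t := fun t ↦ mul_pos hlam0 (radial_pos hK h0 _)
  have hρper : ∀ t, ρ (t + 2 * Real.pi) = ρ t := fun t ↦ by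
    simp only [hρ, hq.add_two_pi, radial_add_two_pi]
  have hρm : ∀ t, m / 2 ≤ ρ t := fun t ↦ by
    have := (hmR (q t)).1
    simp only [hρ]
    nlinarith
  have hρR : ∀ t, ρ t ≤ R := fun t ↦ (hql t).1.trans (hmR t).2
  set β : ℝ → ℝ × ℝ := fun t ↦ radial K (q t) • circ (q t) with hβ
  have hβs : ContDiff ℝ ∞ β := hqs.smul (contDiff_circ.comp hq.contDiff)
  have hβper : ∀ t, β (t + 2 * Real.pi) = β t := fun t ↦ by
    simp only [hβ, hq.add_two_pi, radial_add_two_pi, circ_add_two_pi]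
  have hqlip := hq.abs_sub_le_mul
  have hρlip : ∀ s t, |ρ s - ρ t| ≤ C * L * |s - t| := by
    intro s t
    have e : ρ s - ρ t = lam * (radial K (q s) - radial K (q t)) := by simp only [hρ]; ring
    rw [e, abs_mul, abs_of_pos hlam0]
    calc _ ≤ 1 * (C * (L * |s - t|)) := by
          gcongr
          · linarith
          · exact (hlip _ _).trans (by gcongr; exact hqlip s t)
      _ = _ := by ring
  have hα' : ∀ t, ‖deriv (fun t ↦ ρ t • circ t) t‖ ≤ B := by
    refine norm_deriv_le_of_forall_norm_sub_le hB0.le fun s t ↦ ?_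
    refine (norm_smul_circ_sub_le _ _ _ _).trans ?_
    rw [abs_of_pos (hρpos s)]
    calc _ ≤ C * L * |s - t| + R * L * |s - t| := by
          gcongr
          · exact hρlip s t
          · exact (hρR s).trans (le_mul_of_one_le_right hR.le hL)
      _ = _ := by rw [hB]; ring
  have hβ' : ∀ t, ‖deriv β t‖ ≤ B := by
    refine norm_deriv_le_of_forall_norm_sub_le hB0.le fun s t ↦ ?_
    refine (norm_smul_circ_sub_le _ _ _ _).trans ?_
    rw [abs_of_pos (radial_pos hK h0 _)]
    calc _ ≤ C * (L * |s - t|) + R * (L * |s - t|) := by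
          gcongr
          · exact (hlip _ _).trans (by gcongr; exact hqlip s t)
          · exact (hmR _).2
          · exact hqlip s t
      _ = _ := by rw [hB]; ring
  have hdiff : ∀ t, ‖β t - ρ t • circ t‖ ≤ 2 * R * δ := by
    intro t
    refine (norm_smul_circ_sub_le _ _ _ _).trans ?_
    have e : radial K (q t) - ρ t = δ * radial K (q t) := by simp only [hρ, hlam]; ring
    have hp := radial_pos hK h0 (q t)
    rw [e, abs_of_pos (by positivity), abs_of_pos hp]
    calc _ ≤ δ * R + R * δ := by
          gcongr
          · exact (hmR _).2
          · exact (hmR _).2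
          · exact hq.abs_sub_le t
      _ = _ := by ring
  have hcross : ∀ t v, ‖v‖ ≤ B → |cross (β t - ρ t • circ t) v| ≤ η * ρ t ^ 2 := by
    intro t v hv
    calc _ ≤ 2 * ‖β t - ρ t • circ t‖ * ‖v‖ := abs_cross_le _ _
      _ ≤ 2 * (2 * R * δ) * B := by gcongr; exact hdiff t
      _ = 4 * B * R * δ := by ring
      _ ≤ η * (m / 2) ^ 2 := hδη
      _ ≤ _ := by gcongr; exact hρm t
  have harea : ∫ t in (0 : ℝ)..(2 * Real.pi), radial K t ^ 2 = 2 :=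
    integral_inv_gauge_sq hK hconv h0 hvol
  have hint : ∫ t in (0 : ℝ)..(2 * Real.pi), ρ t ^ 2 ≤ 2 := by
    refine le_trans ?_ harea.le
    apply intervalIntegral.integral_mono_on Real.two_pi_pos.le
    · exact (hρs.continuous.pow 2).intervalIntegrable _ _
    · exact ((continuous_radial hK hconv h0).pow 2).intervalIntegrable _ _
    · intro t _
      have := hρpos t
      gcongr
      exact (hql t).1
  set I := ∫ t in (0 : ℝ)..(2 * Real.pi), ρ t ^ 2 with hI
  have hI0 : 0 < I := intervalIntegral.intervalIntegral_pos_of_pos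
    ((hρs.continuous.pow 2).intervalIntegrable _ _) (fun t ↦ by have := hρpos t; positivity)
    Real.two_pi_pos
  obtain ⟨Q, T, hQm, hQc, hQe, hT, hTj, hTb, hTm⟩ := hmap ρ β (2 * Real.pi / I) hρs hρpos hρper
    (by rw [← hI]; field_simp) hβs hβper (fun t ↦ hcross t _ (hα' t))
    (fun t ↦ hcross t _ (hβ' t))
  refine ⟨q ∘ Q, T, hq.monotone.comp hQm.monotone, hq.contDiff.continuous.comp hQc, fun t ↦ ?_, hT,
    fun x ↦ ?_, fun x ↦ (hTj x).trans ?_, hTb⟩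
  · simp only [Function.comp_apply, hQe, hq.add_two_pi]
  · obtain ⟨t, μ, hμ, s, hs, hx⟩ := hTm x
    rw [hx]
    have h1 : ρ t • circ t ∈ K := (smul_circ_mem_iff hK hconv h0 (hρpos t).le t).2 (hql t).1
    have h2 : β t ∈ K := (smul_circ_mem_iff hK hconv h0 (radial_pos hK h0 _).le _).2 le_rfl
    exact hconv.smul_mem_of_zero_mem (mem_of_mem_nhds h0)
      (hconv h1 h2 (sub_nonneg.2 hs.2) hs.1 (by ring)) hμ
  · calc (1 + ε) / (2 * Real.pi / I) = (1 + ε) / Real.pi * (I / 2) := by field_simp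
      _ ≤ (1 + ε) / Real.pi * 1 := by gcongr; linarith
      _ = _ := mul_one _

/-! ### Marked domains -/

namespace MarkedDomain

variable {N : ℕ} (D : MarkedDomain N)

/-- The domain translated so that its centre is the origin. -/
def centered : Set (ℝ × ℝ) := (fun x ↦ x + D.center) ⁻¹' D.carrier

theorem mem_centered {x : ℝ × ℝ} : x ∈ D.centered ↔ x + D.center ∈ D.carrier := Iff.rfl

theorem centered_eq_image : D.centered = (fun x ↦ x - D.center) '' D.carrier := by
  ext x
  rw [mem_centered]
  constructor
  · exact fun h ↦ ⟨_, h, by simp⟩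
  · rintro ⟨y, hy, rfl⟩
    simpa using hy

theorem isCompact_centered : IsCompact D.centered := by
  rw [centered_eq_image]
  exact D.isCompact.image (by fun_prop)

theorem convex_centered : Convex ℝ D.centered := by
  have := D.convex.translate_preimage_left D.center
  simpa [centered] using this

theorem centered_mem_nhds : D.centered ∈ 𝓝 0 := by
  have h : Filter.Tendsto (fun x ↦ x + D.center) (𝓝 0) (𝓝 D.center) := by
    have : Continuous fun x ↦ x + D.center := by fun_prop
    simpa using this.tendsto 0
  exact h (mem_interior_iff_mem_nhds.1 D.center_mem)

theorem volume_centered : volume D.centered = 1 := by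
  rw [centered, measure_preimage_add_right, D.area]

theorem mem_frontier_centered {x : ℝ × ℝ} :
    x ∈ frontier D.centered ↔ x + D.center ∈ frontier D.carrier := by
  have := (Homeomorph.addRight D.center).preimage_frontier D.carrier
  exact (Set.ext_iff.1 this x).symm

theorem boundary_centered : HasSmoothBoundary D.centered ∨ IsConvexPolygon D.centered := by
  rcases D.boundary with h | ⟨s, hs⟩
  · left
    intro x hx
    obtain ⟨f, hf, hfx, hfr⟩ := h _ (D.mem_frontier_centered.1 hx)
    refine ⟨fun y ↦ f (y + D.center), hf.comp (by fun_prop), ?_, ?_⟩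
    · rwa [fderiv_comp_add_right]
    · have ht : Filter.Tendsto (fun y ↦ y + D.center) (𝓝 x) (𝓝 (x + D.center)) :=
        (by fun_prop : Continuous fun y ↦ y + D.center).continuousAt
      filter_upwards [ht.eventually hfr] with y hy
      rw [D.mem_frontier_centered, hy]
  · right
    classical
    refine ⟨s.image fun x ↦ x - D.center, ?_⟩
    rw [centered_eq_image, hs, Finset.coe_image]
    have h2 := (((AffineEquiv.vaddConst ℝ D.center).symm : ℝ × ℝ ≃ᵃ[ℝ] ℝ × ℝ) :
      ℝ × ℝ →ᵃ[ℝ] ℝ × ℝ).image_convexHull (s : Set (ℝ × ℝ))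
    exact h2

theorem exists_radial_of_mem_frontier {x : ℝ × ℝ} {t : ℝ} (hx : x ∈ frontier D.carrier)
    (hxt : x ∈ planeRay D.center t) : x - D.center = radial D.centered t • circ t := by
  obtain ⟨r, hr, rfl⟩ := hxt
  rw [add_sub_cancel_left]
  have h : r • circ t ∈ frontier D.centered := by
    rw [mem_frontier_centered, add_comm]; exact hx
  rw [(smul_circ_mem_frontier_iff D.isCompact_centered D.convex_centered D.centered_mem_nhds
    hr.le t).1 h]
  rfl

theorem exists_map_to_disc {ε : ℝ} (hε : 0 < ε) :
    ∃ (φ : ℝ → ℝ) (T : ℝ × ℝ → ℝ × ℝ), StrictMono φ ∧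
      (∀ t, φ (t + 2 * Real.pi) = φ t + 2 * Real.pi) ∧ ContDiff ℝ ∞ T ∧
      (∀ x, rad (T x) ≤ 1) ∧ (∀ x, |jac T x| ≤ (1 + ε) ^ 5 * Real.pi) ∧
      ∀ x ∈ frontier D.carrier, ∀ t, x ∈ planeRay D.center t → T x = circ (φ t) := by
  obtain ⟨φ, T, hφ, hφe, hT, hTr, hTj, hTb⟩ := exists_map_body_to_disc D.isCompact_centered
    D.convex_centered D.centered_mem_nhds D.volume_centered D.boundary_centered hε
  refine ⟨φ, fun x ↦ T (x - D.center), hφ, hφe, hT.comp (by fun_prop), fun x ↦ hTr _,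
    fun x ↦ ?_, fun x hx t hxt ↦ ?_⟩
  · rw [jac, fderiv_comp_sub]
    exact hTj _
  · simp only
    rw [D.exists_radial_of_mem_frontier hx hxt, hTb]

theorem exists_map_from_disc {ε : ℝ} (hε : 0 < ε) :
    ∃ (ψ : ℝ → ℝ) (T : ℝ × ℝ → ℝ × ℝ), Monotone ψ ∧ Continuous ψ ∧
      (∀ t, ψ (t + 2 * Real.pi) = ψ t + 2 * Real.pi) ∧ ContDiff ℝ ∞ T ∧
      (∀ x, T x ∈ D.carrier) ∧ (∀ x, |jac T x| ≤ (1 + ε) / Real.pi) ∧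
      ∀ t, T (circ t) ∈ frontier D.carrier ∧ T (circ t) ∈ planeRay D.center (ψ t) := by
  obtain ⟨ψ, T, hψ, hψc, hψe, hT, hTm, hTj, hTb⟩ := exists_map_disc_to_body D.isCompact_centered
    D.convex_centered D.centered_mem_nhds D.volume_centered D.boundary_centered hε
  refine ⟨ψ, fun x ↦ T x + D.center, hψ, hψc, hψe, hT.add contDiff_const, hTm, fun x ↦ ?_,
    fun t ↦ ⟨?_, ?_⟩⟩
  · rw [jac, fderiv_add_const]
    exact hTj _
  · simp only
    rw [← mem_frontier_centered, hTb, smul_circ_mem_frontier_iff D.isCompact_centered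
      D.convex_centered D.centered_mem_nhds
      (radial_pos D.isCompact_centered D.centered_mem_nhds _).le]
  · refine ⟨_, radial_pos D.isCompact_centered D.centered_mem_nhds (ψ t), ?_⟩
    simp only
    rw [hTb, add_comm]
    rfl

end MarkedDomain

/-! ### The Poisson bracket of the components of a planar map -/

theorem mvfderiv_comp_plane {E : Type*} [NormedAddCommGroup E] [NormedSpace ℝ E]
    {M : Type*} [TopologicalSpace M] [ChartedSpace E M] {Φ : M → ℝ × ℝ} {x : M}
    (hΦ : MDifferentiableAt 𝓘(ℝ, E) 𝓘(ℝ, ℝ × ℝ) Φ x) {l : ℝ × ℝ → ℝ}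
    (hl : DifferentiableAt ℝ l (Φ x)) :
    mvfderiv 𝓘(ℝ, E) (fun y ↦ l (Φ y)) x =
      fderiv ℝ l (Φ x) (1, 0) • mvfderiv 𝓘(ℝ, E) (fun y ↦ (Φ y).1) x +
      fderiv ℝ l (Φ x) (0, 1) • mvfderiv 𝓘(ℝ, E) (fun y ↦ (Φ y).2) x := by
  have key : ∀ {l : ℝ × ℝ → ℝ}, DifferentiableAt ℝ l (Φ x) → ∀ v : TangentSpace 𝓘(ℝ, E) x,
      mvfderiv 𝓘(ℝ, E) (fun y ↦ l (Φ y)) x v =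
        fderiv ℝ l (Φ x) (mfderiv 𝓘(ℝ, E) 𝓘(ℝ, ℝ × ℝ) Φ x v : ℝ × ℝ) := by
    intro l hl v
    have h := mfderiv_comp_apply x hl.mdifferentiableAt hΦ v
    rw [mfderiv_eq_fderiv] at h
    exact h
  ext v
  have h1 := key differentiableAt_fst v
  have h2 := key differentiableAt_snd v
  rw [fderiv_fst] at h1
  rw [fderiv_snd] at h2
  rw [key hl, add_apply, smul_apply,
    smul_apply, h1, h2]
  set w : ℝ × ℝ := mfderiv 𝓘(ℝ, E) 𝓘(ℝ, ℝ × ℝ) Φ x v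
  have h3 : w = w.1 • ((1, 0) : ℝ × ℝ) + w.2 • ((0, 1) : ℝ × ℝ) := by ext <;> simp
  conv_lhs => rw [h3]
  rw [map_add, map_smul, map_smul]
  simp [mul_comm]

namespace SymplecticForm

variable {E : Type*} [NormedAddCommGroup E] [NormedSpace ℝ E]
  {M : Type*} [TopologicalSpace M] [ChartedSpace E M] [IsManifold 𝓘(ℝ, E) ∞ M]

theorem form_swap (σ : SymplecticForm E M) (x : M) (v w : TangentSpace 𝓘(ℝ, E) x) :
    σ.form x v w = -σ.form x w v := by
  have h := σ.alternating x (v + w)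
  simp only [map_add, add_apply, σ.alternating] at h
  linarith

variable [FiniteDimensional ℝ E]

theorem poissonBracket_eq_form (σ : SymplecticForm E M) (F G : M → ℝ) (x : M) :
    σ.poissonBracket F G x = σ.form x (σ.hamiltonianVector G x) (σ.hamiltonianVector F x) := by
  rw [poissonBracket, form_hamiltonianVector]

theorem hamiltonianVector_eq (σ : SymplecticForm E M) {F : M → ℝ} {x : M}
    {v : TangentSpace 𝓘(ℝ, E) x} (h : σ.form x v = mvfderiv 𝓘(ℝ, E) F x) :
    σ.hamiltonianVector F x = v := by
  rw [← sub_eq_zero]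
  apply σ.nondegenerate
  intro w
  rw [map_sub, form_hamiltonianVector, h, sub_self]
  rfl

/-- The bracket is bilinear and alternating in the differentials, so a linear substitution
contributes its determinant. -/
theorem poissonBracket_of_mvfderiv_eq (σ : SymplecticForm E M) {F G F₁ F₂ : M → ℝ} {x : M}
    {a b c d : ℝ}
    (hF : mvfderiv 𝓘(ℝ, E) F x = a • mvfderiv 𝓘(ℝ, E) F₁ x + b • mvfderiv 𝓘(ℝ, E) F₂ x)
    (hG : mvfderiv 𝓘(ℝ, E) G x = c • mvfderiv 𝓘(ℝ, E) F₁ x + d • mvfderiv 𝓘(ℝ, E) F₂ x) :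
    σ.poissonBracket F G x = (a * d - b * c) * σ.poissonBracket F₁ F₂ x := by
  have h1 : σ.hamiltonianVector F x =
      a • σ.hamiltonianVector F₁ x + b • σ.hamiltonianVector F₂ x := by
    apply hamiltonianVector_eq
    rw [map_add, map_smul, map_smul, form_hamiltonianVector, form_hamiltonianVector, hF]
  have h2 : σ.hamiltonianVector G x =
      c • σ.hamiltonianVector F₁ x + d • σ.hamiltonianVector F₂ x := by
    apply hamiltonianVector_eq
    rw [map_add, map_smul, map_smul, form_hamiltonianVector, form_hamiltonianVector, hG]
  rw [poissonBracket_eq_form, poissonBracket_eq_form, h1, h2]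
  simp only [map_add, map_smul, add_apply, smul_apply,
    smul_eq_mul, σ.alternating]
  rw [σ.form_swap x (σ.hamiltonianVector F₁ x)]
  ring

theorem poissonBracket_comp (σ : SymplecticForm E M) {Φ : M → ℝ × ℝ} {x : M}
    (hΦ : MDifferentiableAt 𝓘(ℝ, E) 𝓘(ℝ, ℝ × ℝ) Φ x) {T : ℝ × ℝ → ℝ × ℝ}
    (hT : DifferentiableAt ℝ T (Φ x)) :
    σ.poissonBracket (fun y ↦ (T (Φ y)).1) (fun y ↦ (T (Φ y)).2) x =
      jac T (Φ x) * σ.poissonBracket (fun y ↦ (Φ y).1) (fun y ↦ (Φ y).2) x := by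
  rw [σ.poissonBracket_of_mvfderiv_eq (mvfderiv_comp_plane hΦ hT.fst)
    (mvfderiv_comp_plane hΦ hT.snd), jac, cross, hT.hasFDerivAt.fst.fderiv,
    hT.hasFDerivAt.snd.fderiv]
  simp only [ContinuousLinearMap.comp_apply, ContinuousLinearMap.coe_fst',
    ContinuousLinearMap.coe_snd']
  ring

theorem poissonBracket_congr (σ : SymplecticForm E M) {Φ Ψ : M → ℝ × ℝ} {x : M}
    (h : Φ =ᶠ[𝓝 x] Ψ) : σ.poissonBracket (fun y ↦ (Φ y).1) (fun y ↦ (Φ y).2) x =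
      σ.poissonBracket (fun y ↦ (Ψ y).1) (fun y ↦ (Ψ y).2) x := by
  have h1 : mvfderiv 𝓘(ℝ, E) (fun y ↦ (Φ y).1) x = mvfderiv 𝓘(ℝ, E) (fun y ↦ (Ψ y).1) x := by
    have e : (fun y ↦ (Φ y).1) =ᶠ[𝓝 x] fun y ↦ (Ψ y).1 := h.mono fun y hy ↦ by simp only [hy]
    exact e.mfderiv_eq
  have h2 : mvfderiv 𝓘(ℝ, E) (fun y ↦ (Φ y).2) x = mvfderiv 𝓘(ℝ, E) (fun y ↦ (Ψ y).2) x := by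
    have e : (fun y ↦ (Φ y).2) =ᶠ[𝓝 x] fun y ↦ (Ψ y).2 := h.mono fun y hy ↦ by simp only [hy]
    exact e.mfderiv_eq
  have := σ.poissonBracket_of_mvfderiv_eq (F := fun y ↦ (Φ y).1) (G := fun y ↦ (Φ y).2)
    (F₁ := fun y ↦ (Ψ y).1) (F₂ := fun y ↦ (Ψ y).2) (x := x) (a := 1) (b := 0) (c := 0) (d := 1)
    (by rw [h1]; simp) (by rw [h2]; simp)
  simpa using this

/-- The components of a map into the unit circle Poisson commute. -/
theorem poissonBracket_eq_zero_of_circle (σ : SymplecticForm E M) {Φ : M → ℝ × ℝ} {x : M}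
    (hΦ : MDifferentiableAt 𝓘(ℝ, E) 𝓘(ℝ, ℝ × ℝ) Φ x) (h : ∀ᶠ y in 𝓝 x, rad (Φ y) = 1) :
    σ.poissonBracket (fun y ↦ (Φ y).1) (fun y ↦ (Φ y).2) x = 0 := by
  have hd : HasFDerivAt (fun p : ℝ × ℝ ↦ p.1 ^ 2 + p.2 ^ 2)
      ((2 * (Φ x).1) • ContinuousLinearMap.fst ℝ ℝ ℝ +
        (2 * (Φ x).2) • ContinuousLinearMap.snd ℝ ℝ ℝ) (Φ x) := by
    have h1 := (hasFDerivAt_fst (𝕜 := ℝ) (p := Φ x)).pow 2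
    have h2 := (hasFDerivAt_snd (𝕜 := ℝ) (p := Φ x)).pow 2
    exact (h1.add h2).congr_fderiv (by simp)
  have h1 := mvfderiv_comp_plane hΦ hd.differentiableAt
  have h2 : mvfderiv 𝓘(ℝ, E) (fun y ↦ (Φ y).1 ^ 2 + (Φ y).2 ^ 2) x = 0 := by
    have e : (fun y ↦ (Φ y).1 ^ 2 + (Φ y).2 ^ 2) =ᶠ[𝓝 x] fun _ ↦ (1 : ℝ) := h.mono fun y hy ↦ by
      simp only
      rw [← rad_sq, hy, one_pow]
    have e2 := e.mfderiv_eq (I := 𝓘(ℝ, E)) (I' := 𝓘(ℝ, ℝ))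
    rw [mfderiv_const] at e2
    exact e2
  rw [h2, hd.fderiv] at h1
  simp only [add_apply, smul_apply,
    ContinuousLinearMap.coe_fst', ContinuousLinearMap.coe_snd', smul_eq_mul, mul_one, mul_zero,
    add_zero, zero_add] at h1
  set F : M → ℝ := fun y ↦ (Φ y).1
  set G : M → ℝ := fun y ↦ (Φ y).2
  have h3 : ∀ v, 2 * (Φ x).1 * mvfderiv 𝓘(ℝ, E) F x v + 2 * (Φ x).2 * mvfderiv 𝓘(ℝ, E) G x v = 0 :=
    fun v ↦ (DFunLike.congr_fun h1 v).symm
  -- Evaluating `Φ₁ dΦ₁ + Φ₂ dΦ₂ = 0` on the two Hamiltonian vectors shows that both components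
  -- times the bracket vanish; the components are not both zero.
  have h4 : 2 * (Φ x).2 * σ.poissonBracket F G x = 0 := by
    have := h3 (σ.hamiltonianVector F x)
    have e : mvfderiv 𝓘(ℝ, E) F x (σ.hamiltonianVector F x) = 0 := by
      rw [← form_hamiltonianVector, σ.alternating]
    rw [e, mul_zero, zero_add] at this
    exact this
  have h5 : 2 * (Φ x).1 * σ.poissonBracket F G x = 0 := by
    have := h3 (σ.hamiltonianVector G x)
    have e : mvfderiv 𝓘(ℝ, E) G x (σ.hamiltonianVector G x) = 0 := by
      rw [← form_hamiltonianVector, σ.alternating]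
    have e2 : mvfderiv 𝓘(ℝ, E) F x (σ.hamiltonianVector G x) = -σ.poissonBracket F G x := by
      rw [poissonBracket_eq_form, ← form_hamiltonianVector, form_swap]
    rw [e, mul_zero, add_zero, e2] at this
    linarith
  have h6 := h.self_of_nhds
  have h7 := rad_sq (Φ x)
  rw [h6] at h7
  have : σ.poissonBracket F G x * (1 ^ 2) = 0 := by
    rw [h7]
    linear_combination (Φ x).1 / 2 * h5 + (Φ x).2 / 2 * h4
  linarith

end SymplecticForm

/-! ### Moving the marked points on the disc -/

/-- Rotation of the plane by the angle `h`. -/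
noncomputable def rotate (h : ℝ) (p : ℝ × ℝ) : ℝ × ℝ :=
  (p.1 * Real.cos h - p.2 * Real.sin h, p.1 * Real.sin h + p.2 * Real.cos h)

theorem rotate_zero (p : ℝ × ℝ) : rotate 0 p = p := by simp [rotate]

theorem rotate_circ (h t : ℝ) : rotate h (circ t) = circ (t + h) := by
  simp only [rotate, circ, Real.cos_add, Real.sin_add]
  ext <;> ring

theorem rad_rotate (h : ℝ) (p : ℝ × ℝ) : rad (rotate h p) = rad p := by
  rw [← sq_eq_sq₀ (rad_nonneg _) (rad_nonneg _), rad_sq, rad_sq, rotate]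
  linear_combination (p.1 ^ 2 + p.2 ^ 2) * Real.cos_sq_add_sin_sq h

theorem contDiff_rotate : ContDiff ℝ ∞ fun q : ℝ × (ℝ × ℝ) ↦ rotate q.1 q.2 := by
  have h1 : ContDiff ℝ ∞ fun q : ℝ × (ℝ × ℝ) ↦ Real.cos q.1 := Real.contDiff_cos.comp contDiff_fst
  have h2 : ContDiff ℝ ∞ fun q : ℝ × (ℝ × ℝ) ↦ Real.sin q.1 := Real.contDiff_sin.comp contDiff_fst
  have h3 : ContDiff ℝ ∞ fun q : ℝ × (ℝ × ℝ) ↦ q.2.1 := contDiff_fst.comp contDiff_snd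
  have h4 : ContDiff ℝ ∞ fun q : ℝ × (ℝ × ℝ) ↦ q.2.2 := contDiff_snd.comp contDiff_snd
  exact ((h3.mul h1).sub (h4.mul h2)).prodMk ((h3.mul h2).add (h4.mul h1))

/-- Compact sets have compact neighbourhoods that keep all empty intersections empty. -/
theorem exists_compact_nhds_disjoint {ι M : Type*} [Finite ι] [TopologicalSpace M] [T2Space M]
    [LocallyCompactSpace M] {X U : ι → Set M} (hX : ∀ i, IsCompact (X i)) (hU : ∀ i, IsOpen (U i))
    (hXU : ∀ i, X i ⊆ U i) : ∃ K : ι → Set M, (∀ i, IsCompact (K i)) ∧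
      (∀ i, X i ⊆ interior (K i)) ∧ (∀ i, K i ⊆ U i) ∧
      ∀ i j, X i ∩ X j = ∅ → K i ∩ K j = ∅ := by
  have hsep : ∀ i j, ∃ A B : Set M, IsOpen A ∧ IsOpen B ∧ X i ⊆ A ∧ X j ⊆ B ∧
      (X i ∩ X j = ∅ → Disjoint A B) := by
    intro i j
    by_cases h : X i ∩ X j = ∅
    · obtain ⟨A, B, hA, hB, hiA, hjB, hAB⟩ :=
        SeparatedNhds.of_isCompact_isCompact (hX i) (hX j) (disjoint_iff_inter_eq_empty.2 h)
      exact ⟨A, B, hA, hB, hiA, hjB, fun _ ↦ hAB⟩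
    · exact ⟨univ, univ, isOpen_univ, isOpen_univ, subset_univ _, subset_univ _,
        fun h' ↦ absurd h' h⟩
  choose A B hA hB hXA hXB hAB using hsep
  have hex : ∀ i, ∃ K, IsCompact K ∧ X i ⊆ interior K ∧
      K ⊆ U i ∩ ((⋂ j, A i j) ∩ ⋂ j, B j i) := fun i ↦
    exists_compact_between (hX i) ((hU i).inter ((isOpen_iInter_of_finite fun j ↦ hA i j).inter
      (isOpen_iInter_of_finite fun j ↦ hB j i)))
      (subset_inter (hXU i) (subset_inter (subset_iInter fun j ↦ hXA i j)
        (subset_iInter fun j ↦ hXB j i)))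
  choose K hK hXK hKU using hex
  refine ⟨K, hK, hXK, fun i ↦ (hKU i).trans inter_subset_left, fun i j h ↦ ?_⟩
  rw [eq_empty_iff_forall_notMem]
  rintro x ⟨hi, hj⟩
  exact (hAB i j h).ne_of_mem (mem_iInter.1 (hKU i hi).2.1 j) (mem_iInter.1 (hKU j hj).2.2 i) rfl

/-- If a point lies in some of the cyclically intersecting sets, it lies in one or in two
consecutive ones. -/
theorem exists_first_of_cyclic {n : ℕ} (hn : 3 ≤ n) {I : Set (Fin (n + 1))}
    (hI : ∀ i ∈ I, ∀ j ∈ I, i = j - 1 ∨ i = j ∨ i = j + 1) (hne : I.Nonempty) :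
    ∃ i ∈ I, ∀ j ∈ I, j = i ∨ j = i + 1 := by
  -- This needs at least four indices: modulo 3, `i - 2` and `i + 1` coincide and three sets could
  -- share a point.
  have h3 : (1 + 1 + 1 : Fin (n + 1)) ≠ 0 := by
    obtain ⟨m, rfl⟩ : ∃ m, n = m + 3 := ⟨n - 3, by omega⟩
    intro h
    have := congrArg Fin.val h
    simp [Fin.val_add] at this
    rw [Nat.mod_eq_of_lt (by omega)] at this
    omega
  obtain ⟨i, hi⟩ := hne
  by_cases hi' : i - 1 ∈ I
  · refine ⟨i - 1, hi', fun j hj ↦ ?_⟩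
    rcases hI j hj (i - 1) hi' with h | h | h
    · rcases hI j hj i hi with h' | h' | h'
      · exact Or.inl h'
      · right; rw [h']; abel
      · exfalso
        apply h3
        have : i + 1 - (i - 1 - 1) = 0 := by rw [← h, h', sub_self]
        rw [← this]; abel
    · exact Or.inl h
    · exact Or.inr h
  · refine ⟨i, hi, fun j hj ↦ ?_⟩
    rcases hI j hj i hi with h | h | h
    · exact absurd (h ▸ hj) hi'
    · exact Or.inl h
    · exact Or.inr h

section

variable {E : Type*} [NormedAddCommGroup E] [NormedSpace ℝ E] [FiniteDimensional ℝ E]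
  {M : Type*} [TopologicalSpace M] [T2Space M] [SecondCountableTopology M]
  [ChartedSpace E M] [IsManifold 𝓘(ℝ, E) ∞ M]

/-- Suppose that `Ψ` maps neighbourhoods of cyclically intersecting compact sets to circular arcs.
Rotating `Ψ` by a suitable function near these sets, one can prescribe other arcs, without
increasing the Poisson bracket. -/
theorem exists_rotated_map (σ : SymplecticForm E M) {n : ℕ} (hn : 3 ≤ n)
    {X : Fin (n + 1) → Set M} (hX : ∀ i, IsCompact (X i)) (hcyc : IntersectCyclically X)
    {Ψ : M → ℝ × ℝ} (hΨ : ContMDiff 𝓘(ℝ, E) 𝓘(ℝ, ℝ × ℝ) ∞ Ψ)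
    {lo hi lo' hi' : Fin (n + 1) → ℝ} {k : Fin (n + 1) → ℤ}
    (hlen : ∀ i, hi i < lo i + 2 * Real.pi)
    (hsrc : ∀ i, ∃ U, IsOpen U ∧ X i ⊆ U ∧ ∀ y ∈ U, ∃ t ∈ Icc (lo i) (hi i), Ψ y = circ t)
    (hglue : ∀ i, ∀ s ∈ Icc (lo i) (hi i), ∀ t ∈ Icc (lo (i + 1)) (hi (i + 1)),
      circ s = circ t → t = s + k i * (2 * Real.pi))
    (hle : ∀ i, lo' i ≤ hi' i)
    (hglue' : ∀ i, hi' i + k i * (2 * Real.pi) ∈ Icc (lo' (i + 1)) (hi' (i + 1))) :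
    ∃ Ψ' : M → ℝ × ℝ, ContMDiff 𝓘(ℝ, E) 𝓘(ℝ, ℝ × ℝ) ∞ Ψ' ∧
      (∃ L, IsCompact L ∧ ∀ x ∉ L, Ψ' x = Ψ x) ∧
      (∀ i, ∃ U, IsOpen U ∧ X i ⊆ U ∧ ∀ y ∈ U, ∃ t ∈ Icc (lo' i) (hi' i), Ψ' y = circ t) ∧
      ∀ x, |σ.poissonBracket (fun y ↦ (Ψ' y).1) (fun y ↦ (Ψ' y).2) x| ≤
        |σ.poissonBracket (fun y ↦ (Ψ y).1) (fun y ↦ (Ψ y).2) x| := by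
  have : LocallyCompactSpace M := ChartedSpace.locallyCompactSpace E M
  have hpi := Real.pi_pos
  choose U hU hXU hUΨ using hsrc
  obtain ⟨K, hK, hXK, hKU, hKdisj⟩ := exists_compact_nhds_disjoint hX hU hXU
  -- The branch is centred at the middle of an arc shorter than a full turn, so the cut misses the
  -- arc and `θ i` is smooth at the points of `U i`.
  set θ : Fin (n + 1) → M → ℝ := fun i y ↦ angleFrom ((lo i + hi i) / 2) (Ψ y) with hθ
  have hθU : ∀ i, ∀ y ∈ U i, θ i y ∈ Icc (lo i) (hi i) ∧ Ψ y = circ (θ i y) := by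
    intro i y hy
    obtain ⟨t, ht, hty⟩ := hUΨ i y hy
    have h1 := hlen i
    have : θ i y = t := by
      simp only [hθ, hty]
      have := angleFrom_smul_circ (m := (lo i + hi i) / 2) (t := t) one_pos
        (by linarith [ht.1, ht.2]) (by linarith [ht.1, ht.2])
      rwa [one_smul] at this
    rw [this]
    exact ⟨ht, hty⟩
  have hθs : ∀ i, ∀ y ∈ U i, ContMDiffAt 𝓘(ℝ, E) 𝓘(ℝ, ℝ) ∞ (θ i) y := by
    intro i y hy
    obtain ⟨ht, hty⟩ := hθU i y hy
    have h1 := hlen i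
    have h2 := contDiffAt_angleFrom (m := (lo i + hi i) / 2) (t := θ i y) one_pos
        (by linarith [ht.1, ht.2]) (by linarith [ht.1, ht.2])
    rw [one_smul, ← hty] at h2
    exact h2.contMDiffAt.comp y hΨ.contMDiffAt
  obtain ⟨L, hL, hKL, hLU⟩ := exists_compact_between (isCompact_iUnion hK) (isOpen_iUnion hU)
    (iUnion_mono hKU)
  -- The permitted rotation angles at `y`. Being convex, they allow smooth local choices to be
  -- averaged into a global one.
  set S : M → Set ℝ := fun y ↦
    {h | (∀ i, y ∈ K i → θ i y + h ∈ Icc (lo' i) (hi' i)) ∧ (y ∉ interior L → h = 0)} with hS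
  have hconv : ∀ y, Convex ℝ (S y) := by
    intro y a ha b hb p q hp hq hpq
    refine ⟨fun i hi ↦ ?_, fun hy ↦ ?_⟩
    · have := convex_Icc (lo' i) (hi' i) (ha.1 i hi) (hb.1 i hi) hp hq hpq
      convert this using 1
      simp only [smul_eq_mul]
      linear_combination (-θ i y) * hpq
    · rw [ha.2 hy, hb.2 hy]; simp
  have hloc : ∀ x : M, ∃ W ∈ 𝓝 x, ∃ g : M → ℝ, ContMDiffOn 𝓘(ℝ, E) 𝓘(ℝ, ℝ) ∞ g W ∧
      ∀ y ∈ W, g y ∈ S y := by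
    intro x
    have hW₀ : (⋂ i, {y | y ∈ K i → x ∈ K i}) ∈ 𝓝 x := by
      rw [Filter.iInter_mem]
      intro i
      by_cases h : x ∈ K i
      · simp [h]
      · filter_upwards [(hK i).isClosed.isOpen_compl.mem_nhds h] with y hy hy'
        exact absurd hy' hy
    by_cases hne : {i | x ∈ K i}.Nonempty
    -- Near `x` only `K i` and `K (i + 1)` impose conditions. Rotating to the end of the new `i`-th
    -- arc satisfies the first; by `hglue` and `hglue'` it also satisfies the second.
    · obtain ⟨i, hi, hmax⟩ := exists_first_of_cyclic hn (I := {i | x ∈ K i}) (by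
        intro i hi j hj
        by_contra! h
        have := hKdisj i j (hcyc i j h.1 h.2.1 h.2.2)
        exact notMem_empty x (this ▸ ⟨hi, hj⟩)) hne
      have hxL : interior L ∈ 𝓝 x := isOpen_interior.mem_nhds (hKL (mem_iUnion.2 ⟨i, hi⟩))
      refine ⟨_, Filter.inter_mem (Filter.inter_mem hW₀ hxL) ((hU i).mem_nhds (hKU i hi)),
        fun y ↦ hi' i - θ i y, ?_, ?_⟩
      · rintro y ⟨-, hy⟩
        exact (contMDiffAt_const.sub (hθs i y hy)).contMDiffWithinAt
      · rintro y ⟨⟨hy0, hyL⟩, hyU⟩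
        refine ⟨fun j hj ↦ ?_, fun h ↦ absurd hyL h⟩
        have hxj : x ∈ K j := mem_iInter.1 hy0 j hj
        rcases hmax j hxj with rfl | rfl
        · rw [add_sub_cancel]
          exact ⟨hle _, le_rfl⟩
        · obtain ⟨h1, h2⟩ := hθU i y hyU
          obtain ⟨h3, h4⟩ := hθU (i + 1) y (hKU _ hj)
          have h5 := hglue i _ h1 _ h3 (h2.symm.trans h4)
          rw [h5, show θ i y + k i * (2 * Real.pi) + (hi' i - θ i y) =
            hi' i + k i * (2 * Real.pi) by ring]
          exact hglue' i
    · refine ⟨_, hW₀, fun _ ↦ 0, contMDiffOn_const, fun y hy ↦ ⟨fun i hi ↦ ?_, fun _ ↦ rfl⟩⟩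
      exact absurd ⟨i, mem_iInter.1 hy i hi⟩ hne
  obtain ⟨h, hh⟩ := exists_contMDiffMap_forall_mem_convex_of_local 𝓘(ℝ, E) hconv hloc
  have hs : ContMDiff 𝓘(ℝ, E) 𝓘(ℝ, ℝ) ∞ h := h.contMDiff
  set Ψ' : M → ℝ × ℝ := fun y ↦ rotate (h y) (Ψ y) with hΨ'
  have hΨ's : ContMDiff 𝓘(ℝ, E) 𝓘(ℝ, ℝ × ℝ) ∞ Ψ' :=
    contDiff_rotate.contMDiff.comp (hs.prodMk_space hΨ)
  have hoff : ∀ x ∉ L, Ψ' x = Ψ x := by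
    intro x hx
    simp only [hΨ']
    rw [(hh x).2 fun h' ↦ hx (interior_subset h'), rotate_zero]
  refine ⟨Ψ', hΨ's, ⟨L, hL, hoff⟩, fun i ↦ ⟨interior (K i), isOpen_interior, hXK i, fun y hy ↦ ?_⟩,
    fun x ↦ ?_⟩
  · have hyK := interior_subset hy
    refine ⟨θ i y + h y, (hh y).1 i hyK, ?_⟩
    simp only [hΨ']
    rw [(hθU i y (hKU i hyK)).2, rotate_circ]
  -- On the sets `U i` the new map still has values in the circle, so its bracket is zero; elsewhere
  -- it agrees locally with `Ψ`.
  · by_cases hx : x ∈ ⋃ i, U i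
    · have : ∀ᶠ y in 𝓝 x, rad (Ψ' y) = 1 := by
        filter_upwards [(isOpen_iUnion hU).mem_nhds hx] with y hy
        obtain ⟨i, hi⟩ := mem_iUnion.1 hy
        simp only [hΨ']
        rw [rad_rotate, (hθU i y hi).2]
        have := rad_smul_circ zero_le_one (θ i y)
        rwa [one_smul] at this
      rw [σ.poissonBracket_eq_zero_of_circle (hΨ's.mdifferentiableAt (by simp)) this, abs_zero]
      exact abs_nonneg _
    · have : Ψ' =ᶠ[𝓝 x] Ψ := by
        filter_upwards [hL.isClosed.isOpen_compl.mem_nhds fun hxL ↦ hx (hLU hxL)] with y hy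
        exact hoff y hy
      rw [σ.poissonBracket_congr this]

end

/-! ### Comparison of the invariants -/

/-- The successor of `a i` in a cyclic sequence of angles. -/
noncomputable def nextVal {N : ℕ} (a : Fin N → ℝ) (i : Fin N) : ℝ :=
  if h : (i : ℕ) + 1 < N then a ⟨i + 1, h⟩ else a ⟨0, i.pos⟩ + 2 * Real.pi

theorem MarkedDomain.nextAngle_eq {N : ℕ} (D : MarkedDomain N) : D.nextAngle = nextVal D.angle :=
  rfl

theorem map_nextVal {N : ℕ} {f : ℝ → ℝ} (hf : ∀ t, f (t + 2 * Real.pi) = f t + 2 * Real.pi)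
    (a : Fin N → ℝ) (i : Fin N) : f (nextVal a i) = nextVal (fun j ↦ f (a j)) i := by
  rw [nextVal, nextVal]
  split_ifs
  · rfl
  · exact hf _

/-- A strictly increasing sequence of angles spanning less than a full turn. -/
structure IsCyclicAngle {N : ℕ} (a : Fin N → ℝ) : Prop where
  strictMono : StrictMono a
  lt_add (i j : Fin N) : a j < a i + 2 * Real.pi

theorem MarkedDomain.isCyclicAngle {N : ℕ} (D : MarkedDomain N) : IsCyclicAngle D.angle :=
  ⟨D.angle_strictMono, D.angle_lt⟩

theorem IsCyclicAngle.map {N : ℕ} {a : Fin N → ℝ} (ha : IsCyclicAngle a) {f : ℝ → ℝ}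
    (hf : StrictMono f) (hf' : ∀ t, f (t + 2 * Real.pi) = f t + 2 * Real.pi) :
    IsCyclicAngle fun i ↦ f (a i) :=
  ⟨hf.comp ha.strictMono, fun i j ↦ by rw [← hf']; exact hf (ha.lt_add i j)⟩

theorem IsCyclicAngle.lt_nextVal {N : ℕ} {a : Fin N → ℝ} (ha : IsCyclicAngle a) (i : Fin N) :
    a i < nextVal a i := by
  rw [nextVal]
  split_ifs with h
  · exact ha.strictMono (by rw [Fin.lt_def]; simp)
  · exact ha.lt_add _ _

theorem IsCyclicAngle.nextVal_lt {N : ℕ} (hN : 2 ≤ N) {a : Fin N → ℝ} (ha : IsCyclicAngle a)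
    (i : Fin N) : nextVal a i < a i + 2 * Real.pi := by
  rw [nextVal]
  split_ifs with h
  · exact ha.lt_add _ _
  · have : a ⟨0, i.pos⟩ < a i := ha.strictMono (by rw [Fin.lt_def]; simp; omega)
    linarith

theorem eq_of_circ_eq {s t : ℝ} (h : circ s = circ t) (h1 : t < s + 2 * Real.pi)
    (h2 : s < t + 2 * Real.pi) : s = t := by
  obtain ⟨k, hk⟩ := circ_eq_circ h
  have hpi := Real.two_pi_pos
  have h3 : (k : ℝ) < 1 := by
    by_contra! h
    nlinarith
  have h4 : (-1 : ℝ) < k := by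
    by_contra! h
    nlinarith
  have : k = 0 := by
    have h3' : k < 1 := by exact_mod_cast h3
    have h4' : -1 < k := by exact_mod_cast h4
    omega
  rw [hk, this]; simp

/-- A monotone surjection between index sets: it starts at the first index, ends at the last one,
and advances by at most one. -/
structure IsStepMap {n N : ℕ} (e : Fin (n + 1) → Fin N) : Prop where
  zero : (e 0 : ℕ) = 0
  last : (e (Fin.last n) : ℕ) + 1 = N
  step (i : Fin (n + 1)) : i ≠ Fin.last n → e (i + 1) = e i ∨ (e (i + 1) : ℕ) = e i + 1

/-- The number of turns gained in passing from the `i`-th index to the next. -/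
def turn {n : ℕ} (i : Fin (n + 1)) : ℤ := if i = Fin.last n then -1 else 0

theorem nextVal_of_succ {N : ℕ} (a : Fin N → ℝ) {i j : Fin N} (h : (j : ℕ) = i + 1) :
    nextVal a i = a j := by
  rw [nextVal, dif_pos (h ▸ j.isLt)]
  congr 1
  exact Fin.ext h.symm

theorem nextVal_of_last {N : ℕ} (a : Fin N → ℝ) {i j : Fin N} (h : (i : ℕ) + 1 = N)
    (hj : (j : ℕ) = 0) : nextVal a i = a j + 2 * Real.pi := by
  rw [nextVal, dif_neg (by omega)]
  congr 2
  exact Fin.ext hj.symm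

/-- An arc, or two consecutive ones, spans less than a full turn when `N ≥ 3`, so the angle of a
common point is unambiguous apart from the turn at the wrap-around. Two arcs filling the circle
would meet at both ends. -/
theorem IsCyclicAngle.eq_add_turn {n N : ℕ} (hN : 3 ≤ N) {a : Fin N → ℝ} (ha : IsCyclicAngle a)
    {e : Fin (n + 1) → Fin N} (he : IsStepMap e) (i : Fin (n + 1)) {s t : ℝ}
    (hs : s ∈ Icc (a (e i)) (nextVal a (e i)))
    (ht : t ∈ Icc (a (e (i + 1))) (nextVal a (e (i + 1)))) (h : circ s = circ t) :
    t = s + turn i * (2 * Real.pi) := by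
  have hlen := ha.nextVal_lt (by omega : 2 ≤ N)
  by_cases hi : i = Fin.last n
  · rw [turn, if_pos hi]
    subst hi
    rw [Fin.last_add_one] at ht
    rw [nextVal_of_last a he.last he.zero] at hs
    have h1 : (⟨1, by omega⟩ : Fin N) < e (Fin.last n) := by
      rw [Fin.lt_def]; simp only; have := he.last; omega
    have h2 : nextVal a (e 0) = a ⟨1, by omega⟩ := nextVal_of_succ a (by simp [he.zero])
    rw [h2] at ht
    have h3 := ha.strictMono h1
    have h4 : s = t + 2 * Real.pi := eq_of_circ_eq (by rw [circ_add_two_pi]; exact h)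
      (by linarith [hs.1, hs.2, ht.1, ht.2]) (by linarith [hs.1, hs.2, ht.1, ht.2, Real.pi_pos])
    rw [h4]; push_cast; ring
  · rw [turn, if_neg hi]
    have hst : s = t := by
      rcases he.step i hi with h1 | h1
      · rw [h1] at ht
        have := hlen (e i)
        exact eq_of_circ_eq h (by linarith [hs.1, hs.2, ht.1, ht.2])
          (by linarith [hs.1, hs.2, ht.1, ht.2])
      · rw [nextVal_of_succ a h1] at hs
        have h2 : nextVal a (e (i + 1)) < a (e i) + 2 * Real.pi := by
          rw [nextVal]
          split_ifs with h3
          · exact ha.lt_add _ _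
          · have : a ⟨0, (e (i + 1)).pos⟩ < a (e i) := ha.strictMono (by
              rw [Fin.lt_def]; simp only; omega)
            linarith
        exact eq_of_circ_eq h (by linarith [hs.1, hs.2, ht.1, ht.2])
          (by linarith [hs.1, hs.2, ht.1, ht.2, Real.pi_pos])
    rw [hst]; simp

/-- The end of an arc is the start of the next one or, if the index is repeated, the end of the same
arc. This is the hypothesis `hglue'` of `exists_rotated_map`. -/
theorem nextVal_add_turn_mem {n N : ℕ} {b : Fin N → ℝ} (hb : ∀ i, b i ≤ nextVal b i)
    {e : Fin (n + 1) → Fin N} (he : IsStepMap e) (i : Fin (n + 1)) :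
    nextVal b (e i) + turn i * (2 * Real.pi) ∈ Icc (b (e (i + 1))) (nextVal b (e (i + 1))) := by
  by_cases hi : i = Fin.last n
  · rw [turn, if_pos hi]
    subst hi
    rw [Fin.last_add_one, nextVal_of_last b he.last he.zero]
    have : b (e 0) + 2 * Real.pi + ((-1 : ℤ) : ℝ) * (2 * Real.pi) = b (e 0) := by
      push_cast; ring
    rw [this]
    exact ⟨le_rfl, hb _⟩
  · rw [turn, if_neg hi, Int.cast_zero, zero_mul, add_zero]
    rcases he.step i hi with h1 | h1
    · rw [h1]; exact ⟨hb _, le_rfl⟩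
    · rw [nextVal_of_succ b h1]; exact ⟨le_rfl, hb _⟩

section

variable {E : Type*} [NormedAddCommGroup E] [NormedSpace ℝ E] [FiniteDimensional ℝ E]
  {M : Type*} [TopologicalSpace M] [T2Space M] [SecondCountableTopology M]
  [ChartedSpace E M] [IsManifold 𝓘(ℝ, E) ∞ M]

/-- An admissible map for one marked domain gives an admissible map for another one, with almost
the same bound on the Poisson bracket. -/
theorem exists_admissible_of_admissible (σ : SymplecticForm E M) {n N₁ N₂ : ℕ} (hn : 3 ≤ n)
    (hN₁ : 3 ≤ N₁) {X : Fin (n + 1) → Set M} (hX : ∀ i, IsCompact (X i))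
    (hcyc : IntersectCyclically X) (D₁ : MarkedDomain N₁) (D₂ : MarkedDomain N₂)
    {X₁ : Fin N₁ → Set M} {X₂ : Fin N₂ → Set M}
    {e₁ : Fin (n + 1) → Fin N₁} {e₂ : Fin (n + 1) → Fin N₂}
    (he₁ : IsStepMap e₁) (he₂ : IsStepMap e₂) (hX₁ : ∀ i, X i ⊆ X₁ (e₁ i))
    (hX₂ : ∀ j, ∀ x ∈ X₂ j, ∃ i, e₂ i = j ∧ x ∈ X i) {ε : ℝ} (hε : 0 < ε)
    {Φ : M → ℝ × ℝ} (hΦ : IsAdmissible E D₁ X₁ Φ) :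
    ∃ Φ', IsAdmissible E D₂ X₂ Φ' ∧
      ∀ x, |σ.poissonBracket (fun y ↦ (Φ' y).1) (fun y ↦ (Φ' y).2) x| ≤
        (1 + ε) ^ 6 * |σ.poissonBracket (fun y ↦ (Φ y).1) (fun y ↦ (Φ y).2) x| := by
  obtain ⟨φ, T₁, hφ, hφe, hT₁, -, hT₁j, hT₁b⟩ := D₁.exists_map_to_disc hε
  obtain ⟨ψ, T₂, hψ, hψc, hψe, hT₂, hT₂m, hT₂j, hT₂b⟩ := D₂.exists_map_from_disc hε
  have hpi := Real.pi_pos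
  set a : Fin N₁ → ℝ := fun i ↦ φ (D₁.angle i) with ha
  have hac : IsCyclicAngle a := D₁.isCyclicAngle.map hφ hφe
  have hψs := surjective_of_add_two_pi hψ hψc hψe
  -- Since `ψ` need not be injective, preimages of the marked angles are chosen; monotonicity still
  -- sends the arcs between them into the arcs of `D₂`.
  choose b hb using fun i ↦ hψs (D₂.angle i)
  have hbn : ∀ i, ψ (nextVal b i) = D₂.nextAngle i := fun i ↦ by
    rw [map_nextVal hψe, D₂.nextAngle_eq]
    simp only [hb]
  have hble : ∀ i, b i ≤ nextVal b i := fun i ↦ by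
    refine (hψ.reflect_lt ?_).le
    rw [hb, hbn]
    exact D₂.isCyclicAngle.lt_nextVal i
  set Ψ : M → ℝ × ℝ := fun x ↦ T₁ (Φ x) with hΨ
  have hΨs : ContMDiff 𝓘(ℝ, E) 𝓘(ℝ, ℝ × ℝ) ∞ Ψ := hT₁.contMDiff.comp hΦ.smooth
  obtain ⟨Ψ', hΨ's, ⟨L, hL, hΨ'L⟩, hΨ'arc, hΨ'pb⟩ := exists_rotated_map σ hn hX hcyc hΨs
    (lo := fun i ↦ a (e₁ i)) (hi := fun i ↦ nextVal a (e₁ i))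
    (lo' := fun i ↦ b (e₂ i)) (hi' := fun i ↦ nextVal b (e₂ i)) (k := turn)
    (fun i ↦ hac.nextVal_lt (by omega) _)
    (fun i ↦ by
      obtain ⟨U, hU, hXU, hUarc⟩ := hΦ.maps_arc (e₁ i)
      refine ⟨U, hU, (hX₁ i).trans hXU, fun y hy ↦ ?_⟩
      obtain ⟨hfr, t, ht, hray⟩ := hUarc (mem_image_of_mem Φ hy)
      refine ⟨φ t, ⟨hφ.monotone ht.1, ?_⟩, hT₁b _ hfr t hray⟩
      rw [ha, ← map_nextVal hφe]
      exact hφ.monotone ht.2)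
    (fun i s hs t ht h ↦ hac.eq_add_turn hN₁ he₁ i hs ht h)
    (fun i ↦ hble _) (fun i ↦ nextVal_add_turn_mem hble he₂ i)
  refine ⟨fun x ↦ T₂ (Ψ' x), ⟨hT₂.contMDiff.comp hΨ's, fun x ↦ hT₂m _, ?_, fun j ↦ ?_⟩,
    fun x ↦ ?_⟩
  · obtain ⟨p, -, hp1, hp2⟩ := hΦ.compactSupport
    have hconst : ∀ x ∉ L ∪ (tsupport (fun x ↦ (Φ x).1 - p.1) ∪ tsupport fun x ↦ (Φ x).2 - p.2),
        Ψ' x = T₁ p := by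
      intro x hx
      simp only [mem_union, not_or] at hx
      have e1 : (Φ x).1 - p.1 = 0 :=
        image_eq_zero_of_notMem_tsupport (f := fun x ↦ (Φ x).1 - p.1) hx.2.1
      have e2 : (Φ x).2 - p.2 = 0 :=
        image_eq_zero_of_notMem_tsupport (f := fun x ↦ (Φ x).2 - p.2) hx.2.2
      rw [hΨ'L x hx.1, hΨ]
      simp only
      congr 1
      exact Prod.ext (sub_eq_zero.1 e1) (sub_eq_zero.1 e2)
    have hcpt := hL.union (hp1.isCompact.union hp2.isCompact)
    refine ⟨T₂ (T₁ p), hT₂m _, HasCompactSupport.intro hcpt fun x hx ↦ ?_,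
      HasCompactSupport.intro hcpt fun x hx ↦ ?_⟩
    · rw [hconst x hx, sub_self]
    · rw [hconst x hx, sub_self]
  · choose V hV hXV hVarc using hΨ'arc
    refine ⟨⋃ i ∈ {i | e₂ i = j}, V i, isOpen_biUnion fun i _ ↦ hV i, fun x hx ↦ ?_, ?_⟩
    · obtain ⟨i, hi, hxi⟩ := hX₂ j x hx
      exact mem_biUnion hi (hXV i hxi)
    · rintro _ ⟨y, hy, rfl⟩
      obtain ⟨i, rfl, hyi⟩ := mem_iUnion₂.1 hy
      obtain ⟨t, ht, hyt⟩ := hVarc i y hyi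
      simp only [hyt]
      refine ⟨(hT₂b t).1, ψ t, ⟨?_, ?_⟩, (hT₂b t).2⟩
      · rw [← hb]; exact hψ ht.1
      · rw [← hbn]; exact hψ ht.2
  · rw [σ.poissonBracket_comp (hΨ's.mdifferentiableAt (by simp))
      (hT₂.differentiable (by simp) _), abs_mul]
    have h1 := hΨ'pb x
    rw [hΨ, σ.poissonBracket_comp (hΦ.smooth.mdifferentiableAt (by simp))
      (hT₁.differentiable (by simp) _), abs_mul] at h1
    calc _ ≤ (1 + ε) / Real.pi * ((1 + ε) ^ 5 * Real.pi *
          |σ.poissonBracket (fun y ↦ (Φ y).1) (fun y ↦ (Φ y).2) x|) := by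
          gcongr
          · exact hT₂j _
          · exact h1.trans (by gcongr; exact hT₁j _)
      _ = _ := by field_simp

/-- Each `ε` has its own competitor, at the cost of a factor `(1 + ε) ^ 6`; the infimum absorbs this
as `ε → 0`. -/
theorem Pb_le_Pb (σ : SymplecticForm E M) {n N₁ N₂ : ℕ} (hn : 3 ≤ n)
    (hN₁ : 3 ≤ N₁) {X : Fin (n + 1) → Set M} (hX : ∀ i, IsCompact (X i))
    (hcyc : IntersectCyclically X) (D₁ : MarkedDomain N₁) (D₂ : MarkedDomain N₂)
    {X₁ : Fin N₁ → Set M} {X₂ : Fin N₂ → Set M}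
    {e₁ : Fin (n + 1) → Fin N₁} {e₂ : Fin (n + 1) → Fin N₂}
    (he₁ : IsStepMap e₁) (he₂ : IsStepMap e₂) (hX₁ : ∀ i, X i ⊆ X₁ (e₁ i))
    (hX₂ : ∀ j, ∀ x ∈ X₂ j, ∃ i, e₂ i = j ∧ x ∈ X i) :
    Pb σ D₂ X₂ ≤ Pb σ D₁ X₁ := by
  refine le_iInf₂ fun Φ hΦ ↦ ?_
  set s := ⨆ x : M, ‖σ.poissonBracket (fun y ↦ (Φ y).1) (fun y ↦ (Φ y).2) x‖ₑ with hs
  have hbound : ∀ ε : ℝ, 0 < ε → Pb σ D₂ X₂ ≤ ENNReal.ofReal ((1 + ε) ^ 6) * s := by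
    intro ε hε
    obtain ⟨Φ', hΦ', hle⟩ := exists_admissible_of_admissible σ hn hN₁ hX hcyc D₁ D₂ he₁ he₂ hX₁ hX₂
      hε hΦ
    refine (iInf₂_le Φ' hΦ').trans (iSup_le fun x ↦ ?_)
    refine le_trans ?_ (mul_le_mul_right (le_iSup _ x) _)
    rw [← ofReal_norm, ← ofReal_norm, ← ENNReal.ofReal_mul (by positivity)]
    exact ENNReal.ofReal_le_ofReal (hle x)
  have hlim : Filter.Tendsto (fun ε : ℝ ↦ ENNReal.ofReal ((1 + ε) ^ 6) * s) (𝓝[>] 0) (𝓝 (1 * s)) := by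
    -- The limit factor 1 is nonzero, so the case `s = ∞` is included.
    refine ENNReal.Tendsto.mul_const ?_ (Or.inl one_ne_zero)
    have hc : Continuous fun ε : ℝ ↦ ENNReal.ofReal ((1 + ε) ^ 6) :=
      ENNReal.continuous_ofReal.comp (by fun_prop)
    have := hc.tendsto 0
    simp only [add_zero, one_pow, ENNReal.ofReal_one] at this
    exact this.mono_left nhdsWithin_le_nhds
  rw [one_mul] at hlim
  exact ge_of_tendsto hlim (by
    filter_upwards [self_mem_nhdsWithin] with ε hε using hbound ε hε)

end

/-! ### Index maps for merging the last two sets -/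

theorem isStepMap_id (n : ℕ) : IsStepMap (id : Fin (n + 1) → Fin (n + 1)) where
  zero := rfl
  last := rfl
  step i hi := Or.inr (by
    rw [id, id, Fin.val_add_one, if_neg hi])

/-- The map of indices that identifies the last two. -/
def mergeIndex {n : ℕ} (hn : 0 < n) (i : Fin (n + 1)) : Fin n :=
  ⟨min i (n - 1), by omega⟩

theorem isStepMap_mergeIndex {n : ℕ} (hn : 0 < n) : IsStepMap (mergeIndex hn) where
  zero := by simp [mergeIndex]
  last := by simp [mergeIndex]; omega
  step i hi := by
    have h1 : ((i + 1 : Fin (n + 1)) : ℕ) = i + 1 := by rw [Fin.val_add_one, if_neg hi]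
    have h2 : (i : ℕ) < n := by
      have := Fin.lt_last_iff_ne_last.2 hi
      simpa [Fin.lt_def] using this
    simp only [mergeIndex, h1, Fin.mk.injEq]
    omega

theorem subset_mergeLastTwo {n : ℕ} (hn : 0 < n) {M : Type*} (X : Fin (n + 1) → Set M)
    (i : Fin (n + 1)) : X i ⊆ mergeLastTwo X (mergeIndex hn i) := by
  rw [mergeLastTwo]
  have hi := i.isLt
  split_ifs with h
  · simp only [mergeIndex] at h
    rcases Nat.lt_or_ge i n with h1 | h1
    · refine subset_union_of_subset_left (subset_of_eq ?_) _
      congr 1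
      ext
      simp [mergeIndex]
      omega
    · refine subset_union_of_subset_right (subset_of_eq ?_) _
      congr 1
      ext
      simp
      omega
  · simp only [mergeIndex] at h
    refine subset_of_eq ?_
    congr 1
    ext
    simp [mergeIndex]
    omega

theorem exists_mem_of_mem_mergeLastTwo {n : ℕ} (hn : 0 < n) {M : Type*} (X : Fin (n + 1) → Set M)
    (j : Fin n) {x : M} (hx : x ∈ mergeLastTwo X j) : ∃ i, mergeIndex hn i = j ∧ x ∈ X i := by
  have hj := j.isLt
  have hcast : mergeIndex hn j.castSucc = j := by
    ext; simp [mergeIndex]; omega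
  rw [mergeLastTwo] at hx
  split_ifs at hx with h
  · rcases hx with hx | hx
    · exact ⟨_, hcast, hx⟩
    · refine ⟨Fin.last n, ?_, hx⟩
      ext; simp [mergeIndex]; omega
  · exact ⟨_, hcast, hx⟩

/-- Here `N = n + 1 ≥ 4`. The two values of the invariant may be computed with any two marked
domains, one with `N` and one with `N - 1` marked points. -/
theorem mainTheorem2 {E : Type*} [NormedAddCommGroup E] [NormedSpace ℝ E] [FiniteDimensional ℝ E]
    {M : Type*} [TopologicalSpace M] [T2Space M] [SecondCountableTopology M]
    [ChartedSpace E M] [IsManifold 𝓘(ℝ, E) ∞ M] (σ : SymplecticForm E M)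
    (n : ℕ) (hn : 4 ≤ n + 1) (X : Fin (n + 1) → Set M)
    (hX : ∀ i, IsCompact (X i)) (hcyc : IntersectCyclically X)
    (D : MarkedDomain (n + 1)) (D' : MarkedDomain n) :
    Pb σ D X = Pb σ D' (mergeLastTwo X) := by
  have hn3 : 3 ≤ n := by omega
  have hn0 : 0 < n := by omega
  -- First the shared arc of the last two sets is split in two, then two arcs are merged into one.
  apply le_antisymm
  · exact Pb_le_Pb σ hn3 hn3 hX hcyc D' D (isStepMap_mergeIndex hn0) (isStepMap_id n)
      (subset_mergeLastTwo hn0 X) fun j x hx ↦ ⟨j, rfl, hx⟩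
  · exact Pb_le_Pb σ hn3 (by omega) hX hcyc D D' (isStepMap_id n) (isStepMap_mergeIndex hn0)
      (fun i ↦ subset_rfl) fun j x hx ↦ exists_mem_of_mem_mergeLastTwo hn0 X j hx
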